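/- **Setting.** Let $M$ be a smooth ($C^\infty$) manifold of dimension $n$ (Hausdorff, second countable) and $F:TM\to[0,\infty)$ a Finsler structure: $F$ is smooth on $TM\setminus0$, $F(x,\lambda y)=\lambda F(x,y)$ for $\lambda>0$, and $g_{ij}=\tfrac12\,\partial^2(F^2)/\partial y^i\partial y^j$ is positive definite on $TM\setminus 0$. Let $\delta\in\mathbb R$, let $\pi:TM\setminus 0\to M$ be the projection, and let $u:T^*(TM\setminus0)\to\pi^*(T^*M)$ be any smooth vector bundle morphism over $TM\setminus0$; put $d_r(\log F)=(u\circ d\log F)_r$. Summation over repeated indices is understood, indices are raised with $g^{ij}$, and $\mathrm{Sym}_{i,j}\,T_{ij}=T_{ij}+T_{ji}$. In local coordinates $(x^i,y^i)$ put $$A_{ijk}=\tfrac F2\,\frac{\partial g_{ij}}{\partial y^k},\quad \omega_i=\frac{\partial F}{\partial y^i},\quad N^k_m=\tfrac14\frac{\partial}{\partial y^m}\Big(g^{ks}\big(\tfrac{\partial g_{si}}{\partial x^j}+\tfrac{\partial g_{sj}}{\partial x^i}-\tfrac{\partial g_{ij}}{\partial x^s}\big)y^iy^j\Big),$$ $$\gamma^k_{ij}=\tfrac12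 g^{ks}\Big(\tfrac{\partial g_{si}}{\partial x^j}+\tfrac{\partial g_{sj}}{\partial x^i}-\tfrac{\partial g_{ij}}{\partial x^s}\Big)-g^{ks}\Big(\tfrac{N^m_j}{F}A_{msi}+\tfrac{N^m_i}{F}A_{msj}-\tfrac{N^m_s}{F}A_{mij}\Big)$$ (the Chern connection), and $$B^k_{ij}=\big(A^{kr}_i\omega_j+A^{kr}_j\omega_i-A^k_{ij}\omega^r-A^r_{ij}\omega^k-A^k_{is}A^{sr}_j-A^k_{js}A^{sr}_i+A^{rk}_uA^u_{ij}\big)\,d_r(\log F).$$ **The operator.** Let $\mathcal X$ be a smooth nowhere-vanishing vector field on $M$. From now on, in each of $g_{ij},g^{ij},\gamma^k_{ij},B^k_{ij}$ the fibre variable $y$ is replaced by $\mathcal X(x)$; in particular $\gamma$ becomes a linear connection on $M$, and for $P\in S\Gamma(TM^{\otimes2})\otimes\mathcal F_\delta(M)$ (smooth symmetric twice contravariant tensor densities of weight $\delta$) $$D_sP^{ij}=\partial_sP^{ij}+\gamma^i_{sm}P^{mj}+\gamma^j_{sm}P^{im}-\delta\,\gamma^t_{ts}P^{ij}.$$ Let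 $f\in\mathrm{Diff}(M)$ act on geometric objects on $M$ by push-forward $f^*$ (on $\delta$-densities, $f^*\phi=\phi\circ f^{-1}\cdot |J_{f^{-1}}|^{\delta}$; on operators, $f^*T=f^*\circ T\circ (f^*)^{-1}$), so that $(f^{-1})^*$ is pull-back by $f$, and put $\ell(f)=(f^{-1})^*\gamma-\gamma$. Define $\breve{\mathcal A}(f)$ in local coordinates by $(\breve{\mathcal A}(f)P)^k=\breve{\mathcal A}(f)^k_{ij}P^{ij}$, where $$\begin{aligned}\breve{\mathcal A}(f)^k_{ij}={}&(f^{-1})^*\big(g^{sk}g_{ij}D_s\big)-g^{sk}g_{ij}D_s+(2-\delta n)\Big(\ell(f)^k_{ij}-\tfrac1n\,\mathrm{Sym}_{i,j}\,\delta^k_i\,\ell(f)^t_{tj}\Big)\\&+g^{kl}\big(\mathrm{Sym}_{i,j}\,g_{sj}B^s_{li}-\delta\,g_{ij}B^t_{lt}\big)-(f^{-1})^*\Big(g^{kl}\big(\mathrm{Sym}_{i,j}\,g_{sj}B^s_{li}-\delta\,g_{ij}B^t_{lt}\big)\Big)\\&-(2-\delta n)\Big((f^{-1})^*B^k_{ij}-B^k_{ij}-\tfrac1n\,\mathrm{Sym}_{i,j}\,\delta^k_i\big((f^{-1})^*B^t_{jt}-B^t_{jt}\big)\Big).\end{aligned}$$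 **Proposition 4.3.** These local expressions define, for every $f\in\mathrm{Diff}(M)$, a linear differential operator $\breve{\mathcal A}(f)$ with smooth coefficients from $S\Gamma(TM^{\otimes2})\otimes\mathcal F_\delta(M)$ to $\Gamma(TM)\otimes\mathcal F_\delta(M)$, and $f\mapsto\breve{\mathcal A}(f^{-1})$ is a 1-cocycle on $\mathrm{Diff}(M)$ with values in the space of such operators: $$\breve{\mathcal A}\big((f\circ h)^{-1}\big)=f^*\,\breve{\mathcal A}(h^{-1})+\breve{\mathcal A}(f^{-1})\qquad\text{for all } f,h\in\mathrm{Diff}(M).$$ -/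

import Mathlib

open scoped Manifold ContDiff

set_option linter.unusedSectionVars false

noncomputable section

namespace Finsler

/-- The coordinate space `ℝⁿ`. -/
abbrev Coord (n : ℕ) : Type := EuclideanSpace ℝ (Fin n)

/-- Partial derivative of `h` in the `i`-th coordinate. -/
def pd {n : ℕ} (i : Fin n) (h : Coord n → ℝ) (x : Coord n) : ℝ :=
  fderiv ℝ h x (EuclideanSpace.single i 1)

/-- Kronecker delta. -/
def kron {n : ℕ} (i j : Fin n) : ℝ := if i = j then 1 else 0

/-! ### Finsler geometry in one coordinate system

`Φ x y` is the Finsler function in the coordinates `(xⁱ, yⁱ)`. -/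

section Local

variable {n : ℕ} (Φ : Coord n → Coord n → ℝ)

/-- `g_{ij} = ½ ∂²(F²)/∂yⁱ∂yʲ`. -/
def gLow (x y : Coord n) : Matrix (Fin n) (Fin n) ℝ :=
  Matrix.of fun i j => (1 / 2) * pd i (fun y' => pd j (fun y'' => Φ x y'' ^ 2) y') y

/-- `g^{ij}`. -/
def gUp (x y : Coord n) : Matrix (Fin n) (Fin n) ℝ := (gLow Φ x y)⁻¹

/-- The Cartan tensor `A_{ijk} = (F/2) ∂g_{ij}/∂yᵏ`. -/
def cartan (x y : Coord n) (i j k : Fin n) : ℝ :=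
  Φ x y / 2 * pd k (fun y' => gLow Φ x y' i j) y

/-- `A^k_{ij} = A_{ijl} g^{lk}`. -/
def cartanUp (x y : Coord n) (k i j : Fin n) : ℝ :=
  ∑ l, cartan Φ x y i j l * gUp Φ x y l k

/-- `A^{kr}_i = A_{iab} g^{ak} g^{br}`. -/
def cartanUpUp (x y : Coord n) (k r i : Fin n) : ℝ :=
  ∑ a, ∑ b, cartan Φ x y i a b * gUp Φ x y a k * gUp Φ x y b r

/-- The Hilbert form `ω_i = ∂F/∂yⁱ`. -/
def hilbert (x y : Coord n) (i : Fin n) : ℝ := pd i (fun y' => Φ x y') y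

/-- `ω^i = g^{ij} ω_j`. -/
def hilbertUp (x y : Coord n) (i : Fin n) : ℝ := ∑ j, gUp Φ x y i j * hilbert Φ x y j

/-- `g^{ks} (∂g_{si}/∂xʲ + ∂g_{sj}/∂xⁱ - ∂g_{ij}/∂xˢ)`. -/
def formalSymbol (x y : Coord n) (k i j : Fin n) : ℝ :=
  ∑ s, gUp Φ x y k s *
    (pd j (fun x' => gLow Φ x' y s i) x + pd i (fun x' => gLow Φ x' y s j) x
      - pd s (fun x' => gLow Φ x' y i j) x)

/-- `N^k_m = ¼ ∂/∂yᵐ (g^{ks} (∂g_{si}/∂xʲ + ∂g_{sj}/∂xⁱ - ∂g_{ij}/∂xˢ) yʲ yⁱ)`. -/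
def nonlin (x y : Coord n) (k m : Fin n) : ℝ :=
  (1 / 4) * pd m (fun y' => ∑ i, ∑ j, formalSymbol Φ x y' k i j * y' j * y' i) y

/-- The Christoffel symbols `γ^k_{ij}` of the Chern connection. -/
def chern (x y : Coord n) (k i j : Fin n) : ℝ :=
  (1 / 2) * formalSymbol Φ x y k i j
    - ∑ s, gUp Φ x y k s * ∑ m,
        (nonlin Φ x y m j / Φ x y * cartan Φ x y m s i
          + nonlin Φ x y m i / Φ x y * cartan Φ x y m s j
          - nonlin Φ x y m s / Φ x y * cartan Φ x y m i j)

/-- `B^k_{ij}`, where `d r` stands for `d_r (log F)`. -/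
def bTensor (d : Fin n → ℝ) (x y : Coord n) (k i j : Fin n) : ℝ :=
  ∑ r, (cartanUpUp Φ x y k r i * hilbert Φ x y j
      + cartanUpUp Φ x y k r j * hilbert Φ x y i
      - cartanUp Φ x y k i j * hilbertUp Φ x y r
      - cartanUp Φ x y r i j * hilbertUp Φ x y k
      - ∑ s, cartanUp Φ x y k i s * cartanUpUp Φ x y s r j
      - ∑ s, cartanUp Φ x y k j s * cartanUpUp Φ x y s r i
      + ∑ u, cartanUpUp Φ x y r k u * cartanUp Φ x y u i j) * d r

end Local

/-! ### Charts and diffeomorphisms -/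

section Charts

variable (n : ℕ) (M : Type*) [TopologicalSpace M] [ChartedSpace (Coord n) M]

/-- The coordinate systems of `M`: all charts of the maximal smooth atlas. -/
def Chart : Type _ := {e : OpenPartialHomeomorph M (Coord n) // e ∈ IsManifold.maximalAtlas (𝓡 n) ∞ M}

/-- `Diff(M)`. -/
abbrev Diff : Type _ := M ≃ₘ^∞⟮𝓡 n, 𝓡 n⟯ M

variable {n M}

/-- The chart `e ∘ f`. -/
def Chart.comp [IsManifold (𝓡 n) ∞ M] (e : Chart n M) (f : Diff n M) : Chart n M :=
  ⟨f.toHomeomorph.transOpenPartialHomeomorph e.1, by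
    apply OpenPartialHomeomorph.mem_maximalAtlas_of_contMDiffOn
    · exact (contMDiffOn_of_mem_maximalAtlas e.2).comp f.contMDiff.contMDiffOn (fun _ h => h)
    · exact f.symm.contMDiff.comp_contMDiffOn (contMDiffOn_symm_of_mem_maximalAtlas e.2)⟩

/-- Jacobian matrix `∂x'^a/∂xⁱ` at `x` of the change of coordinates from `e` to `e'`. -/
def Chart.jac (e e' : Chart n M) (x : Coord n) : Matrix (Fin n) (Fin n) ℝ :=
  Matrix.of fun a i => pd i (fun z => e'.1 (e.1.symm z) a) x

end Charts

variable {n : ℕ} {M : Type*} [TopologicalSpace M] [ChartedSpace (Coord n) M]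
  [IsManifold (𝓡 n) ∞ M]

theorem Chart.comp_symm_comp (e : Chart n M) (f : Diff n M) : (e.comp f).comp f.symm = e := by
  apply Subtype.ext
  change f.symm.toHomeomorph.transOpenPartialHomeomorph
    (f.toHomeomorph.transOpenPartialHomeomorph e.1) = e.1
  refine OpenPartialHomeomorph.ext _ _ (fun x => ?_) (fun x => ?_) ?_
  · change e.1 (f (f.symm x)) = e.1 x
    rw [f.apply_symm_apply]
  · change f (f.symm (e.1.symm x)) = e.1.symm x
    rw [f.apply_symm_apply]
  · ext x
    change f (f.symm x) ∈ e.1.source ↔ x ∈ e.1.source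
    rw [f.apply_symm_apply]

theorem Chart.jac_comp (e e' : Chart n M) (f : Diff n M) :
    (e.comp f).jac (e'.comp f) = e.jac e' := by
  funext x
  ext a i
  have : (fun z => (e'.comp f).1 ((e.comp f).1.symm z) a) = fun z => e'.1 (e.1.symm z) a := by
    funext z
    change e'.1 (f (f.symm (e.1.symm z))) a = _
    rw [f.apply_symm_apply]
  simp only [Chart.jac, Matrix.of_apply, this]

/-- The overlap of two charts, read in the coordinates of `e`. -/
def Chart.overlap (e e' : Chart n M) : Set (Coord n) :=
  {x | x ∈ e.1.target ∧ e.1.symm x ∈ e'.1.source}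

theorem Chart.overlap_comp (e e' : Chart n M) (f : Diff n M) :
    (e.comp f).overlap (e'.comp f) = e.overlap e' := by
  ext x
  change (x ∈ e.1.target ∧ f (f.symm (e.1.symm x)) ∈ e'.1.source) ↔ _
  rw [f.apply_symm_apply]
  rfl

/-! ### Tensor densities -/

variable (n M) in
/-- `S Γ(TM^{⊗2}) ⊗ 𝓕_δ(M)`: smooth symmetric twice contravariant tensor densities of weight `δ`,
given by their components in all coordinate systems (extended by zero off the coordinate domain). -/
def SymDensity (δ : ℝ) : Submodule ℝ (Chart n M → Coord n → Matrix (Fin n) (Fin n) ℝ) where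
  carrier := {P |
    (∀ e i j, ContDiffOn ℝ ∞ (fun x => P e x i j) e.1.target) ∧
    (∀ e x, x ∉ e.1.target → P e x = 0) ∧
    (∀ e x i j, P e x i j = P e x j i) ∧
    ∀ e e' x, x ∈ Chart.overlap e e' →
      P e' (e'.1 (e.1.symm x)) =
        |(e.jac e' x).det| ^ (-δ) • (e.jac e' x * P e x * (e.jac e' x).transpose)}
  add_mem' := by
    rintro P Q ⟨h1, h2, h3, h4⟩ ⟨k1, k2, k3, k4⟩
    refine ⟨fun e i j => (h1 e i j).add (k1 e i j), fun e x hx => ?_, fun e x i j => ?_,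
      fun e e' x hx => ?_⟩
    · simp [h2 e x hx, k2 e x hx]
    · simp [h3 e x i j, k3 e x i j]
    · simp [h4 e e' x hx, k4 e e' x hx, mul_add, add_mul]
  zero_mem' := ⟨fun _ _ _ => contDiffOn_const, by simp, by simp, by simp⟩
  smul_mem' := by
    rintro c P ⟨h1, h2, h3, h4⟩
    refine ⟨fun e i j => contDiffOn_const.mul (h1 e i j), fun e x hx => ?_, fun e x i j => ?_,
      fun e e' x hx => ?_⟩
    · simp [h2 e x hx]
    · simp [h3 e x i j]
    · simp [h4 e e' x hx, smul_comm c]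

variable (n M) in
/-- `Γ(TM) ⊗ 𝓕_δ(M)`: smooth vector densities of weight `δ`, given by their components in all
coordinate systems (extended by zero off the coordinate domain). -/
def VecDensity (δ : ℝ) : Submodule ℝ (Chart n M → Coord n → Fin n → ℝ) where
  carrier := {V |
    (∀ e k, ContDiffOn ℝ ∞ (fun x => V e x k) e.1.target) ∧
    (∀ e x, x ∉ e.1.target → V e x = 0) ∧
    ∀ e e' x, x ∈ Chart.overlap e e' →
      V e' (e'.1 (e.1.symm x)) =
        |(e.jac e' x).det| ^ (-δ) • ((e.jac e' x).mulVec (V e x))}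
  add_mem' := by
    rintro P Q ⟨h1, h2, h4⟩ ⟨k1, k2, k4⟩
    refine ⟨fun e i => (h1 e i).add (k1 e i), fun e x hx => ?_, fun e e' x hx => ?_⟩
    · simp [h2 e x hx, k2 e x hx]
    · simp [h4 e e' x hx, k4 e e' x hx, Matrix.mulVec_add]
  zero_mem' := ⟨fun _ _ => contDiffOn_const, by simp, by simp⟩
  smul_mem' := by
    rintro c P ⟨h1, h2, h4⟩
    refine ⟨fun e i => contDiffOn_const.mul (h1 e i), fun e x hx => ?_, fun e e' x hx => ?_⟩
    · simp [h2 e x hx]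
    · simp [h4 e e' x hx, Matrix.mulVec_smul, smul_comm c]

/-- The action of `f ∈ Diff(M)` on `S Γ(TM^{⊗2}) ⊗ 𝓕_δ(M)` (push-forward). The components of the
push-forward of `P` in the chart `e` are those of `P` in the chart `e ∘ f`. -/
def SymDensity.push {δ : ℝ} (f : Diff n M) : SymDensity n M δ →ₗ[ℝ] SymDensity n M δ where
  toFun P := ⟨fun e => P.1 (e.comp f),
    fun e i j => P.2.1 (e.comp f) i j,
    fun e x hx => P.2.2.1 (e.comp f) x hx,
    fun e x i j => P.2.2.2.1 (e.comp f) x i j,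
    fun e e' x hx => by
      have h := P.2.2.2.2 (e.comp f) (e'.comp f) x (by rwa [Chart.overlap_comp])
      rw [Chart.jac_comp] at h
      rw [← h]
      change _ = P.1 (e'.comp f) (e'.1 (f (f.symm (e.1.symm x))))
      rw [f.apply_symm_apply]⟩
  map_add' _ _ := rfl
  map_smul' _ _ := rfl

/-- The action of `f ∈ Diff(M)` on `Γ(TM) ⊗ 𝓕_δ(M)` (push-forward). -/
def VecDensity.push {δ : ℝ} (f : Diff n M) : VecDensity n M δ →ₗ[ℝ] VecDensity n M δ where
  toFun V := ⟨fun e => V.1 (e.comp f),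
    fun e k => V.2.1 (e.comp f) k,
    fun e x hx => V.2.2.1 (e.comp f) x hx,
    fun e e' x hx => by
      have h := V.2.2.2 (e.comp f) (e'.comp f) x (by rwa [Chart.overlap_comp])
      rw [Chart.jac_comp] at h
      rw [← h]
      change _ = V.1 (e'.comp f) (e'.1 (f (f.symm (e.1.symm x))))
      rw [f.apply_symm_apply]⟩
  map_add' _ _ := rfl
  map_smul' _ _ := rfl

/-! ### Differential operators -/

/-- Coefficients `a^k_{ij,I}(x)` of a differential operator in one coordinate system; the multi-index
`I : Fin m → Fin n` stands for `∂_{I 0} ⋯ ∂_{I (m-1)}`. -/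
abbrev Coeffs (n : ℕ) : Type :=
  (m : ℕ) → (Fin m → Fin n) → Fin n → Fin n → Fin n → Coord n → ℝ

/-- The value at `x` of `∑_{m ≤ N} a^k_{ij,I} ∂_I P^{ij}`. -/
def Coeffs.eval {n : ℕ} (a : Coeffs n) (N : ℕ) (p : Coord n → Matrix (Fin n) (Fin n) ℝ)
    (x : Coord n) (k : Fin n) : ℝ :=
  ∑ m ∈ Finset.range (N + 1), ∑ I : Fin m → Fin n, ∑ i, ∑ j,
    a m I k i j x *
      iteratedFDeriv ℝ m (fun z => p z i j) x (fun l => EuclideanSpace.single (I l) 1)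

/-- `T` is a linear differential operator of order at most `N` with smooth coefficients. -/
def HasOrder {δ : ℝ} (N : ℕ) (T : SymDensity n M δ →ₗ[ℝ] VecDensity n M δ) : Prop :=
  ∀ e : Chart n M, ∃ a : Coeffs n,
    (∀ m I k i j, ContDiffOn ℝ ∞ (a m I k i j) e.1.target) ∧
    ∀ P : SymDensity n M δ, ∀ x ∈ e.1.target, ∀ k, (T P).1 e x k = a.eval N (P.1 e) x k

theorem Coeffs.eval_add {n : ℕ} (a b : Coeffs n) (N : ℕ)
    (p : Coord n → Matrix (Fin n) (Fin n) ℝ) (x : Coord n) (k : Fin n) :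
    Coeffs.eval (fun m I k i j x => a m I k i j x + b m I k i j x) N p x k
      = a.eval N p x k + b.eval N p x k := by
  simp only [Coeffs.eval, add_mul, Finset.sum_add_distrib]

theorem HasOrder.mono {δ : ℝ} {N N' : ℕ} (h : N ≤ N')
    {T : SymDensity n M δ →ₗ[ℝ] VecDensity n M δ} (hT : HasOrder N T) : HasOrder N' T := by
  intro e
  obtain ⟨a, ha, hT⟩ := hT e
  refine ⟨fun m I k i j x => if m ≤ N then a m I k i j x else 0, fun m I k i j => ?_,
    fun P x hx k => ?_⟩
  · by_cases hm : m ≤ N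
    · simpa only [hm, if_true] using ha m I k i j
    · simp only [hm, if_false]
      exact contDiffOn_const
  · rw [hT P x hx k, Coeffs.eval, Coeffs.eval]
    have hs : Finset.range (N + 1) ⊆ Finset.range (N' + 1) :=
      Finset.range_subset_range.2 (by omega)
    rw [← Finset.sum_subset hs]
    · refine Finset.sum_congr rfl fun m hm => ?_
      have hm' : m ≤ N := by have := Finset.mem_range.1 hm; omega
      simp only [hm', if_true]
    · intro m _ hm
      have hm' : ¬ m ≤ N := by rw [Finset.mem_range] at hm; omega
      simp [hm']

variable (n M) in
/-- `𝒟(S Γ(TM^{⊗2}) ⊗ 𝓕_δ(M), Γ(TM) ⊗ 𝓕_δ(M))`: the linear differential operators. -/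
def DiffOp (δ : ℝ) : Submodule ℝ (SymDensity n M δ →ₗ[ℝ] VecDensity n M δ) where
  carrier := {T | ∃ N, HasOrder N T}
  add_mem' := by
    rintro S T ⟨N, hS⟩ ⟨N', hT⟩
    refine ⟨max N N', fun e => ?_⟩
    obtain ⟨a, ha, hS⟩ := hS.mono (le_max_left N N') e
    obtain ⟨b, hb, hT⟩ := hT.mono (le_max_right N N') e
    refine ⟨_, fun m I k i j => (ha m I k i j).add (hb m I k i j), fun P x hx k => ?_⟩
    have := Coeffs.eval_add a b (max N N') (P.1 e) x k
    rw [← hS P x hx k, ← hT P x hx k] at this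
    exact this.symm
  zero_mem' := ⟨0, fun _ => ⟨fun _ _ _ _ _ _ => 0, fun _ _ _ _ _ => contDiffOn_const,
    fun P x _ k => by simp [Coeffs.eval]⟩⟩
  smul_mem' := by
    rintro c T ⟨N, hT⟩
    refine ⟨N, fun e => ?_⟩
    obtain ⟨a, ha, hT⟩ := hT e
    refine ⟨fun m I k i j x => c * a m I k i j x,
      fun m I k i j => contDiffOn_const.mul (ha m I k i j), fun P x hx k => ?_⟩
    have : (((c • T) P).1 e x k) = c * (T P).1 e x k := rfl
    rw [this, hT P x hx k]
    simp only [Coeffs.eval, Finset.mul_sum, mul_assoc]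

/-- The natural action of `f ∈ Diff(M)` on differential operators: `T ↦ f_* ∘ T ∘ (f_*)⁻¹`. -/
def DiffOp.act {δ : ℝ} (f : Diff n M) (T : DiffOp n M δ) : DiffOp n M δ :=
  ⟨VecDensity.push f ∘ₗ T.1 ∘ₗ SymDensity.push f.symm, by
    obtain ⟨N, hT⟩ := T.2
    refine ⟨N, fun e => ?_⟩
    obtain ⟨a, ha, hT⟩ := hT (e.comp f)
    refine ⟨a, ha, fun P x hx k => ?_⟩
    have h := hT (SymDensity.push f.symm P) x hx k
    have hP : (SymDensity.push f.symm P).1 (e.comp f) = P.1 e :=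
      congrArg P.1 (Chart.comp_symm_comp e f)
    rw [hP] at h
    exact h⟩

/-- `c` is a 1-cocycle on `Diff(M)`: `c(f ∘ h) = f · c(h) + c(f)`. -/
def IsOneCocycle {δ : ℝ} (c : Diff n M → DiffOp n M δ) : Prop :=
  ∀ f h : Diff n M, c (h.trans f) = DiffOp.act f (c h) + c f

/-! ### Finsler manifolds -/

/-- The slit tangent bundle `TM \ 0`. -/
def slit : Set (TangentBundle (𝓡 n) M) := {p | p.2 ≠ 0}

/-- The tangent vector with coordinates `(x, y)` in the chart `e`. -/
def Chart.point (e : Chart n M) (x y : Coord n) : TangentBundle (𝓡 n) M :=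
  ⟨e.1.symm x, mfderiv (𝓡 n) (𝓡 n) e.1.symm x y⟩

/-- A function on `TM` in the coordinates `(x, y)` of the chart `e`. -/
def inCoords (F : TangentBundle (𝓡 n) M → ℝ) (e : Chart n M) (x y : Coord n) : ℝ := F (e.point x y)

/-- `F` is a Finsler structure on `M`. -/
structure IsFinsler (F : TangentBundle (𝓡 n) M → ℝ) : Prop where
  nonneg : ∀ p, 0 ≤ F p
  smooth : ContMDiffOn (𝓡 n).tangent 𝓘(ℝ, ℝ) ∞ F slit
  homogeneous : ∀ (x : M) (y : TangentSpace (𝓡 n) x) (c : ℝ), 0 < c →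
    F ⟨x, c • y⟩ = c * F ⟨x, y⟩
  posDef : ∀ (e : Chart n M), ∀ x ∈ e.1.target, ∀ y ≠ 0, (gLow (inCoords F e) x y).PosDef

variable (n M) in
/-- A smooth vector bundle morphism `u : T^*(TM \ 0) → π^*(T^*M)` over `TM \ 0` (its values over the
zero section are irrelevant). Smoothness says that `u (dh)` has smooth components for all smooth
functions `h` on `TM \ 0`. -/
structure CotangentMorphism where
  toFun : (p : TangentBundle (𝓡 n) M) →
    (TangentSpace (𝓡 n).tangent p →L[ℝ] ℝ) →ₗ[ℝ] (TangentSpace (𝓡 n) p.1 →L[ℝ] ℝ)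
  smooth : ∀ h : TangentBundle (𝓡 n) M → ℝ,
    ContMDiffOn (𝓡 n).tangent 𝓘(ℝ, ℝ) ∞ h slit → ∀ (e : Chart n M) (r : Fin n),
      ContDiffOn ℝ ∞
        (fun z : Coord n × Coord n =>
          toFun (e.point z.1 z.2) (mfderiv (𝓡 n).tangent 𝓘(ℝ, ℝ) h (e.point z.1 z.2))
            (mfderiv (𝓡 n) (𝓡 n) e.1.symm z.1 (EuclideanSpace.single r 1)))
        (e.1.target ×ˢ {0}ᶜ)

/-- The components `d_r (log F)`, `d_r = u ∘ d`, at `(x, y)` in the chart `e`. -/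
def dLog (u : CotangentMorphism n M) (F : TangentBundle (𝓡 n) M → ℝ) (e : Chart n M)
    (x y : Coord n) (r : Fin n) : ℝ :=
  u.toFun (e.point x y)
    (mfderiv (𝓡 n).tangent 𝓘(ℝ, ℝ) (fun q => Real.log (F q)) (e.point x y))
    (mfderiv (𝓡 n) (𝓡 n) e.1.symm x (EuclideanSpace.single r 1))

/-! ### Substituting a vector field for `y` -/

/-- The components of the vector field `X` in the chart `e`. -/
def components (X : (x : M) → TangentSpace (𝓡 n) x) (e : Chart n M) (x : Coord n) : Coord n :=
  mfderiv (𝓡 n) (𝓡 n) e.1 (e.1.symm x) (X (e.1.symm x))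

/-- Substitution of `X` for `y` in a family of component functions of `(x, y)`. -/
def subst {V : Type*} (X : (x : M) → TangentSpace (𝓡 n) x)
    (φ : Chart n M → Coord n → Coord n → V) (e : Chart n M) (x : Coord n) : V :=
  φ e x (components X e x)

/-- Pull-back by `f`, i.e. the action of `f⁻¹`, of a geometric object on `M` given by its local
expressions: the expression of the pull-back in `e` is that of the object in `e ∘ f⁻¹`. -/
def pullback {V : Type*} (f : Diff n M) (φ : Chart n M → V) (e : Chart n M) : V :=
  φ (e.comp f.symm)

section Operator

variable (F : TangentBundle (𝓡 n) M → ℝ) (X : (x : M) → TangentSpace (𝓡 n) x)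

/-- `g_{ij}` along `X`. -/
def gLowX : Chart n M → Coord n → Matrix (Fin n) (Fin n) ℝ :=
  subst X fun e => gLow (inCoords F e)

/-- `g^{ij}` along `X`. -/
def gUpX : Chart n M → Coord n → Matrix (Fin n) (Fin n) ℝ :=
  subst X fun e => gUp (inCoords F e)

/-- The Christoffel symbols `γ^k_{ij}` of the Chern connection along `X`. -/
def chernX : Chart n M → Coord n → Fin n → Fin n → Fin n → ℝ :=
  subst X fun e => chern (inCoords F e)

/-- `B^k_{ij}` along `X`. -/
def bX (u : CotangentMorphism n M) : Chart n M → Coord n → Fin n → Fin n → Fin n → ℝ :=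
  subst X fun e x y => bTensor (inCoords F e) (dLog u F e x y) x y

/-- `D_s P^{ij} = ∂_s P^{ij} + γ^i_{sm} P^{mj} + γ^j_{sm} P^{im} - δ γ^t_{ts} P^{ij}`. -/
def covDeriv (δ : ℝ) (e : Chart n M) (p : Coord n → Matrix (Fin n) (Fin n) ℝ) (x : Coord n)
    (s i j : Fin n) : ℝ :=
  pd s (fun z => p z i j) x + ∑ m, chernX F X e x i s m * p x m j
    + ∑ m, chernX F X e x j s m * p x i m - δ * (∑ t, chernX F X e x t t s) * p x i j

/-- The operator `g^{sk} g_{ij} D_s`. -/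
def gD (δ : ℝ) (e : Chart n M) (p : Coord n → Matrix (Fin n) (Fin n) ℝ) (x : Coord n)
    (k : Fin n) : ℝ :=
  ∑ s, ∑ i, ∑ j, gUpX F X e x s k * gLowX F X e x i j * covDeriv F X δ e p x s i j

/-- `ℓ(f)^k_{ij}`: the pull-back of `γ` by `f`, minus `γ`. -/
def ell (f : Diff n M) (e : Chart n M) (x : Coord n) (k i j : Fin n) : ℝ :=
  pullback f (chernX F X) e x k i j - chernX F X e x k i j

variable (u : CotangentMorphism n M)

/-- `g^{kl} (Sym_{i,j} g_{sj} B^s_{li} - δ g_{ij} B^t_{lt})`. -/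
def gB (δ : ℝ) (e : Chart n M) (x : Coord n) (k i j : Fin n) : ℝ :=
  ∑ l, gUpX F X e x k l *
    (∑ s, (gLowX F X e x s j * bX F X u e x s l i + gLowX F X e x s i * bX F X u e x s l j)
      - δ * gLowX F X e x i j * ∑ t, bX F X u e x t l t)

/-- The pull-back of `B` by `f`, minus `B`. -/
def deltaB (f : Diff n M) (e : Chart n M) (x : Coord n) (k i j : Fin n) : ℝ :=
  pullback f (bX F X u) e x k i j - bX F X u e x k i j

/-- The zero-order part of the operator. -/
def zeroOrder (δ : ℝ) (f : Diff n M) (e : Chart n M) (x : Coord n) (k i j : Fin n) : ℝ :=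
  (2 - δ * n) * (ell F X f e x k i j
      - 1 / n * (kron i k * ∑ t, ell F X f e x t t j + kron j k * ∑ t, ell F X f e x t t i))
    + gB F X u δ e x k i j - pullback f (gB F X u δ) e x k i j
    - (2 - δ * n) * (deltaB F X u f e x k i j
      - 1 / n * (kron i k * ∑ t, deltaB F X u f e x t j t
        + kron j k * ∑ t, deltaB F X u f e x t i t))

/-- The local expression in the chart `e` of the operator obtained from `𝒜(f)` by substituting the
vector field `X` for `y`, applied to a symmetric tensor density with components `p`. -/
def schwarzian (δ : ℝ) (f : Diff n M) (e : Chart n M)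
    (p : Coord n → Matrix (Fin n) (Fin n) ℝ) (x : Coord n) (k : Fin n) : ℝ :=
  pullback f (gD F X δ) e p x k - gD F X δ e p x k
    + ∑ i, ∑ j, zeroOrder F X u δ f e x k i j * p x i j

end Operator

end Finsler

end

noncomputable section

namespace Finsler

/-! The cocycle relation is formal: it is a telescoping sum. In every chart `e`, the operator
attached to `f` has the form Θ(e ∘ f⁻¹) - Θ(e), where Θ(e) is one local expression built from `g`,
`γ` and `B` along `X`. For the inverse diffeomorphisms this becomes Θ(e ∘ f ∘ h) - Θ(e) = [Θ((e ∘ f)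
∘ h) - Θ(e ∘ f)] + [Θ(e ∘ f) - Θ(e)]. The first bracket is the operator of `h⁻¹` read in the chart e
∘ f, which is the action of `f` on it (`schwarzian_cocycle`).

The substance is that the local expressions define a global operator. Write J and H for the first
and second derivatives of a change of coordinates φ. The spray, the nonlinear connection and the
Chern connection pick up the terms 2H(y,y), H(v,y) and H(v,w) (`spray_eq`, `nonlinMap_eq`,
`chernMap_eq`), whereas `B` is a tensor (`bMap_eq`). These laws are proved for multilinear maps and
Fréchet derivatives, with raised indices tested by lowering them, and only then translated into
components.

Along `X` the connection is linear and torsion-free, so `g^{sk} g_{ij} D_s` maps tensor densities to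
vector densities (`covDeriv_transition`, `gD_transition`). The trace `γ^t_{ts}` compensates the
derivative of the power of the Jacobian determinant. In `ℓ(f)` the two terms H cancel, because e ∘
f⁻¹ and e' ∘ f⁻¹ have the same transition map as e and e' (`transition_comp`, `isTensor_ell`).

Smoothness rests on `F > 0` off the zero section, which follows from Euler's identity `g(y,y) = F²`,
and on `X` having no zeros. -/

/-- The `i`-th coordinate vector. -/
abbrev basisVec {n : ℕ} (i : Fin n) : Coord n := EuclideanSpace.single i 1

theorem sum_smul_basisVec {n : ℕ} (v : Coord n) : ∑ i, v i • basisVec i = v := by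
  ext j
  simp [basisVec, Pi.single_apply]

theorem map_eq_sum {n : ℕ} {V L : Type*} [AddCommGroup V] [Module ℝ V] [FunLike L (Coord n) V]
    [LinearMapClass L ℝ (Coord n) V] (T : L) (v : Coord n) :
    T v = ∑ i, v i • T (basisVec i) := by
  conv_lhs => rw [← sum_smul_basisVec v]
  simp only [map_sum, map_smul]

/-! ### Partial derivatives on a slit tangent bundle in coordinates, and Euler's identities. -/

section PartialDerivatives

variable {n : ℕ} {V : Type*} [NormedAddCommGroup V] [NormedSpace ℝ V]

/-- The derivative of `h x y` in `y`. -/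
def fiberDeriv (h : Coord n → Coord n → V) (x y : Coord n) : Coord n →L[ℝ] V := fderiv ℝ (h x) y

/-- The derivative of `h x y` in `x`. -/
def baseDeriv (h : Coord n → Coord n → V) (x y : Coord n) : Coord n →L[ℝ] V :=
  fderiv ℝ (fun x' => h x' y) x

/-- `h` is smooth on the slit tangent bundle of `U`. -/
def SmoothSlit (U : Set (Coord n)) (h : Coord n → Coord n → V) : Prop :=
  ContDiffOn ℝ ∞ (fun p : Coord n × Coord n => h p.1 p.2) (U ×ˢ {0}ᶜ)

variable {U : Set (Coord n)} {h h' : Coord n → Coord n → V}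

theorem isOpen_slitProd (hU : IsOpen U) : IsOpen (U ×ˢ ({0}ᶜ : Set (Coord n))) :=
  hU.prod isOpen_compl_singleton

theorem SmoothSlit.contDiffAt (hh : SmoothSlit U h) (hU : IsOpen U) {x y : Coord n} (hx : x ∈ U)
    (hy : y ≠ 0) : ContDiffAt ℝ ∞ (fun p : Coord n × Coord n => h p.1 p.2) (x, y) :=
  ContDiffOn.contDiffAt hh ((isOpen_slitProd hU).mem_nhds ⟨hx, hy⟩)

theorem SmoothSlit.mono {W : Set (Coord n)} (hh : SmoothSlit U h) (hW : W ⊆ U) : SmoothSlit W h :=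
  ContDiffOn.mono hh (Set.prod_mono hW subset_rfl)

theorem SmoothSlit.congr (hh : SmoothSlit U h) (H : ∀ x ∈ U, ∀ y ≠ 0, h' x y = h x y) :
    SmoothSlit U h' :=
  ContDiffOn.congr hh fun p hp => H p.1 hp.1 p.2 hp.2

theorem SmoothSlit.contDiffAt_fiber (hh : SmoothSlit U h) (hU : IsOpen U) {x y : Coord n}
    (hx : x ∈ U) (hy : y ≠ 0) : ContDiffAt ℝ ∞ (h x) y :=
  (hh.contDiffAt hU hx hy).comp y (contDiffAt_const.prodMk contDiffAt_id)

theorem SmoothSlit.contDiffAt_base (hh : SmoothSlit U h) (hU : IsOpen U) {x y : Coord n}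
    (hx : x ∈ U) (hy : y ≠ 0) : ContDiffAt ℝ ∞ (fun x' => h x' y) x :=
  (hh.contDiffAt hU hx hy).comp x (contDiffAt_id.prodMk contDiffAt_const)

theorem SmoothSlit.hasFDerivAt_fiber (hh : SmoothSlit U h) (hU : IsOpen U) {x y : Coord n}
    (hx : x ∈ U) (hy : y ≠ 0) : HasFDerivAt (h x) (fiberDeriv h x y) y :=
  ((hh.contDiffAt_fiber hU hx hy).differentiableAt (by simp)).hasFDerivAt

theorem SmoothSlit.hasFDerivAt_base (hh : SmoothSlit U h) (hU : IsOpen U) {x y : Coord n}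
    (hx : x ∈ U) (hy : y ≠ 0) : HasFDerivAt (fun x' => h x' y) (baseDeriv h x y) x :=
  ((hh.contDiffAt_base hU hx hy).differentiableAt (by simp)).hasFDerivAt

/-- Restricting the total derivative to the two coordinate slices gives the partial ones. Hence the
partial derivatives inherit smoothness from the total one, and there is a chain rule for curves
along which base point and fibre variable both move. -/
theorem SmoothSlit.hasFDerivAt (hh : SmoothSlit U h) (hU : IsOpen U) {x y : Coord n} (hx : x ∈ U)
    (hy : y ≠ 0) : HasFDerivAt (fun p : Coord n × Coord n => h p.1 p.2)
      ((baseDeriv h x y).coprod (fiberDeriv h x y)) (x, y) := by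
  have H := ((hh.contDiffAt hU hx hy).differentiableAt (by simp)).hasFDerivAt
  have h1 := HasFDerivAt.comp (g := fun p : Coord n × Coord n => h p.1 p.2)
    (f := fun x' => (x', y)) x H
    (hasFDerivAt_prodMk_left x y)
  have h2 := HasFDerivAt.comp (g := fun p : Coord n × Coord n => h p.1 p.2)
    (f := fun y' => (x, y')) y H
    (hasFDerivAt_prodMk_right x y)
  have e1 : baseDeriv h x y = _ := h1.fderiv
  have e2 : fiberDeriv h x y = _ := h2.fderiv
  have e : (baseDeriv h x y).coprod (fiberDeriv h x y) =
      fderiv ℝ (fun p : Coord n × Coord n => h p.1 p.2) (x, y) :=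
    ContinuousLinearMap.ext fun v => by
      rw [e1, e2, ContinuousLinearMap.coprod_apply, ContinuousLinearMap.comp_apply,
        ContinuousLinearMap.comp_apply, ← map_add]
      simp
  rw [e]
  exact H

theorem SmoothSlit.fiberDeriv (hh : SmoothSlit U h) (hU : IsOpen U) :
    SmoothSlit U (fiberDeriv h) := by
  have H := (ContDiffOn.fderiv_of_isOpen hh (isOpen_slitProd hU) (m := ∞) le_rfl).clm_comp
    (contDiffOn_const (c := ContinuousLinearMap.inr ℝ (Coord n) (Coord n)))
  refine ContDiffOn.congr H fun p hp => ?_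
  rw [(hh.hasFDerivAt hU hp.1 hp.2).fderiv]
  ext v
  simp

theorem SmoothSlit.baseDeriv (hh : SmoothSlit U h) (hU : IsOpen U) :
    SmoothSlit U (baseDeriv h) := by
  have H := (ContDiffOn.fderiv_of_isOpen hh (isOpen_slitProd hU) (m := ∞) le_rfl).clm_comp
    (contDiffOn_const (c := ContinuousLinearMap.inl ℝ (Coord n) (Coord n)))
  refine ContDiffOn.congr H fun p hp => ?_
  rw [(hh.hasFDerivAt hU hp.1 hp.2).fderiv]
  ext v
  simp

theorem SmoothSlit.fiberDeriv_symm (hh : SmoothSlit U h) (hU : IsOpen U) {x y : Coord n}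
    (hx : x ∈ U) (hy : y ≠ 0) (v w : Coord n) :
    Finsler.fiberDeriv (Finsler.fiberDeriv h) x y v w
      = Finsler.fiberDeriv (Finsler.fiberDeriv h) x y w v := by
  have := (hh.contDiffAt_fiber hU hx hy).isSymmSndFDerivAt (by
    rw [minSmoothness_of_isRCLikeNormedField]
    exact WithTop.coe_le_coe.2 (le_top : (2 : ℕ∞) ≤ ⊤))
  exact this v w

theorem fiberDeriv_congr {x y : Coord n} (hy : y ≠ 0) (H : ∀ y ≠ 0, h x y = h' x y) :
    fiberDeriv h x y = fiberDeriv h' x y :=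
  Filter.EventuallyEq.fderiv_eq (Filter.eventually_of_mem (isOpen_compl_singleton.mem_nhds hy) H)

theorem baseDeriv_congr {x y : Coord n} (hU : IsOpen U) (hx : x ∈ U)
    (H : ∀ x ∈ U, h x y = h' x y) : baseDeriv h x y = baseDeriv h' x y :=
  Filter.EventuallyEq.fderiv_eq (Filter.eventually_of_mem (hU.mem_nhds hx) H)

theorem SmoothSlit.pd_fiber {h : Coord n → Coord n → ℝ} (hh : SmoothSlit U h) (hU : IsOpen U)
    (i : Fin n) : SmoothSlit U (fun x y => pd i (h x) y) :=
  ContDiffOn.clm_apply (hh.fiberDeriv hU) contDiffOn_const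

theorem SmoothSlit.pd_base {h : Coord n → Coord n → ℝ} (hh : SmoothSlit U h) (hU : IsOpen U)
    (i : Fin n) : SmoothSlit U (fun x y => pd i (fun x' => h x' y) x) :=
  ContDiffOn.clm_apply (hh.baseDeriv hU) contDiffOn_const

/-- The derivative in `y` along the dilations of a function that is homogeneous in `y`. -/
theorem fiberDeriv_self_of_homogeneous (hU : IsOpen U) (hh : SmoothSlit U h) (k : ℕ)
    {x y : Coord n} (hx : x ∈ U) (hy : y ≠ 0) (H : ∀ c : ℝ, 0 < c → h x (c • y) = c ^ k • h x y) :
    fiberDeriv h x y y = (k : ℝ) • h x y := by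
  have h1 : HasDerivAt (fun c : ℝ => c • y) y 1 := by
    simpa using (hasDerivAt_id (1 : ℝ)).smul_const y
  have h2 : HasFDerivAt (h x) (fiberDeriv h x y) ((1 : ℝ) • y) := by
    rw [one_smul]; exact hh.hasFDerivAt_fiber hU hx hy
  have h3 := h2.comp_hasDerivAt 1 h1
  have h4 : HasDerivAt (fun c : ℝ => c ^ k • h x y) ((k : ℝ) • h x y) 1 := by
    simpa using (hasDerivAt_pow k (1 : ℝ)).smul_const (h x y)
  refine h3.unique (h4.congr_of_eventuallyEq ?_)
  filter_upwards [isOpen_Ioi.mem_nhds (show (0 : ℝ) < 1 by norm_num)] with c hc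
  exact H c hc

theorem fiberDeriv_self_of_invariant (hU : IsOpen U) (hh : SmoothSlit U h)
    {x y : Coord n} (hx : x ∈ U) (hy : y ≠ 0) (H : ∀ c : ℝ, 0 < c → h x (c • y) = h x y) :
    fiberDeriv h x y y = 0 := by
  have := fiberDeriv_self_of_homogeneous hU hh 0 hx hy
    fun c hc => by rw [H c hc, pow_zero, one_smul]
  rwa [Nat.cast_zero, zero_smul] at this

/-- The derivative of a homogeneous function is homogeneous of one degree less. -/
theorem fiberDeriv_homogeneous {k : ℕ} {x : Coord n}
    (H : ∀ c : ℝ, 0 < c → ∀ y, h x (c • y) = c ^ (k + 1) • h x y) (c : ℝ) (hc : 0 < c)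
    (y : Coord n) : fiberDeriv h x (c • y) = c ^ k • fiberDeriv h x y := by
  -- Both sides of the homogeneity relation are differentiated in `y`. The rules for scalings need
  -- no differentiability, so `y = 0` is no exception. One factor `c` then cancels.
  have h1 : fderiv ℝ (fun y => h x (c • y)) y = c • fiberDeriv h x (c • y) :=
    fderiv_comp_smul (f := h x) c
  have h2 : fderiv ℝ (fun y => h x (c • y)) y = c ^ (k + 1) • fiberDeriv h x y := by
    rw [funext (H c hc)]
    exact congrFun (fderiv_const_smul_field (𝕜 := ℝ) (c ^ (k + 1)) (f := h x)) y
  rw [h1, pow_succ', mul_smul] at h2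
  exact smul_right_injective _ hc.ne' h2

end PartialDerivatives

end Finsler

namespace Finsler

/-! ### Smoothness of determinants and inverse matrices. -/

section MatrixSmoothness

variable {n : ℕ} {W : Type*} [NormedAddCommGroup W] [NormedSpace ℝ W] {s : Set W}
  {A : W → Matrix (Fin n) (Fin n) ℝ}

theorem contDiffOn_det (hA : ∀ i j, ContDiffOn ℝ ∞ (fun p => A p i j) s) :
    ContDiffOn ℝ ∞ (fun p => (A p).det) s := by
  simp only [Matrix.det_apply']
  exact ContDiffOn.sum fun σ _ => contDiffOn_const.mul (contDiffOn_prod fun i _ => hA (σ i) i)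

/-- Cramer's rule: an entry of the inverse is the quotient of two determinants, the numerator being
that of the matrix with one row replaced by a coordinate vector. -/
theorem contDiffOn_inv_apply (hA : ∀ i j, ContDiffOn ℝ ∞ (fun p => A p i j) s)
    (h0 : ∀ p ∈ s, (A p).det ≠ 0) (i j : Fin n) :
    ContDiffOn ℝ ∞ (fun p => (A p)⁻¹ i j) s := by
  have h1 : ContDiffOn ℝ ∞ (fun p => ((A p).updateRow j (Pi.single i 1)).det) s := by
    refine contDiffOn_det fun k l => ?_
    by_cases hk : k = j
    · subst hk
      simp only [Matrix.updateRow_self]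
      exact contDiffOn_const
    · simp only [Matrix.updateRow_ne hk]
      exact hA k l
  refine (((contDiffOn_det hA).inv h0).mul h1).congr fun p _ => ?_
  rw [Matrix.inv_def, Matrix.smul_apply, Matrix.adjugate_apply, Ring.inverse_eq_inv', smul_eq_mul]
  rfl

end MatrixSmoothness

/-! ### Invariant multilinear forms of the Finsler tensors and connections. -/

section LocalGeometry

variable {n : ℕ}

/-- `Φ` is the coordinate expression over `U` of a Finsler structure. -/
structure FinslerOn (Φ : Coord n → Coord n → ℝ) (U : Set (Coord n)) : Prop where
  isOpen : IsOpen U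
  nonneg : ∀ x y, 0 ≤ Φ x y
  smooth : SmoothSlit U Φ
  homogeneous : ∀ x ∈ U, ∀ c : ℝ, 0 < c → ∀ y, Φ x (c • y) = c * Φ x y
  posDef : ∀ x ∈ U, ∀ y ≠ 0, (gLow Φ x y).PosDef

theorem FinslerOn.mono {Φ : Coord n → Coord n → ℝ} {U W : Set (Coord n)} (hΦ : FinslerOn Φ U)
    (hW : IsOpen W) (h : W ⊆ U) : FinslerOn Φ W :=
  ⟨hW, hΦ.nonneg, hΦ.smooth.mono h, fun x hx => hΦ.homogeneous x (h hx),
    fun x hx => hΦ.posDef x (h hx)⟩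

variable (Φ : Coord n → Coord n → ℝ)

/-- `F²`. -/
def energy (x y : Coord n) : ℝ := Φ x y ^ 2

/-- The fundamental tensor `g` as a bilinear form. -/
def metric (x y : Coord n) : Coord n →L[ℝ] Coord n →L[ℝ] ℝ :=
  (1 / 2 : ℝ) • fiberDeriv (fiberDeriv (energy Φ)) x y

/-- The vector `g^{ks} ξ_s` of a covector `ξ`. -/
def sharp (x y : Coord n) : (Coord n →L[ℝ] ℝ) →ₗ[ℝ] Coord n where
  toFun ξ := WithLp.toLp 2 ((gUp Φ x y).mulVec fun s => ξ (basisVec s))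
  map_add' ξ η := by
    rw [← WithLp.toLp_add, ← Matrix.mulVec_add]
    rfl
  map_smul' c ξ := by
    rw [RingHom.id_apply, ← WithLp.toLp_smul, ← Matrix.mulVec_smul]
    rfl

theorem sharp_apply (x y : Coord n) (ξ : Coord n →L[ℝ] ℝ) (k : Fin n) :
    sharp Φ x y ξ k = ∑ s, gUp Φ x y k s * ξ (basisVec s) := rfl

/-- `∂g(w,v)/∂w`-combination `∂_w g(s,v) + ∂_v g(s,w) - ∂_s g(v,w)` as a covector in `s`. -/
def lowerSymbol (x y : Coord n) (v w : Coord n) : Coord n →L[ℝ] ℝ :=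
  (baseDeriv (metric Φ) x y w).flip v + (baseDeriv (metric Φ) x y v).flip w
    - ((baseDeriv (metric Φ) x y).flip v).flip w

theorem lowerSymbol_apply (x y v w s : Coord n) :
    lowerSymbol Φ x y v w s = baseDeriv (metric Φ) x y w s v + baseDeriv (metric Φ) x y v s w
      - baseDeriv (metric Φ) x y s v w := rfl

/-- The formal Christoffel symbols as a bilinear map. -/
def symbol (x y : Coord n) : Coord n →ₗ[ℝ] Coord n →ₗ[ℝ] Coord n :=
  LinearMap.mk₂ ℝ (fun v w => sharp Φ x y (lowerSymbol Φ x y v w))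
    (fun v v' w => by
      rw [← map_add]; congr 1; ext s; simp [lowerSymbol_apply]; ring)
    (fun c v w => by
      rw [← map_smul]; congr 1; ext s; simp [lowerSymbol_apply]; ring)
    (fun v w w' => by
      rw [← map_add]; congr 1; ext s; simp [lowerSymbol_apply]; ring)
    (fun c v w => by
      rw [← map_smul]; congr 1; ext s; simp [lowerSymbol_apply]; ring)

theorem symbol_apply (x y v w : Coord n) :
    symbol Φ x y v w = sharp Φ x y (lowerSymbol Φ x y v w) := rfl

/-- The geodesic spray. -/
def spray (x y : Coord n) : Coord n := symbol Φ x y y y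

/-- The nonlinear connection as a linear map. -/
def nonlinMap (x y : Coord n) : Coord n →L[ℝ] Coord n := (1 / 4 : ℝ) • fiberDeriv (spray Φ) x y

/-- Twice the Chern connection with its upper index lowered. -/
def lowerChern (x y v w : Coord n) : Coord n →L[ℝ] ℝ :=
  lowerSymbol Φ x y v w - fiberDeriv (metric Φ) x y v (nonlinMap Φ x y w)
    - fiberDeriv (metric Φ) x y w (nonlinMap Φ x y v)
    + ((fiberDeriv (metric Φ) x y w).flip v).comp (nonlinMap Φ x y)

theorem lowerChern_apply (x y v w s : Coord n) :
    lowerChern Φ x y v w s = lowerSymbol Φ x y v w s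
      - fiberDeriv (metric Φ) x y v (nonlinMap Φ x y w) s
      - fiberDeriv (metric Φ) x y w (nonlinMap Φ x y v) s
      + fiberDeriv (metric Φ) x y w (nonlinMap Φ x y s) v := rfl

/-- The Chern connection as a bilinear map. -/
def chernMap (x y : Coord n) : Coord n →ₗ[ℝ] Coord n →ₗ[ℝ] Coord n :=
  LinearMap.mk₂ ℝ (fun v w => (1 / 2 : ℝ) • sharp Φ x y (lowerChern Φ x y v w))
    (fun v v' w => by
      rw [← smul_add, ← map_add]; congr 2; ext s
      simp [lowerChern_apply, lowerSymbol_apply]; ring)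
    (fun c v w => by
      rw [smul_comm c (1 / 2 : ℝ), ← (sharp Φ x y).map_smul c]; congr 2; ext s
      simp [lowerChern_apply, lowerSymbol_apply]; ring)
    (fun v w w' => by
      rw [← smul_add, ← map_add]; congr 2; ext s
      simp [lowerChern_apply, lowerSymbol_apply]; ring)
    (fun c v w => by
      rw [smul_comm c (1 / 2 : ℝ), ← (sharp Φ x y).map_smul c]; congr 2; ext s
      simp [lowerChern_apply, lowerSymbol_apply]; ring)

theorem chernMap_apply (x y v w : Coord n) :
    chernMap Φ x y v w = (1 / 2 : ℝ) • sharp Φ x y (lowerChern Φ x y v w) := rfl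

/-- The Cartan tensor with one index raised, as a bilinear map. -/
def cartanMap (x y : Coord n) : Coord n →ₗ[ℝ] Coord n →ₗ[ℝ] Coord n :=
  LinearMap.mk₂ ℝ (fun v w => (Φ x y / 2) • sharp Φ x y (fiberDeriv (metric Φ) x y v w))
    (fun v v' w => by simp) (fun c v w => by simp [smul_comm c])
    (fun v w w' => by simp) (fun c v w => by simp [smul_comm c])

theorem cartanMap_apply (x y v w : Coord n) :
    cartanMap Φ x y v w = (Φ x y / 2) • sharp Φ x y (fiberDeriv (metric Φ) x y v w) := rfl

/-- The tensor `B` as a bilinear map. -/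
def bMap (d : Coord n →L[ℝ] ℝ) (x y : Coord n) : Coord n →ₗ[ℝ] Coord n →ₗ[ℝ] Coord n :=
  LinearMap.mk₂ ℝ (fun v w =>
      fiberDeriv Φ x y w • cartanMap Φ x y v (sharp Φ x y d)
      + fiberDeriv Φ x y v • cartanMap Φ x y w (sharp Φ x y d)
      - d (sharp Φ x y (fiberDeriv Φ x y)) • cartanMap Φ x y v w
      - d (cartanMap Φ x y v w) • sharp Φ x y (fiberDeriv Φ x y)
      - cartanMap Φ x y v (cartanMap Φ x y w (sharp Φ x y d))
      - cartanMap Φ x y w (cartanMap Φ x y v (sharp Φ x y d))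
      + cartanMap Φ x y (cartanMap Φ x y v w) (sharp Φ x y d))
    (fun v v' w => by simp only [map_add, LinearMap.add_apply]; module)
    (fun c v w => by simp only [map_smul, LinearMap.smul_apply, smul_eq_mul]; module)
    (fun v w w' => by simp only [map_add, LinearMap.add_apply]; module)
    (fun c v w => by simp only [map_smul, LinearMap.smul_apply, smul_eq_mul]; module)

theorem bMap_apply (d : Coord n →L[ℝ] ℝ) (x y v w : Coord n) : bMap Φ d x y v w =
      fiberDeriv Φ x y w • cartanMap Φ x y v (sharp Φ x y d)
      + fiberDeriv Φ x y v • cartanMap Φ x y w (sharp Φ x y d)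
      - d (sharp Φ x y (fiberDeriv Φ x y)) • cartanMap Φ x y v w
      - d (cartanMap Φ x y v w) • sharp Φ x y (fiberDeriv Φ x y)
      - cartanMap Φ x y v (cartanMap Φ x y w (sharp Φ x y d))
      - cartanMap Φ x y w (cartanMap Φ x y v (sharp Φ x y d))
      + cartanMap Φ x y (cartanMap Φ x y v w) (sharp Φ x y d) := rfl

end LocalGeometry

/-! ### Symmetry, positivity and homogeneity of the fundamental tensor. -/

section FinslerOn

variable {n : ℕ} {Φ : Coord n → Coord n → ℝ} {U : Set (Coord n)} {x y : Coord n}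

namespace FinslerOn

theorem smooth_energy (hΦ : FinslerOn Φ U) : SmoothSlit U (energy Φ) := ContDiffOn.pow hΦ.smooth 2

theorem smooth_fiberDeriv_energy (hΦ : FinslerOn Φ U) : SmoothSlit U (fiberDeriv (energy Φ)) :=
  hΦ.smooth_energy.fiberDeriv hΦ.isOpen

theorem smooth_metric (hΦ : FinslerOn Φ U) : SmoothSlit U (metric Φ) :=
  ContDiffOn.const_smul _ (hΦ.smooth_fiberDeriv_energy.fiberDeriv hΦ.isOpen)

theorem gLow_eq (hΦ : FinslerOn Φ U) (hx : x ∈ U) (hy : y ≠ 0) (i j : Fin n) :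
    gLow Φ x y i j = metric Φ x y (basisVec i) (basisVec j) := by
  have h := (hΦ.smooth_fiberDeriv_energy.hasFDerivAt_fiber hΦ.isOpen hx hy).clm_apply
    (hasFDerivAt_const (basisVec j) y)
  have h' : pd i (fun y' => pd j (fun y'' => Φ x y'' ^ 2) y') y
      = fiberDeriv (fiberDeriv (energy Φ)) x y (basisVec i) (basisVec j) := by
    change fderiv ℝ (fun y' => fiberDeriv (energy Φ) x y' (basisVec j)) y (basisVec i) = _
    rw [h.fderiv]
    simp
  simp [gLow, metric, h']

theorem metric_symm (hΦ : FinslerOn Φ U) (hx : x ∈ U) (hy : y ≠ 0) (v w : Coord n) :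
    metric Φ x y v w = metric Φ x y w v := by
  simp only [metric, _root_.smul_apply]
  rw [hΦ.smooth_energy.fiberDeriv_symm hΦ.isOpen hx hy]

theorem metric_eq_sum (hΦ : FinslerOn Φ U) (hx : x ∈ U) (hy : y ≠ 0) (v w : Coord n) :
    metric Φ x y v w = ∑ i, ∑ j, v i * w j * gLow Φ x y i j := by
  rw [map_eq_sum (metric Φ x y) v, _root_.sum_apply]
  refine Finset.sum_congr rfl fun i _ => ?_
  rw [_root_.smul_apply, map_eq_sum (metric Φ x y (basisVec i)) w, Finset.smul_sum]
  refine Finset.sum_congr rfl fun j _ => ?_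
  rw [hΦ.gLow_eq hx hy, smul_eq_mul, smul_eq_mul, mul_assoc]

theorem metric_pos (hΦ : FinslerOn Φ U) (hx : x ∈ U) (hy : y ≠ 0) {v : Coord n} (hv : v ≠ 0) :
    0 < metric Φ x y v v := by
  have hv' : v.ofLp ≠ 0 := fun h => hv (by ext i; exact congrFun h i)
  have h := (hΦ.posDef x hx y hy).dotProduct_mulVec_pos hv'
  rw [hΦ.metric_eq_sum hx hy]
  refine lt_of_lt_of_eq h ?_
  simp only [dotProduct, Matrix.mulVec, Finset.mul_sum]
  refine Finset.sum_congr rfl fun i _ => Finset.sum_congr rfl fun j _ => ?_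
  rw [Pi.star_apply, star_trivial]
  ring

/-- A vector in the kernel would have zero length. With this, identities between raised vectors can
be checked after lowering the index, without handling inverse matrices. -/
theorem metric_injective (hΦ : FinslerOn Φ U) (hx : x ∈ U) (hy : y ≠ 0) :
    Function.Injective (metric Φ x y) := by
  rw [injective_iff_map_eq_zero]
  intro v hv
  by_contra h
  have := hΦ.metric_pos hx hy h
  rw [hv] at this
  simp at this

theorem isUnit_det (hΦ : FinslerOn Φ U) (hx : x ∈ U) (hy : y ≠ 0) : IsUnit (gLow Φ x y).det :=
  (Matrix.isUnit_iff_isUnit_det _).1 (hΦ.posDef x hx y hy).isUnit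

theorem gLow_symm (hΦ : FinslerOn Φ U) (hx : x ∈ U) (hy : y ≠ 0) (i j : Fin n) :
    gLow Φ x y i j = gLow Φ x y j i := by
  rw [hΦ.gLow_eq hx hy, hΦ.metric_symm hx hy, ← hΦ.gLow_eq hx hy]

theorem gUp_symm (hΦ : FinslerOn Φ U) (hx : x ∈ U) (hy : y ≠ 0) (i j : Fin n) :
    gUp Φ x y i j = gUp Φ x y j i := by
  have h : (gLow Φ x y).transpose = gLow Φ x y := by
    ext i j
    exact hΦ.gLow_symm hx hy j i
  have h' : (gUp Φ x y).transpose = gUp Φ x y := by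
    rw [gUp, Matrix.transpose_nonsing_inv, h]
  exact (congrFun (congrFun h' j) i)

/-- This ties the matrix `g^{ij}` to the bilinear form: raising with the inverse matrix inverts the
map v ↦ g(v, ·). -/
theorem metric_sharp (hΦ : FinslerOn Φ U) (hx : x ∈ U) (hy : y ≠ 0) (ξ : Coord n →L[ℝ] ℝ) :
    metric Φ x y (sharp Φ x y ξ) = ξ := by
  have key : ∀ j, metric Φ x y (sharp Φ x y ξ) (basisVec j) = ξ (basisVec j) := by
    intro j
    have h : (gLow Φ x y).mulVec ((gUp Φ x y).mulVec fun s => ξ (basisVec s))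
        = fun s => ξ (basisVec s) := by
      rw [Matrix.mulVec_mulVec, gUp, Matrix.mul_nonsing_inv _ (hΦ.isUnit_det hx hy),
        Matrix.one_mulVec]
    rw [hΦ.metric_symm hx hy, map_eq_sum (metric Φ x y (basisVec j))]
    refine Eq.trans ?_ (congrFun h j)
    rw [Matrix.mulVec, dotProduct]
    refine Finset.sum_congr rfl fun k _ => ?_
    rw [← hΦ.gLow_eq hx hy, smul_eq_mul, mul_comm]
    rfl
  ext w
  rw [map_eq_sum _ w, map_eq_sum ξ w]
  exact Finset.sum_congr rfl fun j _ => by rw [key]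

theorem sharp_metric (hΦ : FinslerOn Φ U) (hx : x ∈ U) (hy : y ≠ 0) (v : Coord n) :
    sharp Φ x y (metric Φ x y v) = v :=
  hΦ.metric_injective hx hy (hΦ.metric_sharp hx hy _)

theorem fiberDeriv_apply_const {V V' : Type*} [NormedAddCommGroup V] [NormedSpace ℝ V]
    [NormedAddCommGroup V'] [NormedSpace ℝ V'] {h : Coord n → Coord n → V →L[ℝ] V'}
    (hh : SmoothSlit U h) (hU : IsOpen U) (hx : x ∈ U) (hy : y ≠ 0) (w : V) (v : Coord n) :
    fiberDeriv (fun x y => h x y w) x y v = fiberDeriv h x y v w := by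
  have H := (hh.hasFDerivAt_fiber hU hx hy).clm_apply (hasFDerivAt_const w y)
  change fderiv ℝ (fun y' => h x y' w) y v = _
  rw [H.fderiv]
  simp

theorem baseDeriv_apply_const {V V' : Type*} [NormedAddCommGroup V] [NormedSpace ℝ V]
    [NormedAddCommGroup V'] [NormedSpace ℝ V'] {h : Coord n → Coord n → V →L[ℝ] V'}
    (hh : SmoothSlit U h) (hU : IsOpen U) (hx : x ∈ U) (hy : y ≠ 0) (w : V) (v : Coord n) :
    baseDeriv (fun x y => h x y w) x y v = baseDeriv h x y v w := by
  have H := (hh.hasFDerivAt_base hU hx hy).clm_apply (hasFDerivAt_const w x)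
  change fderiv ℝ (fun x' => h x' y w) x v = _
  rw [H.fderiv]
  simp

theorem smooth_apply {V V' : Type*} [NormedAddCommGroup V] [NormedSpace ℝ V]
    [NormedAddCommGroup V'] [NormedSpace ℝ V'] {h : Coord n → Coord n → V →L[ℝ] V'}
    (hh : SmoothSlit U h) (w : V) : SmoothSlit U fun x y => h x y w :=
  ContDiffOn.clm_apply hh contDiffOn_const

theorem fiberDeriv_metric_symm_right (hΦ : FinslerOn Φ U) (hx : x ∈ U) (hy : y ≠ 0)
    (u v w : Coord n) :
    fiberDeriv (metric Φ) x y u v w = fiberDeriv (metric Φ) x y u w v := by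
  have h1 := smooth_apply hΦ.smooth_metric v
  have h2 := smooth_apply hΦ.smooth_metric w
  rw [← fiberDeriv_apply_const hΦ.smooth_metric hΦ.isOpen hx hy,
    ← fiberDeriv_apply_const h1 hΦ.isOpen hx hy,
    ← fiberDeriv_apply_const hΦ.smooth_metric hΦ.isOpen hx hy,
    ← fiberDeriv_apply_const h2 hΦ.isOpen hx hy,
    fiberDeriv_congr (h' := fun x y => metric Φ x y w v) hy fun y' hy' => hΦ.metric_symm hx hy' v w]

/-- Since `g` is half a second fibre derivative of `F²`, the symmetry of second derivatives applied
to the first derivative of `F²` exchanges the two slots. Together with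
`fiberDeriv_metric_symm_right` this makes the Cartan tensor totally symmetric. -/
theorem fiberDeriv_metric_symm_left (hΦ : FinslerOn Φ U) (hx : x ∈ U) (hy : y ≠ 0)
    (u v : Coord n) :
    fiberDeriv (metric Φ) x y u v = fiberDeriv (metric Φ) x y v u := by
  have h : fiberDeriv (metric Φ) x y
      = (1 / 2 : ℝ) • fiberDeriv (fiberDeriv (fiberDeriv (energy Φ))) x y :=
    congrFun (fderiv_const_smul_field (𝕜 := ℝ) (1 / 2 : ℝ)
      (f := fiberDeriv (fiberDeriv (energy Φ)) x)) y
  rw [h, _root_.smul_apply, _root_.smul_apply,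
    _root_.smul_apply, _root_.smul_apply,
    hΦ.smooth_fiberDeriv_energy.fiberDeriv_symm hΦ.isOpen hx hy]

theorem energy_homogeneous (hΦ : FinslerOn Φ U) (hx : x ∈ U) (c : ℝ) (hc : 0 < c) (y : Coord n) :
    energy Φ x (c • y) = c ^ 2 • energy Φ x y := by
  rw [energy, hΦ.homogeneous x hx c hc, energy, smul_eq_mul]
  ring

/-- `F²` has degree 2 and each fibre derivative lowers the degree by one. -/
theorem metric_homogeneous (hΦ : FinslerOn Φ U) (hx : x ∈ U) (c : ℝ) (hc : 0 < c) (y : Coord n) :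
    metric Φ x (c • y) = metric Φ x y := by
  have h := fiberDeriv_homogeneous (h := fiberDeriv (energy Φ)) (k := 0) (fun c hc y =>
    fiberDeriv_homogeneous (k := 1) (hΦ.energy_homogeneous hx) c hc y) c hc y
  rw [metric, h, pow_zero, one_smul, metric]

/-- Euler's identity used twice, for the derivative of `F²` (degree 1) and for `F²` itself (degree
2). The resulting factor 2 cancels the 1/2 in `g`. -/
theorem metric_self (hΦ : FinslerOn Φ U) (hx : x ∈ U) (hy : y ≠ 0) :
    metric Φ x y y y = Φ x y ^ 2 := by
  have h1 := fiberDeriv_self_of_homogeneous hΦ.isOpen hΦ.smooth_energy 2 hx hy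
    fun c hc => hΦ.energy_homogeneous hx c hc y
  have h2 := fiberDeriv_self_of_homogeneous hΦ.isOpen hΦ.smooth_fiberDeriv_energy 1 hx hy
    fun c hc => fiberDeriv_homogeneous (k := 1) (hΦ.energy_homogeneous hx) c hc y
  rw [metric, _root_.smul_apply, _root_.smul_apply, h2, Nat.cast_one,
    one_smul, h1]
  simp [energy]

/-- The definition of a Finsler structure only asks for `F ≥ 0`. Strict positivity comes from `F² =
g(y,y)`, and it is needed to divide by `F` and to take its logarithm. -/
theorem pos (hΦ : FinslerOn Φ U) (hx : x ∈ U) (hy : y ≠ 0) : 0 < Φ x y := by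
  refine (hΦ.nonneg x y).lt_of_ne fun h => ?_
  have := hΦ.metric_pos hx hy hy
  rw [hΦ.metric_self hx hy, ← h] at this
  simp at this

/-- Euler's identity in degree 0: the Cartan tensor vanishes on `y`. This removes the
fibre-derivative terms from the transformation law of the spray. -/
theorem fiberDeriv_metric_self (hΦ : FinslerOn Φ U) (hx : x ∈ U) (hy : y ≠ 0) :
    fiberDeriv (metric Φ) x y y = 0 :=
  fiberDeriv_self_of_invariant hΦ.isOpen hΦ.smooth_metric hx hy
    fun c hc => hΦ.metric_homogeneous hx c hc y

/-! ### Smoothness of the component functions -/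

theorem smooth_gLow (hΦ : FinslerOn Φ U) (i j : Fin n) :
    SmoothSlit U fun x y => gLow Φ x y i j :=
  contDiffOn_const.mul ((hΦ.smooth_energy.pd_fiber hΦ.isOpen j).pd_fiber hΦ.isOpen i)

theorem smooth_gUp (hΦ : FinslerOn Φ U) (i j : Fin n) :
    SmoothSlit U fun x y => gUp Φ x y i j :=
  contDiffOn_inv_apply (fun i j => hΦ.smooth_gLow i j)
    (fun _ hp => (hΦ.isUnit_det hp.1 hp.2).ne_zero) i j

theorem smooth_cartan (hΦ : FinslerOn Φ U) (i j k : Fin n) :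
    SmoothSlit U fun x y => cartan Φ x y i j k :=
  (ContDiffOn.div_const hΦ.smooth 2).mul ((hΦ.smooth_gLow i j).pd_fiber hΦ.isOpen k)

theorem smooth_cartanUp (hΦ : FinslerOn Φ U) (k i j : Fin n) :
    SmoothSlit U fun x y => cartanUp Φ x y k i j :=
  ContDiffOn.sum fun l _ => (hΦ.smooth_cartan i j l).mul (hΦ.smooth_gUp l k)

theorem smooth_cartanUpUp (hΦ : FinslerOn Φ U) (k r i : Fin n) :
    SmoothSlit U fun x y => cartanUpUp Φ x y k r i :=
  ContDiffOn.sum fun a _ => ContDiffOn.sum fun b _ =>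
    ((hΦ.smooth_cartan i a b).mul (hΦ.smooth_gUp a k)).mul (hΦ.smooth_gUp b r)

theorem smooth_hilbert (hΦ : FinslerOn Φ U) (i : Fin n) :
    SmoothSlit U fun x y => hilbert Φ x y i :=
  hΦ.smooth.pd_fiber hΦ.isOpen i

theorem smooth_hilbertUp (hΦ : FinslerOn Φ U) (i : Fin n) :
    SmoothSlit U fun x y => hilbertUp Φ x y i :=
  ContDiffOn.sum fun j _ => (hΦ.smooth_gUp i j).mul (hΦ.smooth_hilbert j)

theorem smooth_formalSymbol (hΦ : FinslerOn Φ U) (k i j : Fin n) :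
    SmoothSlit U fun x y => formalSymbol Φ x y k i j :=
  ContDiffOn.sum fun s _ => (hΦ.smooth_gUp k s).mul
    ((((hΦ.smooth_gLow s i).pd_base hΦ.isOpen j).add
      ((hΦ.smooth_gLow s j).pd_base hΦ.isOpen i)).sub ((hΦ.smooth_gLow i j).pd_base hΦ.isOpen s))

theorem smooth_coord (i : Fin n) : SmoothSlit U fun _ y => y i :=
  ((EuclideanSpace.proj (𝕜 := ℝ) i).contDiff.comp contDiff_snd).contDiffOn

theorem smooth_sprayComponent (hΦ : FinslerOn Φ U) (k : Fin n) :
    SmoothSlit U fun x y => ∑ i, ∑ j, formalSymbol Φ x y k i j * y j * y i :=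
  ContDiffOn.sum fun i _ => ContDiffOn.sum fun j _ =>
    ((hΦ.smooth_formalSymbol k i j).mul (smooth_coord j)).mul (smooth_coord i)

theorem smooth_nonlin (hΦ : FinslerOn Φ U) (k m : Fin n) :
    SmoothSlit U fun x y => nonlin Φ x y k m :=
  contDiffOn_const.mul ((hΦ.smooth_sprayComponent k).pd_fiber hΦ.isOpen m)

theorem smooth_chern (hΦ : FinslerOn Φ U) (k i j : Fin n) :
    SmoothSlit U fun x y => chern Φ x y k i j := by
  have hN : ∀ m i, SmoothSlit U fun x y => nonlin Φ x y m i / Φ x y := fun m i =>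
    ContDiffOn.div (hΦ.smooth_nonlin m i) hΦ.smooth fun p hp => (hΦ.pos hp.1 hp.2).ne'
  exact (contDiffOn_const.mul (hΦ.smooth_formalSymbol k i j)).sub <|
    ContDiffOn.sum fun s _ => (hΦ.smooth_gUp k s).mul <| ContDiffOn.sum fun m _ =>
      (((hN m j).mul (hΦ.smooth_cartan m s i)).add ((hN m i).mul (hΦ.smooth_cartan m s j))).sub
        ((hN m s).mul (hΦ.smooth_cartan m i j))

theorem smooth_bTensor (hΦ : FinslerOn Φ U) {d : Coord n → Coord n → Fin n → ℝ}
    (hd : ∀ r, SmoothSlit U fun x y => d x y r) (k i j : Fin n) :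
    SmoothSlit U fun x y => bTensor Φ (d x y) x y k i j :=
  ContDiffOn.sum fun r _ => ContDiffOn.mul
    (((((((hΦ.smooth_cartanUpUp k r i).mul (hΦ.smooth_hilbert j)).add
      ((hΦ.smooth_cartanUpUp k r j).mul (hΦ.smooth_hilbert i))).sub
      ((hΦ.smooth_cartanUp k i j).mul (hΦ.smooth_hilbertUp r))).sub
      ((hΦ.smooth_cartanUp r i j).mul (hΦ.smooth_hilbertUp k))).sub
      (ContDiffOn.sum fun s _ => (hΦ.smooth_cartanUp k i s).mul (hΦ.smooth_cartanUpUp s r j))).sub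
      (ContDiffOn.sum fun s _ => (hΦ.smooth_cartanUp k j s).mul (hΦ.smooth_cartanUpUp s r i)) |>.add
      (ContDiffOn.sum fun u _ => (hΦ.smooth_cartanUpUp r k u).mul (hΦ.smooth_cartanUp u i j)))
    (hd r)

end FinslerOn

end FinslerOn

end Finsler

namespace Finsler

namespace FinslerOn

/-! ### The component functions as components of multilinear maps -/

variable {n : ℕ} {Φ : Coord n → Coord n → ℝ} {U : Set (Coord n)} {x y : Coord n}

theorem bilin_eq_sum (β : Coord n →ₗ[ℝ] Coord n →ₗ[ℝ] Coord n) (v w : Coord n) (k : Fin n) :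
    β v w k = ∑ i, ∑ j, v i * w j * β (basisVec i) (basisVec j) k := by
  have h1 : β v w = ∑ i, v i • β (basisVec i) w := map_eq_sum (β.flip w) v
  rw [h1, WithLp.ofLp_sum, Finset.sum_apply]
  refine Finset.sum_congr rfl fun i _ => ?_
  rw [map_eq_sum (β (basisVec i)) w, PiLp.smul_apply, WithLp.ofLp_sum, Finset.sum_apply,
    smul_eq_mul, Finset.mul_sum]
  refine Finset.sum_congr rfl fun j _ => ?_
  rw [PiLp.smul_apply, smul_eq_mul, mul_assoc]

/-- By total symmetry the direction of differentiation may be placed in the last slot, in the index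
order of `A_{ijk}`. -/
theorem pd_fiber_gLow (hΦ : FinslerOn Φ U) (hx : x ∈ U) (hy : y ≠ 0) (i j k : Fin n) :
    pd k (fun y' => gLow Φ x y' i j) y
      = fiberDeriv (metric Φ) x y (basisVec i) (basisVec j) (basisVec k) := by
  have h1 := smooth_apply hΦ.smooth_metric (basisVec i)
  rw [hΦ.fiberDeriv_metric_symm_right hx hy, hΦ.fiberDeriv_metric_symm_left hx hy,
    ← fiberDeriv_apply_const hΦ.smooth_metric hΦ.isOpen hx hy,
    ← fiberDeriv_apply_const h1 hΦ.isOpen hx hy]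
  exact congrFun (congrArg DFunLike.coe (fiberDeriv_congr (h := fun x y => gLow Φ x y i j)
    (h' := fun x y => metric Φ x y (basisVec i) (basisVec j)) hy
    fun y' hy' => hΦ.gLow_eq hx hy' i j)) _

theorem pd_base_gLow (hΦ : FinslerOn Φ U) (hx : x ∈ U) (hy : y ≠ 0) (i j k : Fin n) :
    pd k (fun x' => gLow Φ x' y i j) x
      = baseDeriv (metric Φ) x y (basisVec k) (basisVec i) (basisVec j) := by
  have h1 := smooth_apply hΦ.smooth_metric (basisVec i)
  rw [← baseDeriv_apply_const hΦ.smooth_metric hΦ.isOpen hx hy,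
    ← baseDeriv_apply_const h1 hΦ.isOpen hx hy]
  exact congrFun (congrArg DFunLike.coe (baseDeriv_congr (h := fun x y => gLow Φ x y i j)
    (h' := fun x y => metric Φ x y (basisVec i) (basisVec j)) hΦ.isOpen hx
    fun x' hx' => hΦ.gLow_eq hx' hy i j)) _

theorem cartan_eq (hΦ : FinslerOn Φ U) (hx : x ∈ U) (hy : y ≠ 0) (i j k : Fin n) :
    cartan Φ x y i j k
      = Φ x y / 2 * fiberDeriv (metric Φ) x y (basisVec i) (basisVec j) (basisVec k) := by
  rw [cartan, hΦ.pd_fiber_gLow hx hy]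

theorem cartanUp_eq (hΦ : FinslerOn Φ U) (hx : x ∈ U) (hy : y ≠ 0) (k i j : Fin n) :
    cartanUp Φ x y k i j = cartanMap Φ x y (basisVec i) (basisVec j) k := by
  rw [cartanUp, cartanMap_apply, PiLp.smul_apply, sharp_apply, smul_eq_mul, Finset.mul_sum]
  refine Finset.sum_congr rfl fun l _ => ?_
  rw [hΦ.cartan_eq hx hy, hΦ.gUp_symm hx hy l k]
  ring

theorem cartanMap_symm (hΦ : FinslerOn Φ U) (hx : x ∈ U) (hy : y ≠ 0) (v w : Coord n) :
    cartanMap Φ x y v w = cartanMap Φ x y w v := by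
  rw [cartanMap_apply, hΦ.fiberDeriv_metric_symm_left hx hy, cartanMap_apply]

/-- Contracting an upper index of `A` with `d` amounts to inserting the raised covector. This is how
every term of `B` becomes a composition of `cartanMap` and `sharp`. -/
theorem sum_cartanUpUp (hΦ : FinslerOn Φ U) (hx : x ∈ U) (hy : y ≠ 0) (d : Coord n →L[ℝ] ℝ)
    (k i : Fin n) : ∑ r, cartanUpUp Φ x y k r i * d (basisVec r)
      = cartanMap Φ x y (basisVec i) (sharp Φ x y d) k := by
  rw [map_eq_sum (cartanMap Φ x y (basisVec i))]
  simp only [WithLp.ofLp_sum, WithLp.ofLp_smul, Finset.sum_apply, Pi.smul_apply, smul_eq_mul,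
    ← hΦ.cartanUp_eq hx hy, cartanUp, cartanUpUp, sharp_apply, Finset.mul_sum, Finset.sum_mul]
  rw [Finset.sum_congr rfl fun r _ => Finset.sum_comm, Finset.sum_comm]
  refine Finset.sum_congr rfl fun b _ => ?_
  rw [Finset.sum_comm]
  refine Finset.sum_congr rfl fun r _ => Finset.sum_congr rfl fun a _ => ?_
  rw [hΦ.cartan_eq hx hy, hΦ.cartan_eq hx hy, hΦ.fiberDeriv_metric_symm_right hx hy]
  ring

theorem hilbertUp_eq (x y : Coord n) (i : Fin n) :
    hilbertUp Φ x y i = sharp Φ x y (fiberDeriv Φ x y) i := rfl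

theorem bTensor_eq (hΦ : FinslerOn Φ U) (hx : x ∈ U) (hy : y ≠ 0) (d : Coord n →L[ℝ] ℝ)
    (k i j : Fin n) : bTensor Φ (fun r => d (basisVec r)) x y k i j
      = bMap Φ d x y (basisVec i) (basisVec j) k := by
  have h3 : ∑ r, hilbertUp Φ x y r * d (basisVec r) = d (sharp Φ x y (fiberDeriv Φ x y)) := by
    rw [map_eq_sum d]
    rfl
  have h4 : ∑ r, cartanUp Φ x y r i j * d (basisVec r)
      = d (cartanMap Φ x y (basisVec i) (basisVec j)) := by
    rw [map_eq_sum d]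
    exact Finset.sum_congr rfl fun r _ => by rw [hΦ.cartanUp_eq hx hy, smul_eq_mul]
  have h5 : ∀ i j, ∑ r, (∑ s, cartanUp Φ x y k i s * cartanUpUp Φ x y s r j) * d (basisVec r)
      = cartanMap Φ x y (basisVec i) (cartanMap Φ x y (basisVec j) (sharp Φ x y d)) k := by
    intro i j
    rw [map_eq_sum (cartanMap Φ x y (basisVec i))]
    simp only [WithLp.ofLp_sum, WithLp.ofLp_smul, Finset.sum_apply, Pi.smul_apply, smul_eq_mul,
      ← hΦ.cartanUp_eq hx hy, ← hΦ.sum_cartanUpUp hx hy, Finset.sum_mul]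
    rw [Finset.sum_comm]
    exact Finset.sum_congr rfl fun s _ => Finset.sum_congr rfl fun r _ => by ring
  have h7 : ∑ r, (∑ u, cartanUpUp Φ x y r k u * cartanUp Φ x y u i j) * d (basisVec r)
      = cartanMap Φ x y (cartanMap Φ x y (basisVec i) (basisVec j)) (sharp Φ x y d) k := by
    -- In the last term of `B` the contracted index `r` comes first. Symmetry of the two upper
    -- indices moves it to the position required by `sum_cartanUpUp`.
    have hsymm : ∀ r u, cartanUpUp Φ x y r k u = cartanUpUp Φ x y k r u := fun r u => by
      rw [cartanUpUp, cartanUpUp, Finset.sum_comm]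
      refine Finset.sum_congr rfl fun a _ => Finset.sum_congr rfl fun b _ => ?_
      rw [hΦ.cartan_eq hx hy, hΦ.cartan_eq hx hy, hΦ.fiberDeriv_metric_symm_right hx hy]
      ring
    rw [hΦ.cartanMap_symm hx hy, map_eq_sum (cartanMap Φ x y (sharp Φ x y d))]
    simp only [WithLp.ofLp_sum, WithLp.ofLp_smul, Finset.sum_apply, Pi.smul_apply, smul_eq_mul,
      hΦ.cartanMap_symm hx hy (sharp Φ x y d), ← hΦ.cartanUp_eq hx hy,
      ← hΦ.sum_cartanUpUp hx hy, Finset.sum_mul, Finset.mul_sum, hsymm]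
    rw [Finset.sum_comm]
    exact Finset.sum_congr rfl fun s _ => Finset.sum_congr rfl fun r _ => by ring
  rw [bMap_apply]
  simp only [PiLp.add_apply, PiLp.sub_apply, PiLp.smul_apply, smul_eq_mul,
    ← hΦ.sum_cartanUpUp hx hy d k i, ← hΦ.sum_cartanUpUp hx hy d k j, ← h5, ← h7, ← h3, ← h4,
    ← hΦ.cartanUp_eq hx hy, ← hilbertUp_eq]
  simp only [bTensor, add_mul, sub_mul, Finset.sum_add_distrib, Finset.sum_sub_distrib]
  congr 1
  congr 1
  congr 1
  · congr 1
    · congr 1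
      · congr 1 <;>
        · rw [Finset.mul_sum]
          refine Finset.sum_congr rfl fun r _ => ?_
          rw [hilbert, fiberDeriv, pd]
          ring
      · rw [Finset.sum_mul]
        exact Finset.sum_congr rfl fun r _ => by ring
    · rw [Finset.sum_mul]
      exact Finset.sum_congr rfl fun r _ => by ring

theorem formalSymbol_eq (hΦ : FinslerOn Φ U) (hx : x ∈ U) (hy : y ≠ 0) (k i j : Fin n) :
    formalSymbol Φ x y k i j = symbol Φ x y (basisVec i) (basisVec j) k := by
  rw [formalSymbol, symbol_apply, sharp_apply]
  refine Finset.sum_congr rfl fun s _ => ?_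
  rw [lowerSymbol_apply, hΦ.pd_base_gLow hx hy, hΦ.pd_base_gLow hx hy, hΦ.pd_base_gLow hx hy]

theorem spray_apply (hΦ : FinslerOn Φ U) (hx : x ∈ U) (hy : y ≠ 0) (k : Fin n) :
    spray Φ x y k = ∑ i, ∑ j, formalSymbol Φ x y k i j * y j * y i := by
  rw [spray, bilin_eq_sum]
  refine Finset.sum_congr rfl fun i _ => Finset.sum_congr rfl fun j _ => ?_
  rw [← hΦ.formalSymbol_eq hx hy]
  ring

theorem smooth_spray (hΦ : FinslerOn Φ U) : SmoothSlit U (spray Φ) := by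
  rw [SmoothSlit, contDiffOn_euclidean]
  exact fun k => (hΦ.smooth_sprayComponent k).congr fun x hx y hy => hΦ.spray_apply hx hy k

theorem nonlin_eq (hΦ : FinslerOn Φ U) (hx : x ∈ U) (hy : y ≠ 0) (k m : Fin n) :
    nonlin Φ x y k m = nonlinMap Φ x y (basisVec m) k := by
  have h := (EuclideanSpace.proj (𝕜 := ℝ) k).hasFDerivAt.comp y
    (hΦ.smooth_spray.hasFDerivAt_fiber hΦ.isOpen hx hy)
  have h' : fiberDeriv (fun x y => ∑ i, ∑ j, formalSymbol Φ x y k i j * y j * y i) x y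
      = fiberDeriv (fun x y => spray Φ x y k) x y :=
    fiberDeriv_congr hy fun y' hy' => (hΦ.spray_apply hx hy' k).symm
  have h'' : fiberDeriv (fun x y => spray Φ x y k) x y
      = (EuclideanSpace.proj (𝕜 := ℝ) k).comp (fiberDeriv (spray Φ) x y) := h.fderiv
  rw [h''] at h'
  have := congrFun (congrArg DFunLike.coe h') (basisVec m)
  rw [nonlinMap, _root_.smul_apply, PiLp.smul_apply, smul_eq_mul, nonlin]
  congr 1

theorem chern_eq (hΦ : FinslerOn Φ U) (hx : x ∈ U) (hy : y ≠ 0) (k i j : Fin n) :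
    chern Φ x y k i j = chernMap Φ x y (basisVec i) (basisVec j) k := by
  have hpos := (hΦ.pos hx hy).ne'
  -- The factor `F/2` of the Cartan tensor cancels the denominator of `N/F`, leaving half the fibre
  -- derivative of `g`. Positivity of `F` enters here.
  have key : ∀ i j s, ∑ m, nonlin Φ x y m j / Φ x y * cartan Φ x y m s i = (1 / 2) *
      fiberDeriv (metric Φ) x y (basisVec i) (nonlinMap Φ x y (basisVec j)) (basisVec s) := by
    intro i j s
    rw [hΦ.fiberDeriv_metric_symm_right hx hy,
      map_eq_sum (fiberDeriv (metric Φ) x y (basisVec i) (basisVec s)), Finset.mul_sum]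
    refine Finset.sum_congr rfl fun m _ => ?_
    rw [hΦ.cartan_eq hx hy, hΦ.nonlin_eq hx hy, smul_eq_mul,
      hΦ.fiberDeriv_metric_symm_right hx hy, hΦ.fiberDeriv_metric_symm_left hx hy,
      hΦ.fiberDeriv_metric_symm_right hx hy]
    field_simp
  have key' : ∀ s, ∑ m, nonlin Φ x y m s / Φ x y * cartan Φ x y m i j = (1 / 2) *
      fiberDeriv (metric Φ) x y (basisVec j) (nonlinMap Φ x y (basisVec s)) (basisVec i) :=
    fun s => key j s i
  rw [chern, chernMap_apply, PiLp.smul_apply, smul_eq_mul, hΦ.formalSymbol_eq hx hy,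
    symbol_apply, sharp_apply, sharp_apply, Finset.mul_sum, Finset.mul_sum,
    ← Finset.sum_sub_distrib]
  refine Finset.sum_congr rfl fun s _ => ?_
  rw [Finset.sum_sub_distrib, Finset.sum_add_distrib, key, key, key', lowerChern_apply]
  ring

end FinslerOn

end Finsler

/-! ### Transformation laws under a change of coordinates. -/

namespace Finsler

variable {n : ℕ}

/-- `φ` is a change of coordinates, which carries the coordinate expression `Φ` of a Finsler
structure to `Φ'`. -/
structure IsTransition (φ : Coord n → Coord n) (U U' : Set (Coord n))
    (Φ Φ' : Coord n → Coord n → ℝ) : Prop where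
  source : FinslerOn Φ U
  target : FinslerOn Φ' U'
  mapsTo : ∀ x ∈ U, φ x ∈ U'
  smooth : ContDiffOn ℝ ∞ φ U
  bijective : ∀ x ∈ U, Function.Bijective (fderiv ℝ φ x)
  eq : ∀ x ∈ U, ∀ y, Φ' (φ x) (fderiv ℝ φ x y) = Φ x y

namespace IsTransition

variable {φ : Coord n → Coord n} {U U' : Set (Coord n)} {Φ Φ' : Coord n → Coord n → ℝ}
  {x y : Coord n}

theorem ne_zero (T : IsTransition φ U U' Φ Φ') (hx : x ∈ U) (hy : y ≠ 0) :
    fderiv ℝ φ x y ≠ 0 := fun h =>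
  hy ((T.bijective x hx).1 (h.trans (map_zero _).symm))

theorem hasFDerivAt (T : IsTransition φ U U' Φ Φ') (hx : x ∈ U) :
    HasFDerivAt φ (fderiv ℝ φ x) x :=
  ((T.smooth.contDiffAt (T.source.isOpen.mem_nhds hx)).differentiableAt (by simp)).hasFDerivAt

theorem smooth_fderiv (T : IsTransition φ U U' Φ Φ') : ContDiffOn ℝ ∞ (fderiv ℝ φ) U :=
  T.smooth.fderiv_of_isOpen T.source.isOpen le_rfl

theorem hasFDerivAt_fderiv (T : IsTransition φ U U' Φ Φ') (hx : x ∈ U) :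
    HasFDerivAt (fderiv ℝ φ) (fderiv ℝ (fderiv ℝ φ) x) x :=
  ((T.smooth_fderiv.contDiffAt (T.source.isOpen.mem_nhds hx)).differentiableAt
    (by simp)).hasFDerivAt

theorem hessian_symm (T : IsTransition φ U U' Φ Φ') (hx : x ∈ U) (v w : Coord n) :
    fderiv ℝ (fderiv ℝ φ) x v w = fderiv ℝ (fderiv ℝ φ) x w v :=
  (T.smooth.contDiffAt (T.source.isOpen.mem_nhds hx)).isSymmSndFDerivAt (by
    rw [minSmoothness_of_isRCLikeNormedField]
    exact WithTop.coe_le_coe.2 (le_top : (2 : ℕ∞) ≤ ⊤)) v w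

/-- On a single fibre the change of coordinates is the linear map J, so fibre derivatives transform
tensorially and no second derivative of φ appears. -/
theorem fiberDeriv_eq {V : Type*} [NormedAddCommGroup V] [NormedSpace ℝ V]
    (T : IsTransition φ U U' Φ Φ') {h h' : Coord n → Coord n → V} (hh' : SmoothSlit U' h')
    (hx : x ∈ U) (hy : y ≠ 0) (H : ∀ y ≠ 0, h x y = h' (φ x) (fderiv ℝ φ x y)) (v : Coord n) :
    fiberDeriv h x y v = fiberDeriv h' (φ x) (fderiv ℝ φ x y) (fderiv ℝ φ x v) := by
  have h1 := (hh'.hasFDerivAt_fiber T.target.isOpen (T.mapsTo x hx) (T.ne_zero hx hy)).comp y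
    (fderiv ℝ φ x).hasFDerivAt
  have h2 : fiberDeriv h x y = fiberDeriv (fun x' y => h' (φ x) (fderiv ℝ φ x y)) x y :=
    fiberDeriv_congr hy H
  rw [h2]
  exact congrFun (congrArg DFunLike.coe h1.fderiv) v

theorem fiberDeriv_energy_eq (T : IsTransition φ U U' Φ Φ') (hx : x ∈ U) (hy : y ≠ 0)
    (v : Coord n) : fiberDeriv (energy Φ) x y v
      = fiberDeriv (energy Φ') (φ x) (fderiv ℝ φ x y) (fderiv ℝ φ x v) :=
  T.fiberDeriv_eq T.target.smooth_energy hx hy (fun y _ => by rw [energy, energy, T.eq x hx]) v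

theorem metric_eq (T : IsTransition φ U U' Φ Φ') (hx : x ∈ U) (hy : y ≠ 0) (v w : Coord n) :
    metric Φ x y v w
      = metric Φ' (φ x) (fderiv ℝ φ x y) (fderiv ℝ φ x v) (fderiv ℝ φ x w) := by
  have hs := FinslerOn.smooth_apply T.target.smooth_fiberDeriv_energy (fderiv ℝ φ x w)
  have h := T.fiberDeriv_eq (h := fun x y => fiberDeriv (energy Φ) x y w) hs hx hy
    (fun y hy => T.fiberDeriv_energy_eq hx hy w) v
  rw [FinslerOn.fiberDeriv_apply_const T.source.smooth_fiberDeriv_energy T.source.isOpen hx hy,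
    FinslerOn.fiberDeriv_apply_const T.target.smooth_fiberDeriv_energy T.target.isOpen
      (T.mapsTo x hx) (T.ne_zero hx hy)] at h
  simp only [metric, _root_.smul_apply, h]

/-- After lowering with the metric of the target, both sides are covectors. Surjectivity of J allows
testing them on vectors of the form J w, where the invariance of `g` applies. -/
theorem sharp_eq (T : IsTransition φ U U' Φ Φ') (hx : x ∈ U) (hy : y ≠ 0)
    {ξ ξ' : Coord n →L[ℝ] ℝ} (hξ : ∀ s, ξ s = ξ' (fderiv ℝ φ x s)) :
    fderiv ℝ φ x (sharp Φ x y ξ) = sharp Φ' (φ x) (fderiv ℝ φ x y) ξ' := by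
  apply T.target.metric_injective (T.mapsTo x hx) (T.ne_zero hx hy)
  rw [T.target.metric_sharp (T.mapsTo x hx) (T.ne_zero hx hy)]
  ext w
  obtain ⟨w, rfl⟩ := (T.bijective x hx).2 w
  rw [← T.metric_eq hx hy, T.source.metric_sharp hx hy, hξ]

theorem fiberDeriv_metric_eq (T : IsTransition φ U U' Φ Φ') (hx : x ∈ U) (hy : y ≠ 0)
    (u v w : Coord n) : fiberDeriv (metric Φ) x y u v w = fiberDeriv (metric Φ') (φ x)
      (fderiv ℝ φ x y) (fderiv ℝ φ x u) (fderiv ℝ φ x v) (fderiv ℝ φ x w) := by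
  have hx' := T.mapsTo x hx
  have hy' := T.ne_zero hx hy
  have hs := FinslerOn.smooth_apply T.source.smooth_metric v
  have hs' := FinslerOn.smooth_apply T.target.smooth_metric (fderiv ℝ φ x v)
  have h := T.fiberDeriv_eq (h := fun x y => metric Φ x y v w)
    (FinslerOn.smooth_apply hs' (fderiv ℝ φ x w)) hx hy (fun y hy => T.metric_eq hx hy v w) u
  rwa [FinslerOn.fiberDeriv_apply_const hs T.source.isOpen hx hy,
    FinslerOn.fiberDeriv_apply_const T.source.smooth_metric T.source.isOpen hx hy,
    FinslerOn.fiberDeriv_apply_const hs' T.target.isOpen hx' hy',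
    FinslerOn.fiberDeriv_apply_const T.target.smooth_metric T.target.isOpen hx' hy'] at h

/-- Chain rule for g'(φ x, J y)(J v, J w), where J depends on `x`. The three terms containing H come
from the fibre variable and from the two arguments of `g'`. -/
theorem baseDeriv_metric_eq (T : IsTransition φ U U' Φ Φ') (hx : x ∈ U) (hy : y ≠ 0)
    (u v w : Coord n) : baseDeriv (metric Φ) x y u v w =
      baseDeriv (metric Φ') (φ x) (fderiv ℝ φ x y)
        (fderiv ℝ φ x u) (fderiv ℝ φ x v) (fderiv ℝ φ x w)
      + fiberDeriv (metric Φ') (φ x) (fderiv ℝ φ x y)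
        (fderiv ℝ (fderiv ℝ φ) x u y) (fderiv ℝ φ x v) (fderiv ℝ φ x w)
      + metric Φ' (φ x) (fderiv ℝ φ x y) (fderiv ℝ (fderiv ℝ φ) x u v) (fderiv ℝ φ x w)
      + metric Φ' (φ x) (fderiv ℝ φ x y) (fderiv ℝ φ x v) (fderiv ℝ (fderiv ℝ φ) x u w) := by
  have hs := FinslerOn.smooth_apply T.source.smooth_metric v
  rw [← FinslerOn.baseDeriv_apply_const T.source.smooth_metric T.source.isOpen hx hy,
    ← FinslerOn.baseDeriv_apply_const hs T.source.isOpen hx hy,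
    baseDeriv_congr (h' := fun x y => metric Φ' (φ x) (fderiv ℝ φ x y) (fderiv ℝ φ x v)
      (fderiv ℝ φ x w)) T.source.isOpen hx fun x hx => T.metric_eq hx hy v w]
  have hJ : ∀ v, HasFDerivAt (fun x => fderiv ℝ φ x v) ((fderiv ℝ (fderiv ℝ φ) x).flip v) x :=
    fun v => by simpa using (T.hasFDerivAt_fderiv hx).clm_apply (hasFDerivAt_const v x)
  have h1 := T.target.smooth_metric.hasFDerivAt T.target.isOpen (T.mapsTo x hx) (T.ne_zero hx hy)
  have h2 := HasFDerivAt.comp (g := fun p : Coord n × Coord n => metric Φ' p.1 p.2)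
    (f := fun x => (φ x, fderiv ℝ φ x y)) x h1 ((T.hasFDerivAt hx).prodMk (hJ y))
  have h3 := (h2.clm_apply (hJ v)).clm_apply (hJ w)
  refine (congrFun (congrArg DFunLike.coe h3.fderiv) u).trans ?_
  simp
  ring

theorem fiberDeriv_metric_self_right (T : IsTransition φ U U' Φ Φ') (hx : x ∈ U) (hy : y ≠ 0)
    (u v : Coord n) : fiberDeriv (metric Φ') (φ x) (fderiv ℝ φ x y) u v (fderiv ℝ φ x y) = 0 := by
  have hx' := T.mapsTo x hx
  have hy' := T.ne_zero hx hy
  rw [T.target.fiberDeriv_metric_symm_right hx' hy', T.target.fiberDeriv_metric_symm_left hx' hy',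
    T.target.fiberDeriv_metric_self hx' hy']
  rfl

/-- The fibre-derivative terms vanish because each has J y as an argument. Of the metric terms,
those with H(s,y) cancel and 2 g'(J s, H(y,y)) remains. -/
theorem spray_eq (T : IsTransition φ U U' Φ Φ') (hx : x ∈ U) (hy : y ≠ 0) :
    fderiv ℝ φ x (spray Φ x y)
      = spray Φ' (φ x) (fderiv ℝ φ x y) + (2 : ℝ) • fderiv ℝ (fderiv ℝ φ) x y y := by
  have hx' := T.mapsTo x hx
  have hy' := T.ne_zero hx hy
  -- The inhomogeneous term is supplied in lowered form, as the covector g'(2H(y,y), ·), so that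
  -- raising the index recovers it.
  rw [spray, symbol_apply, T.sharp_eq hx hy (ξ' := lowerSymbol Φ' (φ x) (fderiv ℝ φ x y)
    (fderiv ℝ φ x y) (fderiv ℝ φ x y) + (2 : ℝ) • metric Φ' (φ x) (fderiv ℝ φ x y)
      (fderiv ℝ (fderiv ℝ φ) x y y)), map_add, map_smul, T.target.sharp_metric hx' hy']
  · rfl
  · intro s
    simp only [lowerSymbol_apply, _root_.add_apply, _root_.smul_apply, smul_eq_mul,
      T.baseDeriv_metric_eq hx hy, T.fiberDeriv_metric_self_right hx hy,
      T.hessian_symm hx s y]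
    rw [T.target.metric_symm hx' hy' (fderiv ℝ φ x y), T.target.metric_symm hx' hy'
      (fderiv ℝ φ x s) (fderiv ℝ (fderiv ℝ φ) x y y)]
    ring

/-- The law of the spray is differentiated in `y`. By symmetry of H the quadratic term 2H(y,y)
contributes 4H(v,y), and the factor 1/4 in `N` normalises it. -/
theorem nonlinMap_eq (T : IsTransition φ U U' Φ Φ') (hx : x ∈ U) (hy : y ≠ 0) (v : Coord n) :
    fderiv ℝ φ x (nonlinMap Φ x y v)
      = nonlinMap Φ' (φ x) (fderiv ℝ φ x y) (fderiv ℝ φ x v) + fderiv ℝ (fderiv ℝ φ) x v y := by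
  have hx' := T.mapsTo x hx
  have hy' := T.ne_zero hx hy
  have h1 := (fderiv ℝ φ x).hasFDerivAt.comp y
    (T.source.smooth_spray.hasFDerivAt_fiber T.source.isOpen hx hy)
  have h2 := (T.target.smooth_spray.hasFDerivAt_fiber T.target.isOpen hx' hy').comp y
    (fderiv ℝ φ x).hasFDerivAt
  have h3 := ((fderiv ℝ (fderiv ℝ φ) x).hasFDerivAt (x := y)).clm_apply (hasFDerivAt_id y)
  have h4 := (h2.add (h3.const_smul (2 : ℝ))).congr_of_eventuallyEq (f₁ := _) <|
    Filter.eventually_of_mem (isOpen_compl_singleton.mem_nhds hy) fun y hy => T.spray_eq hx hy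
  have h5 := congrFun (congrArg DFunLike.coe (h1.unique h4)) v
  have h6 : fderiv ℝ φ x (fiberDeriv (spray Φ) x y v)
      = fiberDeriv (spray Φ') (φ x) (fderiv ℝ φ x y) (fderiv ℝ φ x v)
        + (2 : ℝ) • (fderiv ℝ (fderiv ℝ φ) x y v + fderiv ℝ (fderiv ℝ φ) x v y) := by
    simpa using h5
  rw [nonlinMap, _root_.smul_apply, map_smul, h6, T.hessian_symm hx y v, nonlinMap,
    _root_.smul_apply]
  module

/-- The x-derivatives of `g` produce Cartan terms with an argument H(·,y). The terms H(·,y) in the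
law of `N` cancel them, once the total symmetry of the Cartan tensor has aligned the slots. The
remaining metric terms combine, as for the Levi-Civita connection, to 2 g'(H(v,w), ·). -/
theorem chernMap_eq (T : IsTransition φ U U' Φ Φ') (hx : x ∈ U) (hy : y ≠ 0) (v w : Coord n) :
    fderiv ℝ φ x (chernMap Φ x y v w)
      = chernMap Φ' (φ x) (fderiv ℝ φ x y) (fderiv ℝ φ x v) (fderiv ℝ φ x w)
        + fderiv ℝ (fderiv ℝ φ) x v w := by
  have hx' := T.mapsTo x hx
  have hy' := T.ne_zero hx hy
  rw [chernMap_apply, map_smul, T.sharp_eq hx hy (ξ' := lowerChern Φ' (φ x) (fderiv ℝ φ x y)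
    (fderiv ℝ φ x v) (fderiv ℝ φ x w) + (2 : ℝ) • metric Φ' (φ x) (fderiv ℝ φ x y)
      (fderiv ℝ (fderiv ℝ φ) x v w)), map_add, map_smul, T.target.sharp_metric hx' hy',
    chernMap_apply]
  · module
  · intro s
    simp only [lowerChern_apply, lowerSymbol_apply, _root_.add_apply, _root_.smul_apply,
      smul_eq_mul, T.baseDeriv_metric_eq hx hy, T.fiberDeriv_metric_eq hx hy,
      T.nonlinMap_eq hx hy, map_add]
    rw [T.hessian_symm hx s v, T.hessian_symm hx s w, T.hessian_symm hx w v,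
      T.target.metric_symm hx' hy' (fderiv ℝ φ x s) (fderiv ℝ (fderiv ℝ φ) x v w),
      T.target.metric_symm hx' hy' (fderiv ℝ φ x v) (fderiv ℝ (fderiv ℝ φ) x w s),
      T.target.fiberDeriv_metric_symm_left hx' hy' (fderiv ℝ φ x v)
        (fderiv ℝ (fderiv ℝ φ) x w y),
      T.target.fiberDeriv_metric_symm_right hx' hy' (fderiv ℝ (fderiv ℝ φ) x w y)
        (fderiv ℝ φ x s),
      T.target.fiberDeriv_metric_symm_left hx' hy' (fderiv ℝ φ x w)
        (fderiv ℝ (fderiv ℝ φ) x v y),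
      T.target.fiberDeriv_metric_symm_right hx' hy' (fderiv ℝ (fderiv ℝ φ) x v y)
        (fderiv ℝ φ x s),
      T.target.fiberDeriv_metric_symm_left hx' hy' (fderiv ℝ φ x w)
        (fderiv ℝ (fderiv ℝ φ) x s y),
      T.target.fiberDeriv_metric_symm_right hx' hy' (fderiv ℝ (fderiv ℝ φ) x s y)
        (fderiv ℝ φ x v)]
    ring

theorem fiberDeriv_self_eq (T : IsTransition φ U U' Φ Φ') (hx : x ∈ U) (hy : y ≠ 0)
    (v : Coord n) : fiberDeriv Φ x y v = fiberDeriv Φ' (φ x) (fderiv ℝ φ x y) (fderiv ℝ φ x v) :=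
  T.fiberDeriv_eq T.target.smooth hx hy (fun y _ => (T.eq x hx y).symm) v

theorem cartanMap_eq (T : IsTransition φ U U' Φ Φ') (hx : x ∈ U) (hy : y ≠ 0) (v w : Coord n) :
    fderiv ℝ φ x (cartanMap Φ x y v w)
      = cartanMap Φ' (φ x) (fderiv ℝ φ x y) (fderiv ℝ φ x v) (fderiv ℝ φ x w) := by
  rw [cartanMap_apply, cartanMap_apply, map_smul, T.eq x hx,
    T.sharp_eq hx hy fun s => T.fiberDeriv_metric_eq hx hy v w s]

/-- Every constituent of `B`, namely the Cartan map, the raising of indices, the differential of `F`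
on the fibre and `d`, is natural under J. -/
theorem bMap_eq (T : IsTransition φ U U' Φ Φ') (hx : x ∈ U) (hy : y ≠ 0)
    {d d' : Coord n →L[ℝ] ℝ} (hd : ∀ s, d s = d' (fderiv ℝ φ x s)) (v w : Coord n) :
    fderiv ℝ φ x (bMap Φ d x y v w)
      = bMap Φ' d' (φ x) (fderiv ℝ φ x y) (fderiv ℝ φ x v) (fderiv ℝ φ x w) := by
  simp only [bMap_apply, map_add, map_sub, map_smul, T.cartanMap_eq hx hy, T.sharp_eq hx hy hd,
    T.sharp_eq hx hy (T.fiberDeriv_self_eq hx hy), hd, ← T.fiberDeriv_self_eq hx hy]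

end IsTransition

end Finsler

/-! ### Charts, the tangent bundle and vector fields in coordinates. -/

namespace Finsler

variable {n : ℕ} {M : Type*} [TopologicalSpace M] [ChartedSpace (Coord n) M]
  [IsManifold (𝓡 n) ∞ M]

namespace Chart

theorem contMDiffOn (e : Chart n M) : ContMDiffOn (𝓡 n) (𝓡 n) ∞ e.1 e.1.source :=
  contMDiffOn_of_mem_maximalAtlas e.2

theorem contMDiffOn_symm (e : Chart n M) : ContMDiffOn (𝓡 n) (𝓡 n) ∞ e.1.symm e.1.target :=
  contMDiffOn_symm_of_mem_maximalAtlas e.2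

theorem mdifferentiable (e : Chart n M) : e.1.MDifferentiable (𝓡 n) (𝓡 n) :=
  ⟨e.contMDiffOn.mdifferentiableOn (by simp), e.contMDiffOn_symm.mdifferentiableOn (by simp)⟩

/-- The change of coordinates from `e` to `e'`. -/
def transition (e e' : Chart n M) (x : Coord n) : Coord n := e'.1 (e.1.symm x)

theorem isOpen_overlap (e e' : Chart n M) : IsOpen (e.overlap e') :=
  e.1.isOpen_inter_preimage_symm e'.1.open_source

theorem overlap_subset (e e' : Chart n M) : e.overlap e' ⊆ e.1.target := fun _ h => h.1

variable {e e' : Chart n M} {x y : Coord n}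

theorem transition_mem_target (hx : x ∈ e.overlap e') : e.transition e' x ∈ e'.1.target :=
  e'.1.map_source hx.2

theorem symm_transition (hx : x ∈ e.overlap e') : e'.1.symm (e.transition e' x) = e.1.symm x :=
  e'.1.left_inv hx.2

theorem contDiffOn_transition (e e' : Chart n M) :
    ContDiffOn ℝ ∞ (e.transition e') (e.overlap e') := by
  rw [← contMDiffOn_iff_contDiffOn]
  exact e'.contMDiffOn.comp (e.contMDiffOn_symm.mono fun _ h => h.1) fun _ h => h.2

theorem fderiv_transition (hx : x ∈ e.overlap e') (v : Coord n) :
    fderiv ℝ (e.transition e') x v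
      = mfderiv (𝓡 n) (𝓡 n) e'.1 (e.1.symm x) (mfderiv (𝓡 n) (𝓡 n) e.1.symm x v) := by
  have h := mfderiv_comp x (e'.mdifferentiable.mdifferentiableAt hx.2)
    (e.mdifferentiable.mdifferentiableAt_symm hx.1)
  rw [mfderiv_eq_fderiv] at h
  exact congrFun (congrArg DFunLike.coe h) v

theorem mfderiv_symm_mfderiv (e : Chart n M) {p : M} (hp : p ∈ e.1.source) (v : Coord n) :
    mfderiv (𝓡 n) (𝓡 n) e.1.symm (e.1 p) (mfderiv (𝓡 n) (𝓡 n) e.1 p v) = v :=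
  congrFun (congrArg DFunLike.coe (e.mdifferentiable.symm_comp_deriv hp)) v

theorem mfderiv_symm_injective (hx : x ∈ e.1.target) :
    Function.Injective (mfderiv (𝓡 n) (𝓡 n) e.1.symm x) :=
  e.mdifferentiable.symm.mfderiv_injective hx

theorem bijective_fderiv_transition (hx : x ∈ e.overlap e') :
    Function.Bijective (fderiv ℝ (e.transition e') x) := by
  have h := (e'.mdifferentiable.mfderiv_bijective hx.2).comp
    (e.mdifferentiable.symm.mfderiv_bijective hx.1)
  have h' : ⇑(fderiv ℝ (e.transition e') x) = fun v : Coord n =>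
      mfderiv (𝓡 n) (𝓡 n) e'.1 (e.1.symm x) (mfderiv (𝓡 n) (𝓡 n) e.1.symm x v) :=
    funext fun v => fderiv_transition hx v
  rw [h']
  exact h

theorem mfderiv_symm_transition (hx : x ∈ e.overlap e') (v : Coord n) :
    mfderiv (𝓡 n) (𝓡 n) e'.1.symm (e.transition e' x) (fderiv ℝ (e.transition e') x v)
      = mfderiv (𝓡 n) (𝓡 n) e.1.symm x v := by
  rw [fderiv_transition hx]
  exact e'.mfderiv_symm_mfderiv hx.2 _

/-- All tangent spaces are definitionally the model space, so vectors over base points that are only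
propositionally equal can be compared there. -/
theorem tangentBundle_mk_eq {p q : M} (h : p = q) {v w : Coord n} (h' : v = w) :
    (⟨p, v⟩ : TangentBundle (𝓡 n) M) = ⟨q, w⟩ := by
  subst h h'
  rfl

theorem point_transition (hx : x ∈ e.overlap e') (y : Coord n) :
    e'.point (e.transition e' x) (fderiv ℝ (e.transition e') x y) = e.point x y :=
  tangentBundle_mk_eq (symm_transition hx) (mfderiv_symm_transition hx y)

theorem point_mem_slit (hx : x ∈ e.1.target) (hy : y ≠ 0) : e.point x y ∈ slit := fun h =>
  hy (mfderiv_symm_injective hx (h.trans (map_zero _).symm))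

theorem point_mfderiv (e : Chart n M) {p : M} (hp : p ∈ e.1.source) (v : TangentSpace (𝓡 n) p) :
    e.point (e.1 p) (mfderiv (𝓡 n) (𝓡 n) e.1 p v) = ⟨p, v⟩ :=
  tangentBundle_mk_eq (e.1.left_inv hp) (e.mfderiv_symm_mfderiv hp v)

theorem contMDiff_tangentBundle_mk : ContMDiff 𝓘(ℝ, Coord n × Coord n) (𝓡 n).tangent ∞
    (fun z : Coord n × Coord n => (⟨z.1, z.2⟩ : TangentBundle (𝓡 n) (Coord n))) := by
  intro z
  apply Bundle.contMDiffAt_totalSpace.2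
  refine ⟨contDiff_fst.contMDiff.contMDiffAt, ?_⟩
  convert! (contDiff_snd (𝕜 := ℝ) (E := Coord n) (F := Coord n)).contMDiff.contMDiffAt with y
  simp
  rfl

/-- Over the target, `e.point` is the tangent map of the inverse chart, precomposed with the
identification of pairs with tangent vectors of coordinate space. -/
theorem contMDiffOn_point (e : Chart n M) :
    ContMDiffOn 𝓘(ℝ, Coord n × Coord n) (𝓡 n).tangent ∞
      (fun z : Coord n × Coord n => e.point z.1 z.2) (e.1.target ×ˢ Set.univ) := by
  have h1 := e.contMDiffOn_symm.contMDiffOn_tangentMapWithin (m := ∞) le_rfl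
    e.1.open_target.uniqueMDiffOn
  have h2 := h1.comp contMDiff_tangentBundle_mk.contMDiffOn
    (s := e.1.target ×ˢ Set.univ) fun z hz => hz.1
  refine h2.congr fun z hz => ?_
  have h3 : tangentMapWithin (𝓡 n) (𝓡 n) e.1.symm e.1.target
      (⟨z.1, z.2⟩ : TangentBundle (𝓡 n) (Coord n))
      = tangentMap (𝓡 n) (𝓡 n) e.1.symm (⟨z.1, z.2⟩ : TangentBundle (𝓡 n) (Coord n)) :=
    tangentMapWithin_eq_tangentMap (e.1.open_target.uniqueMDiffOn z.1 hz.1)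
      (e.mdifferentiable.mdifferentiableAt_symm hz.1)
  exact h3.symm

theorem jac_apply (hx : x ∈ e.overlap e') (a i : Fin n) :
    e.jac e' x a i = fderiv ℝ (e.transition e') x (basisVec i) a := by
  have h1 := (((contDiffOn_transition e e').contDiffAt
    ((isOpen_overlap e e').mem_nhds hx)).differentiableAt (by simp)).hasFDerivAt
  have h2 := (EuclideanSpace.proj (𝕜 := ℝ) a).hasFDerivAt.comp x h1
  exact congrFun (congrArg DFunLike.coe h2.fderiv) (basisVec i)

end Chart

variable {F : TangentBundle (𝓡 n) M → ℝ} {X : (x : M) → TangentSpace (𝓡 n) x}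

theorem smoothSlit_inCoords {h : TangentBundle (𝓡 n) M → ℝ}
    (hh : ContMDiffOn (𝓡 n).tangent 𝓘(ℝ, ℝ) ∞ h slit) (e : Chart n M) :
    SmoothSlit e.1.target (inCoords h e) := by
  rw [SmoothSlit, ← contMDiffOn_iff_contDiffOn]
  exact hh.comp (e.contMDiffOn_point.mono fun z hz => ⟨hz.1, trivial⟩)
    fun z hz => Chart.point_mem_slit hz.1 hz.2

namespace IsFinsler

theorem finslerOn (hF : IsFinsler F) (e : Chart n M) : FinslerOn (inCoords F e) e.1.target where
  isOpen := e.1.open_target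
  nonneg _ _ := hF.nonneg _
  smooth := smoothSlit_inCoords hF.smooth e
  homogeneous _ _ c hc y := by
    rw [inCoords, inCoords, Chart.point, Chart.point, ← hF.homogeneous _ _ c hc]
    congr 2
    exact map_smul _ c y
  posDef := hF.posDef e

theorem isTransition (hF : IsFinsler F) (e e' : Chart n M) :
    IsTransition (e.transition e') (e.overlap e') e'.1.target (inCoords F e) (inCoords F e') where
  source := (hF.finslerOn e).mono (e.isOpen_overlap e') (e.overlap_subset e')
  target := hF.finslerOn e'
  mapsTo _ hx := Chart.transition_mem_target hx
  smooth := e.contDiffOn_transition e'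
  bijective _ hx := Chart.bijective_fderiv_transition hx
  eq _ hx y := congrArg F (Chart.point_transition hx y)

theorem contMDiffOn_log (hF : IsFinsler F) :
    ContMDiffOn (𝓡 n).tangent 𝓘(ℝ, ℝ) ∞ (fun q => Real.log (F q)) slit := by
  -- Positivity is known in coordinates, so it is taken from the preferred chart at the base point.
  have h : ∀ q ∈ slit, F q ≠ 0 := by
    rintro ⟨p, v⟩ hv
    let e : Chart n M := ⟨chartAt (Coord n) p, IsManifold.chart_mem_maximalAtlas p⟩
    have hp : p ∈ e.1.source := mem_chart_source (Coord n) p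
    have h0 : mfderiv (𝓡 n) (𝓡 n) e.1 p v ≠ 0 := fun h =>
      hv (e.mdifferentiable.mfderiv_injective hp (h.trans (map_zero _).symm))
    have h1 := ((hF.finslerOn e).pos (e.1.map_source hp) h0).ne'
    exact fun h2 => h1 ((congrArg F (e.point_mfderiv hp v)).trans h2)
  intro q hq
  exact (Real.contDiffAt_log.2 (h q hq)).contMDiffAt.comp_contMDiffWithinAt q (hF.smooth q hq)

end IsFinsler

/-- The covector `d log F` at `(x, y)` in the chart `e`. -/
def dLogForm (u : CotangentMorphism n M) (F : TangentBundle (𝓡 n) M → ℝ) (e : Chart n M)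
    (x y : Coord n) : Coord n →L[ℝ] ℝ :=
  ContinuousLinearMap.comp (M₂ := Coord n) (u.toFun (e.point x y)
    (mfderiv (𝓡 n).tangent 𝓘(ℝ, ℝ) (fun q => Real.log (F q)) (e.point x y)))
    (mfderiv (𝓡 n) (𝓡 n) e.1.symm x)

/-- The morphism `u` lives on the tangent bundle itself, so both charts evaluate the same covector
on the same vector. -/
theorem dLogForm_transition (u : CotangentMorphism n M) (F : TangentBundle (𝓡 n) M → ℝ)
    {e e' : Chart n M} {x : Coord n} (hx : x ∈ e.overlap e') (y v : Coord n) :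
    dLogForm u F e x y v = dLogForm u F e' (e.transition e' x)
      (fderiv ℝ (e.transition e') x y) (fderiv ℝ (e.transition e') x v) := by
  -- Naming the dependence on the point, with values in a fixed space, lets the point be rewritten
  -- without disturbing the dependent types.
  let L : TangentBundle (𝓡 n) M → Coord n →L[ℝ] ℝ := fun p =>
    u.toFun p (mfderiv (𝓡 n).tangent 𝓘(ℝ, ℝ) (fun q => Real.log (F q)) p)
  change L (e.point x y) (mfderiv (𝓡 n) (𝓡 n) e.1.symm x v) = L (e'.point _ _)
    (mfderiv (𝓡 n) (𝓡 n) e'.1.symm (e.transition e' x) (fderiv ℝ (e.transition e') x v))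
  rw [Chart.point_transition hx]
  exact congrArg (L (e.point x y)) (Chart.mfderiv_symm_transition hx v).symm

theorem IsFinsler.smooth_dLog (hF : IsFinsler F) (u : CotangentMorphism n M) (e : Chart n M)
    (r : Fin n) : SmoothSlit e.1.target fun x y => dLog u F e x y r :=
  u.smooth _ hF.contMDiffOn_log e r

/-! ### The components of a vector field -/

theorem components_transition (X : (x : M) → TangentSpace (𝓡 n) x) {e e' : Chart n M}
    {x : Coord n} (hx : x ∈ e.overlap e') : components X e' (e.transition e' x)
      = fderiv ℝ (e.transition e') x (components X e x) := by
  let g : M → Coord n := fun p => mfderiv (𝓡 n) (𝓡 n) e'.1 p (X p)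
  rw [Chart.fderiv_transition hx]
  refine (congrArg g (Chart.symm_transition hx)).trans ?_
  have h := e.mfderiv_symm_mfderiv (e.1.map_target hx.1) (X (e.1.symm x))
  rw [e.1.right_inv hx.1] at h
  exact congrArg (mfderiv (𝓡 n) (𝓡 n) e'.1 (e.1.symm x)) h.symm

theorem components_ne_zero (hX0 : ∀ x, X x ≠ 0) {e : Chart n M} {x : Coord n}
    (hx : x ∈ e.1.target) : components X e x ≠ 0 := fun h =>
  hX0 _ (e.mdifferentiable.mfderiv_injective (e.1.map_target hx) (h.trans (map_zero _).symm))

theorem contDiffOn_components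
    (hX : ContMDiff (𝓡 n) (𝓡 n).tangent ∞ (fun x => (⟨x, X x⟩ : TangentBundle (𝓡 n) M)))
    (e : Chart n M) : ContDiffOn ℝ ∞ (components X e) e.1.target := by
  rw [← contMDiffOn_iff_contDiffOn]
  have h1 := e.contMDiffOn.contMDiffOn_tangentMapWithin (m := ∞) le_rfl
    e.1.open_source.uniqueMDiffOn
  have h2 := (contMDiff_snd_tangentBundle_modelSpace (n := ∞) (Coord n) (𝓡 n)).comp_contMDiffOn
    (h1.comp (hX.comp_contMDiffOn e.contMDiffOn_symm) fun x hx => e.1.map_target hx)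
  refine h2.congr fun x hx => ?_
  change (tangentMap (𝓡 n) (𝓡 n) e.1 ⟨e.1.symm x, X (e.1.symm x)⟩).2 = _
  rw [← tangentMapWithin_eq_tangentMap
    (e.1.open_source.uniqueMDiffOn _ (e.1.map_target hx))]
  · rfl
  · exact e.mdifferentiable.mdifferentiableAt (e.1.map_target hx)

/-- As `X` has no zeros, its graph stays in the slit bundle, which is the only place where the
component functions are known to be smooth. -/
theorem contDiffOn_subst
    (hX : ContMDiff (𝓡 n) (𝓡 n).tangent ∞ (fun x => (⟨x, X x⟩ : TangentBundle (𝓡 n) M)))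
    (hX0 : ∀ x, X x ≠ 0) (e : Chart n M) {h : Coord n → Coord n → ℝ}
    (hh : SmoothSlit e.1.target h) :
    ContDiffOn ℝ ∞ (fun x => h x (components X e x)) e.1.target :=
  ContDiffOn.comp (g := fun p : Coord n × Coord n => h p.1 p.2) hh
    (contDiffOn_id.prodMk (contDiffOn_components hX e)) fun _ hx => ⟨hx, components_ne_zero hX0 hx⟩

end Finsler

namespace Finsler

open Matrix

variable {n : ℕ}

/-! ### Components of tensors under a linear change of coordinates -/

/-- `T` and `T'` are the components of one `(1,2)`-tensor in two coordinate systems with Jacobian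
matrix `J`. -/
def IsTensor (J : Matrix (Fin n) (Fin n) ℝ) (T T' : Fin n → Fin n → Fin n → ℝ) : Prop :=
  ∀ c i j, ∑ k, J c k * T k i j = ∑ a, ∑ b, T' c a b * (J a i * J b j)

/-- `ξ` and `ξ'` are the components of one covector in two coordinate systems with Jacobian
matrix `J`. -/
def IsCovector (J : Matrix (Fin n) (Fin n) ℝ) (ξ ξ' : Fin n → ℝ) : Prop :=
  ∀ j, ξ j = ∑ b, ξ' b * J b j

variable {J : Matrix (Fin n) (Fin n) ℝ}

namespace IsTensor

variable {T T' S S' : Fin n → Fin n → Fin n → ℝ}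

theorem add (hT : IsTensor J T T') (hS : IsTensor J S S') :
    IsTensor J (fun k i j => T k i j + S k i j) (fun k i j => T' k i j + S' k i j) := by
  intro c i j
  simp only [mul_add, add_mul, Finset.sum_add_distrib, hT c i j, hS c i j]

theorem sub (hT : IsTensor J T T') (hS : IsTensor J S S') :
    IsTensor J (fun k i j => T k i j - S k i j) (fun k i j => T' k i j - S' k i j) := by
  intro c i j
  simp only [mul_sub, sub_mul, Finset.sum_sub_distrib, hT c i j, hS c i j]

theorem const_mul (r : ℝ) (hT : IsTensor J T T') :
    IsTensor J (fun k i j => r * T k i j) (fun k i j => r * T' k i j) := by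
  intro c i j
  simp only [mul_left_comm _ r, mul_assoc r, ← Finset.mul_sum, hT c i j]

theorem swap (hT : IsTensor J T T') :
    IsTensor J (fun k i j => T k j i) (fun k i j => T' k j i) := by
  intro c i j
  rw [hT c j i, Finset.sum_comm]
  simp only [mul_comm (J _ j)]

/-- For fixed `j` the tensor law reads J T = M J. Thus T is similar to M, and similar matrices have
equal traces. -/
theorem trace_left (hJ : IsUnit J.det) (hT : IsTensor J T T') :
    IsCovector J (fun j => ∑ t, T t t j) (fun j => ∑ t, T' t t j) := by
  intro j
  let M : Matrix (Fin n) (Fin n) ℝ := Matrix.of fun c a => ∑ b, T' c a b * J b j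
  have h : J * Matrix.of (fun k i => T k i j) = M * J := by
    ext c i
    rw [Matrix.mul_apply, Matrix.mul_apply]
    simp only [M, Matrix.of_apply]
    rw [hT c i j]
    simp only [Finset.sum_mul]
    exact Finset.sum_congr rfl fun a _ => Finset.sum_congr rfl fun b _ => by ring
  have h' : Matrix.of (fun k i => T k i j) = J⁻¹ * (M * J) := by
    rw [← h, Matrix.nonsing_inv_mul_cancel_left _ _ hJ]
  have h2 := congrArg Matrix.trace h'
  rw [Matrix.trace_mul_comm, Matrix.mul_nonsing_inv_cancel_right _ _ hJ] at h2
  simp only [Matrix.trace, Matrix.diag, M, Matrix.of_apply] at h2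
  refine h2.trans ?_
  rw [Finset.sum_comm]
  simp only [Finset.sum_mul]

theorem trace_right (hJ : IsUnit J.det) (hT : IsTensor J T T') :
    IsCovector J (fun j => ∑ t, T t j t) (fun j => ∑ t, T' t j t) :=
  hT.swap.trace_left hJ

/-- The identity endomorphism has the same components in all coordinates, so its product with a
covector is a tensor. -/
theorem kron_left {ξ ξ' : Fin n → ℝ} (hξ : IsCovector J ξ ξ') :
    IsTensor J (fun k i j => kron i k * ξ j) (fun k i j => kron i k * ξ' j) := by
  intro c i j
  simp only [kron, hξ j, ite_mul, mul_ite, one_mul, zero_mul, mul_zero, Finset.sum_ite_eq,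
    Finset.mem_univ, if_true]
  rw [Finset.sum_comm, Finset.mul_sum]
  refine Finset.sum_congr rfl fun b _ => ?_
  simp only [Finset.sum_ite_eq', Finset.mem_univ, if_true]
  ring

theorem kron_right {ξ ξ' : Fin n → ℝ} (hξ : IsCovector J ξ ξ') :
    IsTensor J (fun k i j => kron j k * ξ i) (fun k i j => kron j k * ξ' i) :=
  (kron_left hξ).swap

/-- The contraction with a symmetric tensor density. -/
theorem sum_mul_eq (hT : IsTensor J T T') (p : Matrix (Fin n) (Fin n) ℝ) (r : ℝ) (c : Fin n) :
    ∑ a, ∑ b, T' c a b * (r • (J * p * J.transpose)) a b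
      = r * ∑ k, J c k * ∑ i, ∑ j, T k i j * p i j := by
  have h1 : ∑ k, J c k * ∑ i, ∑ j, T k i j * p i j
      = ∑ i, ∑ j, (∑ k, J c k * T k i j) * p i j := by
    simp only [Finset.mul_sum, Finset.sum_mul]
    rw [Finset.sum_comm]
    refine Finset.sum_congr rfl fun i _ => ?_
    rw [Finset.sum_comm]
    exact Finset.sum_congr rfl fun j _ => Finset.sum_congr rfl fun k _ => by ring
  rw [h1]
  simp only [hT c, Matrix.smul_apply, Matrix.mul_apply, Matrix.transpose_apply, smul_eq_mul,
    Finset.mul_sum, Finset.sum_mul]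
  calc _ = ∑ a, ∑ j, ∑ b, ∑ i, T' c a b * (r * (J a i * p i j * J b j)) :=
        Finset.sum_congr rfl fun a _ => Finset.sum_comm
    _ = ∑ a, ∑ j, ∑ i, ∑ b, T' c a b * (r * (J a i * p i j * J b j)) :=
        Finset.sum_congr rfl fun a _ => Finset.sum_congr rfl fun j _ => Finset.sum_comm
    _ = ∑ j, ∑ a, ∑ i, ∑ b, T' c a b * (r * (J a i * p i j * J b j)) := Finset.sum_comm
    _ = ∑ j, ∑ i, ∑ a, ∑ b, T' c a b * (r * (J a i * p i j * J b j)) :=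
        Finset.sum_congr rfl fun a _ => Finset.sum_comm
    _ = ∑ i, ∑ j, ∑ a, ∑ b, T' c a b * (r * (J a i * p i j * J b j)) := Finset.sum_comm
    _ = _ := Finset.sum_congr rfl fun i _ => Finset.sum_congr rfl fun j _ =>
        Finset.sum_congr rfl fun a _ => Finset.sum_congr rfl fun b _ => by ring

/-- Lowering the upper index of a tensor and raising another one. -/
theorem raise_lower {g g' h h' : Matrix (Fin n) (Fin n) ℝ} (hT : IsTensor J T T')
    (hg : g = J.transpose * g' * J) (hh : h' = J * h * J.transpose) :
    IsTensor J (fun k i j => ∑ l, h k l * ∑ s, g s j * T s l i)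
      (fun k i j => ∑ l, h' k l * ∑ s, g' s j * T' s l i) := by
  intro c i j
  let L : Fin n → ℝ := fun l => ∑ s, g s j * T s l i
  -- In `L'` the indices `i` and `j` are already transformed. Only `l` still changes, as for a
  -- covector, and raising it uses no inverse of J.
  let L' : Fin n → ℝ := fun l => ∑ a, ∑ b, (∑ s, g' s b * T' s l a) * (J a i * J b j)
  have hL : L = J.transpose *ᵥ L' := by
    funext l
    have e1 : L l = ∑ a, (g' * J) a j * ∑ s, J a s * T s l i := by
      simp only [L, hg, Matrix.mul_assoc, Matrix.mul_apply (M := J.transpose),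
        Matrix.transpose_apply, Finset.mul_sum, Finset.sum_mul]
      rw [Finset.sum_comm]
      exact Finset.sum_congr rfl fun a _ => Finset.sum_congr rfl fun s _ => by ring
    rw [e1]
    simp only [hT _ l i, L', Matrix.mulVec, dotProduct, Matrix.transpose_apply, Matrix.mul_apply,
      Finset.mul_sum, Finset.sum_mul]
    calc _ = ∑ a, ∑ c, ∑ b, ∑ d, g' a d * J d j * (T' a c b * (J c l * J b i)) :=
          Finset.sum_congr rfl fun a _ => Finset.sum_congr rfl fun c _ => rfl
      _ = ∑ c, ∑ a, ∑ b, ∑ d, g' a d * J d j * (T' a c b * (J c l * J b i)) := Finset.sum_comm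
      _ = ∑ c, ∑ b, ∑ a, ∑ d, g' a d * J d j * (T' a c b * (J c l * J b i)) :=
          Finset.sum_congr rfl fun c _ => Finset.sum_comm
      _ = ∑ c, ∑ b, ∑ d, ∑ a, g' a d * J d j * (T' a c b * (J c l * J b i)) :=
          Finset.sum_congr rfl fun c _ => Finset.sum_congr rfl fun b _ => Finset.sum_comm
      _ = _ := Finset.sum_congr rfl fun c _ => Finset.sum_congr rfl fun b _ =>
          Finset.sum_congr rfl fun d _ => Finset.sum_congr rfl fun a _ => by ring
  have h1 : J *ᵥ (h *ᵥ L) = h' *ᵥ L' := by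
    rw [hL, hh, Matrix.mulVec_mulVec, Matrix.mulVec_mulVec, Matrix.mul_assoc]
  refine (congrFun h1 c).trans ?_
  simp only [Matrix.mulVec, dotProduct, L', Finset.mul_sum, Finset.sum_mul]
  calc _ = ∑ a, ∑ l, ∑ b, ∑ s, h' c l * (g' s b * T' s l a * (J a i * J b j)) := Finset.sum_comm
    _ = ∑ a, ∑ b, ∑ l, ∑ s, h' c l * (g' s b * T' s l a * (J a i * J b j)) :=
        Finset.sum_congr rfl fun a _ => Finset.sum_comm
    _ = _ := Finset.sum_congr rfl fun c _ => Finset.sum_congr rfl fun b _ =>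
          Finset.sum_congr rfl fun d _ => Finset.sum_congr rfl fun a _ => by ring

/-- The product of a symmetric covariant tensor with a raised covector. -/
theorem raise_covector {g g' h h' : Matrix (Fin n) (Fin n) ℝ} {ξ ξ' : Fin n → ℝ}
    (hξ : IsCovector J ξ ξ') (hg : g = J.transpose * g' * J) (hh : h' = J * h * J.transpose) :
    IsTensor J (fun k i j => ∑ l, h k l * (g i j * ξ l))
      (fun k i j => ∑ l, h' k l * (g' i j * ξ' l)) := by
  intro c i j
  have hξ' : ξ = J.transpose *ᵥ ξ' := by
    funext l
    rw [hξ l]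
    simp only [Matrix.mulVec, dotProduct, Matrix.transpose_apply, mul_comm]
  have h1 : J *ᵥ (h *ᵥ ξ) = h' *ᵥ ξ' := by
    rw [hξ', hh, Matrix.mulVec_mulVec, Matrix.mulVec_mulVec, Matrix.mul_assoc]
  have h2 := congrFun h1 c
  simp only [Matrix.mulVec, dotProduct] at h2
  have h3 : g i j = ∑ a, ∑ b, g' a b * (J a i * J b j) := by
    rw [hg]
    simp only [Matrix.mul_apply, Matrix.transpose_apply, Finset.sum_mul]
    rw [Finset.sum_comm]
    exact Finset.sum_congr rfl fun a _ => Finset.sum_congr rfl fun b _ => by ring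
  simp only [mul_left_comm _ (g _ _), mul_left_comm _ (g' _ _), ← Finset.mul_sum]
  rw [h2, h3, Finset.sum_mul]
  refine Finset.sum_congr rfl fun a _ => ?_
  rw [Finset.sum_mul]
  exact Finset.sum_congr rfl fun b _ => by ring

end IsTensor

/-! ### Derivatives of matrices -/

/-- `A'` is the entrywise derivative of `A` at `0`. -/
def HasMatrixDeriv (A : ℝ → Matrix (Fin n) (Fin n) ℝ) (A' : Matrix (Fin n) (Fin n) ℝ) : Prop :=
  ∀ i j, HasDerivAt (fun t => A t i j) (A' i j) 0

namespace HasMatrixDeriv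

variable {A B : ℝ → Matrix (Fin n) (Fin n) ℝ} {A' B' : Matrix (Fin n) (Fin n) ℝ}

theorem unique (h : HasMatrixDeriv A A') (h' : HasMatrixDeriv A B') : A' = B' := by
  ext i j
  exact (h i j).unique (h' i j)

theorem transpose (h : HasMatrixDeriv A A') :
    HasMatrixDeriv (fun t => (A t).transpose) A'.transpose := fun i j => h j i

theorem mul (hA : HasMatrixDeriv A A') (hB : HasMatrixDeriv B B') :
    HasMatrixDeriv (fun t => A t * B t) (A' * B 0 + A 0 * B') := by
  intro i j
  simp only [Matrix.mul_apply, Matrix.add_apply, ← Finset.sum_add_distrib]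
  exact HasDerivAt.fun_sum fun k _ => (hA i k).mul (hB k j)

theorem smul {c : ℝ → ℝ} {c' : ℝ} (hc : HasDerivAt c c' 0) (hA : HasMatrixDeriv A A') :
    HasMatrixDeriv (fun t => c t • A t) (c' • A 0 + c 0 • A') := by
  intro i j
  simp only [Matrix.smul_apply, Matrix.add_apply, smul_eq_mul]
  exact hc.mul (hA i j)

theorem congr (h : HasMatrixDeriv A A') (H : ∀ᶠ t in nhds 0, B t = A t) : HasMatrixDeriv B A' :=
  fun i j => (h i j).congr_of_eventuallyEq (H.mono fun _ ht => congrFun (congrFun ht i) j)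

/-- Jacobi's formula. -/
theorem det (h : HasMatrixDeriv A A') :
    HasDerivAt (fun t => (A t).det) ((A 0).adjugate * A').trace 0 := by
  -- By Cramer's rule the trace is a sum of determinants with one column differentiated, which is
  -- what the product rule yields in the Leibniz expansion.
  have h1 : ((A 0).adjugate * A').trace = ∑ i, ((A 0).updateCol i fun k => A' k i).det := by
    rw [Matrix.trace]
    refine Finset.sum_congr rfl fun i _ => ?_
    rw [← Matrix.cramer_apply, Matrix.cramer_eq_adjugate_mulVec]
    rfl
  rw [h1]
  simp only [Matrix.det_apply']
  rw [Finset.sum_comm]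
  refine HasDerivAt.fun_sum fun σ _ => ?_
  rw [← Finset.mul_sum]
  refine HasDerivAt.const_mul _ ?_
  have h2 := HasDerivAt.fun_finsetProd (u := Finset.univ) fun i _ => h (σ i) i
  convert h2 using 1
  refine Finset.sum_congr rfl fun i _ => ?_
  rw [← Finset.mul_prod_erase Finset.univ _ (Finset.mem_univ i), Matrix.updateCol_self, mul_comm,
    smul_eq_mul]
  congr 1
  exact Finset.prod_congr rfl fun j hj => Matrix.updateCol_ne (Finset.ne_of_mem_erase hj)

/-- The logarithmic derivative of the density factor is a trace. It balances the inhomogeneous part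
of `δ γ^t_{ts}` in the covariant derivative. -/
theorem abs_det_rpow (h : HasMatrixDeriv A A') (h0 : IsUnit (A 0).det) (r : ℝ) :
    HasDerivAt (fun t => |(A t).det| ^ r) (r * ((A 0)⁻¹ * A').trace * |(A 0).det| ^ r) 0 := by
  have h1 : ((A 0)⁻¹ * A').trace = ((A 0).det)⁻¹ * ((A 0).adjugate * A').trace := by
    rw [Matrix.inv_def, Ring.inverse_eq_inv', Matrix.smul_mul, Matrix.trace_smul, smul_eq_mul]
  have hd := h0.ne_zero
  have h2 := (hasDerivAt_abs hd).comp (0 : ℝ) h.det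
  have h3 := h2.rpow_const (p := r) (Or.inl (abs_ne_zero.2 hd))
  refine h3.congr_deriv ?_
  rw [h1, Function.comp_apply, Real.rpow_sub_one (abs_ne_zero.2 hd)]
  rcases lt_or_gt_of_ne hd with hd' | hd'
  · simp only [sign_neg hd', abs_of_neg hd']
    have : (A 0).det ≠ 0 := hd
    field_simp
    simp
  · simp only [sign_pos hd', abs_of_pos hd']
    field_simp
    simp

end HasMatrixDeriv

end Finsler

/-! ### Transformation laws along the vector field, in components. -/

namespace Finsler

open Matrix

variable {n : ℕ} {M : Type*} [TopologicalSpace M] [ChartedSpace (Coord n) M]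
  [IsManifold (𝓡 n) ∞ M] {F : TangentBundle (𝓡 n) M → ℝ} {X : (x : M) → TangentSpace (𝓡 n) x}
  {e e' : Chart n M} {x : Coord n}

namespace Chart

theorem sum_jac_mul (hx : x ∈ e.overlap e') (c : Fin n) (v : Coord n) :
    ∑ k, e.jac e' x c k * v k = fderiv ℝ (e.transition e') x v c := by
  rw [map_eq_sum (fderiv ℝ (e.transition e') x) v, WithLp.ofLp_sum, Finset.sum_apply]
  refine Finset.sum_congr rfl fun k _ => ?_
  rw [jac_apply hx, PiLp.smul_apply, smul_eq_mul, mul_comm]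

theorem isUnit_det_jac (hx : x ∈ e.overlap e') : IsUnit (e.jac e' x).det := by
  rw [← Matrix.isUnit_iff_isUnit_det, ← Matrix.mulVec_injective_iff_isUnit]
  intro v w h
  have h' : fderiv ℝ (e.transition e') x (WithLp.toLp 2 v)
      = fderiv ℝ (e.transition e') x (WithLp.toLp 2 w) := by
    ext c
    rw [← sum_jac_mul hx, ← sum_jac_mul hx]
    exact congrFun h c
  exact congrArg WithLp.ofLp ((bijective_fderiv_transition hx).1 h')

/-- The second derivatives of the change of coordinates. -/
def hess (e e' : Chart n M) (x : Coord n) (c i j : Fin n) : ℝ :=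
  fderiv ℝ (fderiv ℝ (e.transition e')) x (basisVec i) (basisVec j) c

/-- A bridge from invariant laws to components. The inhomogeneity `h` is the second derivative of
the transition map for `γ` and zero for `B`. -/
theorem sum_jac_mul_bilin (hx : x ∈ e.overlap e') {β β' : Coord n →ₗ[ℝ] Coord n →ₗ[ℝ] Coord n}
    {h : Coord n} {i j : Fin n} (H : fderiv ℝ (e.transition e') x (β (basisVec i) (basisVec j))
      = β' (fderiv ℝ (e.transition e') x (basisVec i)) (fderiv ℝ (e.transition e') x (basisVec j))
        + h) (c : Fin n) :
    ∑ k, e.jac e' x c k * β (basisVec i) (basisVec j) k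
      = ∑ a, ∑ b, β' (basisVec a) (basisVec b) c * (e.jac e' x a i * e.jac e' x b j) + h c := by
  rw [sum_jac_mul hx, H, PiLp.add_apply, FinslerOn.bilin_eq_sum]
  congr 1
  refine Finset.sum_congr rfl fun a _ => Finset.sum_congr rfl fun b _ => ?_
  rw [jac_apply hx, jac_apply hx]
  ring

end Chart

namespace IsFinsler

theorem gLowX_transition (hF : IsFinsler F) (hX0 : ∀ x, X x ≠ 0) (hx : x ∈ e.overlap e') :
    gLowX F X e x
      = (e.jac e' x).transpose * gLowX F X e' (e.transition e' x) * e.jac e' x := by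
  have T := hF.isTransition e e'
  have hy := components_ne_zero hX0 hx.1
  ext i j
  rw [gLowX, subst, T.source.gLow_eq hx hy, T.metric_eq hx hy,
    T.target.metric_eq_sum (T.mapsTo x hx) (T.ne_zero hx hy), Finset.sum_comm]
  simp only [Matrix.mul_apply, Matrix.transpose_apply, Chart.jac_apply hx, subst,
    components_transition X hx, Finset.sum_mul]
  exact Finset.sum_congr rfl fun a _ => Finset.sum_congr rfl fun b _ => by ring

theorem gUpX_transition (hF : IsFinsler F) (hX0 : ∀ x, X x ≠ 0) (hx : x ∈ e.overlap e') :
    gUpX F X e' (e.transition e' x)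
      = e.jac e' x * gUpX F X e x * (e.jac e' x).transpose := by
  have hJ := Chart.isUnit_det_jac hx
  have hJt : IsUnit (e.jac e' x).transpose.det := by rwa [Matrix.det_transpose]
  have h : gUpX F X e x = (gLowX F X e x)⁻¹ := rfl
  have h' : gUpX F X e' (e.transition e' x) = (gLowX F X e' (e.transition e' x))⁻¹ := rfl
  rw [h', h, hF.gLowX_transition hX0 hx, Matrix.mul_inv_rev, Matrix.mul_inv_rev,
    Matrix.mul_nonsing_inv_cancel_left _ _ hJ, Matrix.nonsing_inv_mul_cancel_right _ _ hJt]

/-- The components of `X` are themselves carried over by J, so the law at (x, y) may be read at `y =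
X`. The result is the law of a linear connection. -/
theorem chernX_transition (hF : IsFinsler F) (hX0 : ∀ x, X x ≠ 0) (hx : x ∈ e.overlap e')
    (c i j : Fin n) :
    ∑ k, e.jac e' x c k * chernX F X e x k i j
      = ∑ a, ∑ b, chernX F X e' (e.transition e' x) c a b * (e.jac e' x a i * e.jac e' x b j)
        + e.hess e' x c i j := by
  have T := hF.isTransition e e'
  have hy := components_ne_zero hX0 hx.1
  have h := Chart.sum_jac_mul_bilin hx (T.chernMap_eq hx hy (basisVec i) (basisVec j)) c
  rw [← components_transition X hx] at h
  simp only [← T.source.chern_eq hx hy, ← T.target.chern_eq (T.mapsTo x hx)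
    (components_ne_zero hX0 (Chart.transition_mem_target hx))] at h
  exact h

theorem bX_transition (hF : IsFinsler F) (hX0 : ∀ x, X x ≠ 0) (u : CotangentMorphism n M)
    (hx : x ∈ e.overlap e') :
    IsTensor (e.jac e' x) (bX F X u e x) (bX F X u e' (e.transition e' x)) := by
  intro c i j
  have T := hF.isTransition e e'
  have hy := components_ne_zero hX0 hx.1
  have h := Chart.sum_jac_mul_bilin hx ((T.bMap_eq hx hy
    (dLogForm_transition u F hx (components X e x)) (basisVec i) (basisVec j)).trans
    (add_zero _).symm) c
  rw [← components_transition X hx] at h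
  simp only [← T.source.bTensor_eq hx hy, PiLp.zero_apply, add_zero,
    ← T.target.bTensor_eq (T.mapsTo x hx)
      (components_ne_zero hX0 (Chart.transition_mem_target hx))] at h
  exact h

theorem isTensor_gB (hF : IsFinsler F) (hX0 : ∀ x, X x ≠ 0) (u : CotangentMorphism n M) (δ : ℝ)
    (hx : x ∈ e.overlap e') :
    IsTensor (e.jac e' x) (gB F X u δ e x) (gB F X u δ e' (e.transition e' x)) := by
  have hB := hF.bX_transition hX0 u hx
  have hg := hF.gLowX_transition hX0 hx
  have hh := hF.gUpX_transition hX0 hx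
  have h1 := hB.raise_lower hg hh
  have h2 := IsTensor.raise_covector (hB.trace_right (Chart.isUnit_det_jac hx)) hg hh
  have key : ∀ (e : Chart n M) (x : Coord n), gB F X u δ e x = fun k i j =>
      (∑ l, gUpX F X e x k l * ∑ s, gLowX F X e x s j * bX F X u e x s l i)
      + (∑ l, gUpX F X e x k l * ∑ s, gLowX F X e x s i * bX F X u e x s l j)
      - δ * ∑ l, gUpX F X e x k l * (gLowX F X e x i j * ∑ t, bX F X u e x t l t) := by
    intro e x
    funext k i j
    rw [gB, Finset.mul_sum, ← Finset.sum_add_distrib, ← Finset.sum_sub_distrib]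
    refine Finset.sum_congr rfl fun l _ => ?_
    rw [Finset.sum_add_distrib]
    ring
  rw [key, key]
  exact (h1.add h1.swap).sub (h2.const_mul δ)

end IsFinsler

namespace Chart

/-- The diffeomorphism cancels between the two charts. Pulled-back objects therefore obey the same
laws as the originals, with the same J and H at the same point. -/
theorem transition_comp (e e' : Chart n M) (f : Diff n M) :
    (e.comp f).transition (e'.comp f) = e.transition e' := by
  funext z
  change e'.1 (f (f.symm (e.1.symm z))) = _
  rw [f.apply_symm_apply]
  rfl

theorem hess_comp (e e' : Chart n M) (f : Diff n M) :
    (e.comp f).hess (e'.comp f) = e.hess e' := by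
  funext x c i j
  rw [hess, transition_comp, hess]

theorem mem_overlap_comp (hx : x ∈ e.overlap e') (f : Diff n M) :
    x ∈ (e.comp f).overlap (e'.comp f) := by
  rwa [overlap_comp]

end Chart

namespace IsFinsler

/-- Both connections carry the same inhomogeneous term, which drops out of their difference. -/
theorem isTensor_ell (hF : IsFinsler F) (hX0 : ∀ x, X x ≠ 0) (f : Diff n M)
    (hx : x ∈ e.overlap e') :
    IsTensor (e.jac e' x) (ell F X f e x) (ell F X f e' (e.transition e' x)) := by
  intro c i j
  have h1 := hF.chernX_transition hX0 hx c i j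
  have h2 := hF.chernX_transition hX0 (Chart.mem_overlap_comp hx f.symm) c i j
  rw [Chart.jac_comp, Chart.transition_comp, Chart.hess_comp] at h2
  simp only [ell, pullback, mul_sub, sub_mul, Finset.sum_sub_distrib, h1, h2]
  ring

theorem isTensor_deltaB (hF : IsFinsler F) (hX0 : ∀ x, X x ≠ 0) (u : CotangentMorphism n M)
    (f : Diff n M) (hx : x ∈ e.overlap e') :
    IsTensor (e.jac e' x) (deltaB F X u f e x) (deltaB F X u f e' (e.transition e' x)) := by
  have h := hF.bX_transition hX0 u (Chart.mem_overlap_comp hx f.symm)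
  rw [Chart.jac_comp, Chart.transition_comp] at h
  exact h.sub (hF.bX_transition hX0 u hx)

theorem isTensor_zeroOrder (hF : IsFinsler F) (hX0 : ∀ x, X x ≠ 0) (u : CotangentMorphism n M)
    (δ : ℝ) (f : Diff n M) (hx : x ∈ e.overlap e') :
    IsTensor (e.jac e' x) (zeroOrder F X u δ f e x)
      (zeroOrder F X u δ f e' (e.transition e' x)) := by
  have hJ := Chart.isUnit_det_jac hx
  have hl := hF.isTensor_ell hX0 f hx
  have hb := hF.isTensor_deltaB hX0 u f hx
  have hg := hF.isTensor_gB hX0 u δ hx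
  have hg' := hF.isTensor_gB hX0 u δ (Chart.mem_overlap_comp hx f.symm)
  rw [Chart.jac_comp, Chart.transition_comp] at hg'
  have tl := hl.trace_left hJ
  have tb := hb.trace_right hJ
  exact ((((hl.sub (((IsTensor.kron_left tl).add (IsTensor.kron_right tl)).const_mul
    (1 / n))).const_mul (2 - δ * n)).add hg).sub hg').sub
    ((hb.sub (((IsTensor.kron_left tb).add (IsTensor.kron_right tb)).const_mul
      (1 / n))).const_mul (2 - δ * n))

/-! ### The covariant derivative of a tensor density -/

/-- The covariant derivative in the direction `s` as a matrix. -/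
theorem covDeriv_eq (δ : ℝ) (e : Chart n M) (p : Coord n → Matrix (Fin n) (Fin n) ℝ) (x : Coord n)
    (s : Fin n) : Matrix.of (covDeriv F X δ e p x s)
      = Matrix.of (fun i j => pd s (fun z => p z i j) x)
        + Matrix.of (fun i m => chernX F X e x i s m) * p x
        + p x * (Matrix.of fun i m => chernX F X e x i s m).transpose
        - (δ * ∑ t, chernX F X e x t t s) • p x := by
  ext i j
  simp only [covDeriv, Matrix.of_apply, Matrix.add_apply, Matrix.sub_apply, Matrix.mul_apply,
    Matrix.transpose_apply, Matrix.smul_apply, smul_eq_mul, mul_comm (p x _ _)]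

theorem hasDerivAt_line {f : Coord n → ℝ} {f' : Coord n →L[ℝ] ℝ} {x : Coord n}
    (hf : HasFDerivAt f f' x) (v : Coord n) :
    HasDerivAt (fun t : ℝ => f (x + t • v)) (f' v) 0 := by
  have h1 : HasDerivAt (fun t : ℝ => x + t • v) v 0 := by
    simpa using ((hasDerivAt_id (0 : ℝ)).smul_const v).const_add x
  have h2 : HasFDerivAt f f' (x + (0 : ℝ) • v) := by simpa using hf
  exact h2.comp_hasDerivAt 0 h1

theorem hess_symm (hx : x ∈ e.overlap e') (c i j : Fin n) : e.hess e' x c i j = e.hess e' x c j i := by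
  rw [Chart.hess, Chart.hess, (((Chart.contDiffOn_transition e e').contDiffAt
    ((Chart.isOpen_overlap e e').mem_nhds hx)).isSymmSndFDerivAt (by
      rw [minSmoothness_of_isRCLikeNormedField]
      exact WithTop.coe_le_coe.2 (le_top : (2 : ℕ∞) ≤ ⊤)) :
        IsSymmSndFDerivAt ℝ (e.transition e') x)]

theorem hasMatrixDeriv_jac (hx : x ∈ e.overlap e') (s : Fin n) :
    HasMatrixDeriv (fun t : ℝ => e.jac e' (x + t • basisVec s))
      (Matrix.of fun c m => e.hess e' x c s m) := by
  intro c m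
  have h1 : ContDiffOn ℝ ∞ (fderiv ℝ (e.transition e')) (e.overlap e') :=
    (Chart.contDiffOn_transition e e').fderiv_of_isOpen (Chart.isOpen_overlap e e') le_rfl
  have h2 := ((h1.contDiffAt ((Chart.isOpen_overlap e e').mem_nhds hx)).differentiableAt
    (by simp)).hasFDerivAt
  have h3 := (EuclideanSpace.proj (𝕜 := ℝ) c).hasFDerivAt.comp x
    (h2.clm_apply (hasFDerivAt_const (basisVec m) x))
  have h4 : HasFDerivAt (fun z => e.jac e' z c m) _ x := h3.congr_of_eventuallyEq <|
    Filter.eventually_of_mem ((Chart.isOpen_overlap e e').mem_nhds hx) fun z hz =>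
      Chart.jac_apply hz c m
  convert hasDerivAt_line h4 (basisVec s) using 1
  simp [Chart.hess]

theorem hasMatrixDeriv_line {s : Set (Coord n)} (hs : IsOpen s) (hx : x ∈ s)
    {p : Coord n → Matrix (Fin n) (Fin n) ℝ}
    (hp : ∀ i j, ContDiffOn ℝ ∞ (fun z => p z i j) s) (k : Fin n) :
    HasMatrixDeriv (fun t : ℝ => p (x + t • basisVec k))
      (Matrix.of fun i j => pd k (fun z => p z i j) x) := fun i j =>
  hasDerivAt_line (((hp i j).contDiffAt (hs.mem_nhds hx)).differentiableAt (by simp)).hasFDerivAt _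

/-- The components of a tensor density in the coordinates `e'`, differentiated along the
coordinate lines of `e`. -/
theorem hasMatrixDeriv_transition (hx : x ∈ e.overlap e')
    {p : Coord n → Matrix (Fin n) (Fin n) ℝ}
    (hp : ∀ i j, ContDiffOn ℝ ∞ (fun z => p z i j) e'.1.target) (s : Fin n) :
    HasMatrixDeriv (fun t : ℝ => p (e.transition e' (x + t • basisVec s)))
      (∑ d, e.jac e' x d s •
        Matrix.of fun i j => pd d (fun z => p z i j) (e.transition e' x)) := by
  intro i j
  have h1 := (((hp i j).contDiffAt (e'.1.open_target.mem_nhds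
    (Chart.transition_mem_target hx))).differentiableAt (by simp)).hasFDerivAt
  have h2 := (((Chart.contDiffOn_transition e e').contDiffAt
    ((Chart.isOpen_overlap e e').mem_nhds hx)).differentiableAt (by simp)).hasFDerivAt
  refine (hasDerivAt_line (h1.comp x h2) (basisVec s)).congr_deriv ?_
  rw [ContinuousLinearMap.comp_apply, map_eq_sum (fderiv ℝ (fun z => p z i j) _), Matrix.sum_apply]
  refine Finset.sum_congr rfl fun d _ => ?_
  rw [← Chart.jac_apply hx, Matrix.smul_apply, Matrix.of_apply]
  rfl

/-- The law of transformation of the covariant derivative of a tensor density. -/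
theorem covDeriv_transition (hF : IsFinsler F) (hX0 : ∀ x, X x ≠ 0) {δ : ℝ}
    (hx : x ∈ e.overlap e') {p p' : Coord n → Matrix (Fin n) (Fin n) ℝ}
    (hp : ∀ i j, ContDiffOn ℝ ∞ (fun z => p z i j) e.1.target)
    (hp' : ∀ i j, ContDiffOn ℝ ∞ (fun z => p' z i j) e'.1.target)
    (h : ∀ z ∈ e.overlap e', p' (e.transition e' z)
      = |(e.jac e' z).det| ^ (-δ) • (e.jac e' z * p z * (e.jac e' z).transpose)) (s : Fin n) :
    ∑ d, e.jac e' x d s • Matrix.of (covDeriv F X δ e' p' (e.transition e' x) d)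
      = |(e.jac e' x).det| ^ (-δ) •
        (e.jac e' x * Matrix.of (covDeriv F X δ e p x s) * (e.jac e' x).transpose) := by
  have hJu := Chart.isUnit_det_jac hx
  have hzero : x + (0 : ℝ) • basisVec s = x := by simp
  have hJ := hasMatrixDeriv_jac hx s
  have hdet := hJ.abs_det_rpow (by rwa [hzero]) (-δ)
  have hP := hasMatrixDeriv_line e.1.open_target hx.1 hp s
  have hR := HasMatrixDeriv.smul hdet ((hJ.mul hP).mul hJ.transpose)
  have hL := hasMatrixDeriv_transition hx hp' s
  have hcont : ∀ᶠ t : ℝ in nhds 0, x + t • basisVec s ∈ e.overlap e' := by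
    have hc : Continuous fun t : ℝ => x + t • basisVec s := by fun_prop
    exact hc.continuousAt.eventually_mem
      (by rw [hzero]; exact (Chart.isOpen_overlap e e').mem_nhds hx)
  -- The density law is differentiated along a coordinate line of `e` in two ways: by the chain rule
  -- on the left and the product rule on the right. The line stays in the overlap for small
  -- parameters.
  have hD := hL.unique (hR.congr (hcont.mono fun t ht => h _ ht))
  simp only [hzero] at hD
  have hG : e.jac e' x * Matrix.of (fun i m => chernX F X e x i s m)
      = (∑ d, e.jac e' x d s •
          Matrix.of fun i m => chernX F X e' (e.transition e' x) i d m) * e.jac e' x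
        + Matrix.of fun c m => e.hess e' x c s m := by
    ext c m
    rw [Matrix.mul_apply, Matrix.add_apply]
    refine (hF.chernX_transition hX0 hx c s m).trans ?_
    rw [Matrix.of_apply, Matrix.mul_apply]
    congr 1
    rw [Finset.sum_comm]
    refine Finset.sum_congr rfl fun b _ => ?_
    rw [Matrix.sum_apply, Finset.sum_mul]
    refine Finset.sum_congr rfl fun a _ => ?_
    rw [Matrix.smul_apply, Matrix.of_apply, smul_eq_mul]
    ring
  -- The traced connection law. Its inhomogeneous part tr(J⁻¹H) is the trace that occurs in the
  -- derivative of the determinant factor.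
  have htr : ∑ t, chernX F X e x t t s
      = ∑ d, e.jac e' x d s * ∑ t, chernX F X e' (e.transition e' x) t t d
        + ((e.jac e' x)⁻¹ * Matrix.of fun c m => e.hess e' x c s m).trace := by
    let N : Matrix (Fin n) (Fin n) ℝ :=
      Matrix.of fun c a => ∑ d, chernX F X e' (e.transition e' x) c a d * e.jac e' x d s
    have h1 : e.jac e' x * Matrix.of (fun k i => chernX F X e x k i s)
        = N * e.jac e' x + Matrix.of fun c m => e.hess e' x c s m := by
      ext c i
      rw [Matrix.mul_apply, Matrix.add_apply]
      refine (hF.chernX_transition hX0 hx c i s).trans ?_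
      -- The trace pairs the upper index with the first lower one, so `s` sits in the second slot.
      -- Symmetry of H brings it back to the first.
      rw [Matrix.of_apply, Matrix.mul_apply, hess_symm hx]
      congr 1
      refine Finset.sum_congr rfl fun a _ => ?_
      simp only [N, Matrix.of_apply, Finset.sum_mul]
      exact Finset.sum_congr rfl fun b _ => by ring
    have h2 : Matrix.of (fun k i => chernX F X e x k i s) = (e.jac e' x)⁻¹ *
        (N * e.jac e' x + Matrix.of fun c m => e.hess e' x c s m) := by
      rw [← h1, Matrix.nonsing_inv_mul_cancel_left _ _ hJu]
    have h3 := congrArg Matrix.trace h2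
    rw [Matrix.mul_add, Matrix.trace_add, Matrix.trace_mul_comm,
      Matrix.mul_nonsing_inv_cancel_right _ _ hJu] at h3
    refine h3.trans ?_
    congr 1
    simp only [Matrix.trace, Matrix.diag, N, Matrix.of_apply, Finset.mul_sum]
    rw [Finset.sum_comm]
    exact Finset.sum_congr rfl fun a _ => Finset.sum_congr rfl fun b _ => by ring
  -- The value of `p'` is abstracted as `Q`, so that the density law can replace it at this one
  -- point while the derivatives of `p'` stay untouched.
  have hL' : ∀ Q : Matrix (Fin n) (Fin n) ℝ, p' (e.transition e' x) = Q →
      ∑ d, e.jac e' x d s • Matrix.of (covDeriv F X δ e' p' (e.transition e' x) d)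
        = ∑ d, e.jac e' x d s • Matrix.of (fun i j => pd d (fun z => p' z i j)
            (e.transition e' x))
          + (∑ d, e.jac e' x d s •
              Matrix.of fun i m => chernX F X e' (e.transition e' x) i d m) * Q
          + Q * (∑ d, e.jac e' x d s •
              Matrix.of fun i m => chernX F X e' (e.transition e' x) i d m).transpose
          - (δ * ∑ d, e.jac e' x d s * ∑ t, chernX F X e' (e.transition e' x) t t d) • Q := by
    rintro Q rfl
    rw [Matrix.transpose_sum, Finset.sum_mul, Finset.mul_sum, Finset.mul_sum, Finset.sum_smul,
      ← Finset.sum_add_distrib, ← Finset.sum_add_distrib, ← Finset.sum_sub_distrib]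
    refine Finset.sum_congr rfl fun d _ => ?_
    rw [covDeriv_eq, Matrix.transpose_smul, Matrix.smul_mul, Matrix.mul_smul, smul_sub, smul_add,
      smul_add, smul_smul, mul_left_comm]
  rw [hL' _ (h x hx), hD, covDeriv_eq, htr]
  -- From here on it is matrix algebra. The H-terms from differentiating J p Jᵗ match those of J G =
  -- S J + H and its transpose, and `r'` matches the determinant term.
  generalize Matrix.of (fun i m => chernX F X e x i s m) = G at hG ⊢
  generalize (∑ d, e.jac e' x d s •
    Matrix.of fun i m => chernX F X e' (e.transition e' x) i d m) = S at hG ⊢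
  generalize (∑ d, e.jac e' x d s * ∑ t, chernX F X e' (e.transition e' x) t t d) = r
  generalize (Matrix.of fun c m => e.hess e' x c s m) = H at hG ⊢
  generalize ((e.jac e' x)⁻¹ * H).trace = r'
  generalize |(e.jac e' x).det| ^ (-δ) = c
  generalize Matrix.of (fun i j => pd s (fun z => p z i j) x) = P'
  generalize e.jac e' x = J at hG ⊢
  have hG' : G.transpose * J.transpose = J.transpose * S.transpose + H.transpose := by
    rw [← Matrix.transpose_mul, hG, Matrix.transpose_add, Matrix.transpose_mul]
  have e1 : J * (P' + G * p x + p x * G.transpose - (δ * (r + r')) • p x) * J.transpose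
      = J * P' * J.transpose + (J * G) * p x * J.transpose
        + J * p x * (G.transpose * J.transpose) - (δ * (r + r')) • (J * p x * J.transpose) := by
    simp only [Matrix.mul_add, Matrix.add_mul, Matrix.mul_sub, Matrix.sub_mul, Matrix.mul_smul,
      Matrix.smul_mul, Matrix.mul_assoc]
  rw [e1, hG, hG']
  simp only [Matrix.mul_add, Matrix.add_mul, Matrix.mul_smul, Matrix.smul_mul, Matrix.mul_assoc]
  module

/-- The operator `g^{sk} g_{ij} D_s` maps tensor densities to vector densities. -/
theorem gD_transition (hF : IsFinsler F) (hX0 : ∀ x, X x ≠ 0) {δ : ℝ}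
    (hx : x ∈ e.overlap e') {p p' : Coord n → Matrix (Fin n) (Fin n) ℝ}
    (hp : ∀ i j, ContDiffOn ℝ ∞ (fun z => p z i j) e.1.target)
    (hp' : ∀ i j, ContDiffOn ℝ ∞ (fun z => p' z i j) e'.1.target)
    (h : ∀ z ∈ e.overlap e', p' (e.transition e' z)
      = |(e.jac e' z).det| ^ (-δ) • (e.jac e' z * p z * (e.jac e' z).transpose)) :
    gD F X δ e' p' (e.transition e' x)
      = |(e.jac e' x).det| ^ (-δ) • (e.jac e' x).mulVec (gD F X δ e p x) := by
  have key : ∀ (e : Chart n M) (p : Coord n → Matrix (Fin n) (Fin n) ℝ) (x : Coord n),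
      gD F X δ e p x = (gUpX F X e x).transpose *ᵥ fun s =>
        ((gLowX F X e x).transpose * Matrix.of (covDeriv F X δ e p x s)).trace := by
    intro e p x
    funext k
    simp only [gD, Matrix.mulVec, dotProduct, Matrix.transpose_apply, Matrix.trace, Matrix.diag,
      Matrix.mul_apply, Matrix.of_apply, Finset.mul_sum]
    refine Finset.sum_congr rfl fun s _ => ?_
    rw [Finset.sum_comm]
    exact Finset.sum_congr rfl fun i _ => Finset.sum_congr rfl fun j _ => by ring
  -- Contracting the covariant derivative with `g_{ij}` leaves a covector density in `s`. The law is
  -- stated with Jᵗ on the primed side, which avoids inverting J, and the matrix `g^{sk}` then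
  -- raises the index.
  have hτ : (e.jac e' x).transpose *ᵥ (fun d => ((gLowX F X e' (e.transition e' x)).transpose *
        Matrix.of (covDeriv F X δ e' p' (e.transition e' x) d)).trace)
      = |(e.jac e' x).det| ^ (-δ) • fun s =>
        ((gLowX F X e x).transpose * Matrix.of (covDeriv F X δ e p x s)).trace := by
    funext s
    have h1 : ((e.jac e' x).transpose *ᵥ (fun d =>
        ((gLowX F X e' (e.transition e' x)).transpose *
          Matrix.of (covDeriv F X δ e' p' (e.transition e' x) d)).trace)) s
        = ((gLowX F X e' (e.transition e' x)).transpose * ∑ d, e.jac e' x d s •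
          Matrix.of (covDeriv F X δ e' p' (e.transition e' x) d)).trace := by
      rw [Finset.mul_sum, Matrix.trace_sum]
      simp only [Matrix.mul_smul, Matrix.trace_smul]
      rfl
    rw [h1, hF.covDeriv_transition hX0 hx hp hp' h s, Matrix.mul_smul, Matrix.trace_smul,
      Pi.smul_apply, hF.gLowX_transition hX0 hx, Matrix.transpose_mul, Matrix.transpose_mul,
      Matrix.transpose_transpose, Matrix.mul_assoc (e.jac e' x).transpose,
      Matrix.trace_mul_comm (e.jac e' x).transpose,
      Matrix.mul_assoc, Matrix.mul_assoc, Matrix.mul_assoc]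
  rw [key, key, hF.gUpX_transition hX0 hx, Matrix.transpose_mul, Matrix.transpose_mul,
    Matrix.transpose_transpose, ← Matrix.mul_assoc, ← Matrix.mulVec_mulVec, hτ,
    Matrix.mulVec_smul, Matrix.mulVec_mulVec]

end IsFinsler

end Finsler

namespace Finsler

variable {n : ℕ} {M : Type*} [TopologicalSpace M] [ChartedSpace (Coord n) M]
  [IsManifold (𝓡 n) ∞ M]

/-! ### The operator in local coordinates -/

section Coefficients

variable (F : TangentBundle (𝓡 n) M → ℝ) (X : (x : M) → TangentSpace (𝓡 n) x)

/-- The coefficients of order zero of `g^{sk} g_{ij} D_s`. -/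
def gDZero (δ : ℝ) (e : Chart n M) (x : Coord n) (k i j : Fin n) : ℝ :=
  ∑ s, gUpX F X e x s k * (∑ a, gLowX F X e x a j * chernX F X e x a s i
    + ∑ a, gLowX F X e x i a * chernX F X e x a s j
    - δ * (∑ t, chernX F X e x t t s) * gLowX F X e x i j)

/-- The operator is sorted by order: dummy indices in the connection terms are renamed until
`P^{ij}` factors out. -/
theorem gD_eq (δ : ℝ) (e : Chart n M) (p : Coord n → Matrix (Fin n) (Fin n) ℝ) (x : Coord n)
    (k : Fin n) : gD F X δ e p x k = ∑ i, ∑ j, gDZero F X δ e x k i j * p x i j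
      + ∑ s, ∑ i, ∑ j, gUpX F X e x s k * gLowX F X e x i j * pd s (fun z => p z i j) x := by
  have h1 : ∀ s, ∑ i, ∑ j, gLowX F X e x i j * ∑ m, chernX F X e x i s m * p x m j
      = ∑ i, ∑ j, (∑ a, gLowX F X e x a j * chernX F X e x a s i) * p x i j := fun s => by
    simp only [Finset.mul_sum, Finset.sum_mul]
    calc _ = ∑ a, ∑ i, ∑ j, gLowX F X e x a j * (chernX F X e x a s i * p x i j) :=
          Finset.sum_congr rfl fun a _ => Finset.sum_comm
      _ = ∑ i, ∑ a, ∑ j, gLowX F X e x a j * (chernX F X e x a s i * p x i j) := Finset.sum_comm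
      _ = ∑ i, ∑ j, ∑ a, gLowX F X e x a j * (chernX F X e x a s i * p x i j) :=
          Finset.sum_congr rfl fun i _ => Finset.sum_comm
      _ = _ := by simp only [mul_assoc]
  have h2 : ∀ s, ∑ i, ∑ j, gLowX F X e x i j * ∑ m, chernX F X e x j s m * p x i m
      = ∑ i, ∑ j, (∑ a, gLowX F X e x i a * chernX F X e x a s j) * p x i j := fun s => by
    simp only [Finset.mul_sum, Finset.sum_mul]
    refine Finset.sum_congr rfl fun i _ => ?_
    rw [Finset.sum_comm]
    simp only [mul_assoc]
  have h3 : ∀ s, ∑ i, ∑ j, gUpX F X e x s k * gLowX F X e x i j * covDeriv F X δ e p x s i j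
      = ∑ i, ∑ j, gUpX F X e x s k * (∑ a, gLowX F X e x a j * chernX F X e x a s i
          + ∑ a, gLowX F X e x i a * chernX F X e x a s j
          - δ * (∑ t, chernX F X e x t t s) * gLowX F X e x i j) * p x i j
        + ∑ i, ∑ j, gUpX F X e x s k * gLowX F X e x i j * pd s (fun z => p z i j) x :=
    fun s => by
      have e0 : ∑ i, ∑ j, gUpX F X e x s k * gLowX F X e x i j * covDeriv F X δ e p x s i j
          = gUpX F X e x s k * ∑ i, ∑ j, (gLowX F X e x i j * pd s (fun z => p z i j) x
            + gLowX F X e x i j * ∑ m, chernX F X e x i s m * p x m j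
            + gLowX F X e x i j * ∑ m, chernX F X e x j s m * p x i m
            - δ * (∑ t, chernX F X e x t t s) * gLowX F X e x i j * p x i j) := by
        rw [Finset.mul_sum]
        refine Finset.sum_congr rfl fun i _ => ?_
        rw [Finset.mul_sum]
        refine Finset.sum_congr rfl fun j _ => ?_
        rw [covDeriv]
        ring
      rw [e0]
      simp only [Finset.sum_add_distrib, Finset.sum_sub_distrib]
      rw [h1 s, h2 s]
      simp only [mul_assoc (gUpX F X e x s k), ← Finset.mul_sum, add_mul, sub_mul,
        Finset.sum_add_distrib, Finset.sum_sub_distrib]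
      ring
  simp only [gD, h3, Finset.sum_add_distrib, gDZero, Finset.sum_mul]
  congr 1
  rw [Finset.sum_comm]
  exact Finset.sum_congr rfl fun i _ => Finset.sum_comm

variable (u : CotangentMorphism n M)

/-- The coefficients of the operator in the chart `e`. -/
def schwarzianCoeffs (δ : ℝ) (f : Diff n M) (e : Chart n M) : Coeffs n
  | 0, _, k, i, j, x => gDZero F X δ (e.comp f.symm) x k i j - gDZero F X δ e x k i j
      + zeroOrder F X u δ f e x k i j
  | 1, I, k, i, j, x => gUpX F X (e.comp f.symm) x (I 0) k * gLowX F X (e.comp f.symm) x i j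
      - gUpX F X e x (I 0) k * gLowX F X e x i j
  | _, _, _, _, _, _ => 0

/-- Valid for arbitrary `p`, smooth or not. Linearity, smoothness of the image and the order of the
operator are then general facts about `Coeffs.eval`. -/
theorem schwarzian_eq_eval (δ : ℝ) (f : Diff n M) (e : Chart n M)
    (p : Coord n → Matrix (Fin n) (Fin n) ℝ) (x : Coord n) (k : Fin n) :
    schwarzian F X u δ f e p x k = (schwarzianCoeffs F X u δ f e).eval 1 p x k := by
  have h1 : ∑ I : Fin 1 → Fin n, ∑ i, ∑ j, schwarzianCoeffs F X u δ f e 1 I k i j x *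
        iteratedFDeriv ℝ 1 (fun z => p z i j) x (fun l => EuclideanSpace.single (I l) 1)
      = ∑ s, ∑ i, ∑ j, (gUpX F X (e.comp f.symm) x s k * gLowX F X (e.comp f.symm) x i j
        - gUpX F X e x s k * gLowX F X e x i j) * pd s (fun z => p z i j) x :=
    Fintype.sum_equiv (Equiv.funUnique (Fin 1) (Fin n)) _ _ fun I => by
      simp only [iteratedFDeriv_one_apply]
      rfl
  rw [Coeffs.eval, Finset.sum_range_succ, Finset.sum_range_one, h1, Fintype.sum_unique]
  simp only [iteratedFDeriv_zero_apply, schwarzianCoeffs, schwarzian, pullback, gD_eq, add_mul,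
    sub_mul, Finset.sum_add_distrib, Finset.sum_sub_distrib]
  ring

/-- Smoothness of both summands is needed because derivatives take default values where they do not
exist, and those need not be additive. -/
theorem Coeffs.eval_add_of_contDiffOn (a : Coeffs n) {s : Set (Coord n)} (hs : IsOpen s)
    {p q : Coord n → Matrix (Fin n) (Fin n) ℝ}
    (hp : ∀ i j, ContDiffOn ℝ ∞ (fun z => p z i j) s)
    (hq : ∀ i j, ContDiffOn ℝ ∞ (fun z => q z i j) s) {x : Coord n} (hx : x ∈ s) (N : ℕ)
    (k : Fin n) : a.eval N (p + q) x k = a.eval N p x k + a.eval N q x k := by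
  have h : ∀ m i j, iteratedFDeriv ℝ m (fun z => (p + q) z i j) x
      = iteratedFDeriv ℝ m (fun z => p z i j) x + iteratedFDeriv ℝ m (fun z => q z i j) x :=
    fun m i j => iteratedFDeriv_add_apply
      (((hp i j).contDiffAt (hs.mem_nhds hx)).of_le (WithTop.coe_le_coe.2 le_top))
      (((hq i j).contDiffAt (hs.mem_nhds hx)).of_le (WithTop.coe_le_coe.2 le_top))
  simp only [Coeffs.eval, h, _root_.add_apply, mul_add, Finset.sum_add_distrib]

theorem Coeffs.eval_smul (a : Coeffs n) {s : Set (Coord n)} (hs : IsOpen s) (c : ℝ)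
    {p : Coord n → Matrix (Fin n) (Fin n) ℝ}
    (hp : ∀ i j, ContDiffOn ℝ ∞ (fun z => p z i j) s) {x : Coord n} (hx : x ∈ s) (N : ℕ)
    (k : Fin n) : a.eval N (c • p) x k = c * a.eval N p x k := by
  have h : ∀ m i j, iteratedFDeriv ℝ m (fun z => (c • p) z i j) x
      = c • iteratedFDeriv ℝ m (fun z => p z i j) x :=
    fun m i j => iteratedFDeriv_const_smul_apply (a := c) (f := fun z => p z i j)
      (((hp i j).contDiffAt (hs.mem_nhds hx)).of_le (WithTop.coe_le_coe.2 le_top))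
  simp only [Coeffs.eval, h, _root_.smul_apply, smul_eq_mul,
    mul_left_comm _ c, Finset.mul_sum]

theorem Coeffs.contDiffOn_eval (a : Coeffs n) {s : Set (Coord n)} (hs : IsOpen s)
    (ha : ∀ m I k i j, ContDiffOn ℝ ∞ (a m I k i j) s)
    {p : Coord n → Matrix (Fin n) (Fin n) ℝ}
    (hp : ∀ i j, ContDiffOn ℝ ∞ (fun z => p z i j) s) (N : ℕ) (k : Fin n) :
    ContDiffOn ℝ ∞ (fun x => a.eval N p x k) s := by
  refine ContDiffOn.sum fun m _ => ContDiffOn.sum fun I _ => ContDiffOn.sum fun i _ =>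
    ContDiffOn.sum fun j _ => (ha m I k i j).mul fun x hx => ContDiffAt.contDiffWithinAt ?_
  have h := ((hp i j).contDiffAt (hs.mem_nhds hx)).iteratedFDeriv_right (m := ∞) (i := m) le_rfl
  exact (ContinuousMultilinearMap.apply ℝ (fun _ : Fin m => Coord n) ℝ
    (fun l => EuclideanSpace.single (I l) 1)).contDiff.contDiffAt.comp x h

end Coefficients

/-! ### Smooth coefficients and the global operator. -/

namespace IsFinsler

variable {F : TangentBundle (𝓡 n) M → ℝ} {X : (x : M) → TangentSpace (𝓡 n) x} {δ : ℝ}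

theorem contDiffOn_gLowX (hF : IsFinsler F)
    (hX : ContMDiff (𝓡 n) (𝓡 n).tangent ∞ (fun x => (⟨x, X x⟩ : TangentBundle (𝓡 n) M)))
    (hX0 : ∀ x, X x ≠ 0) (e : Chart n M) (i j : Fin n) :
    ContDiffOn ℝ ∞ (fun x => gLowX F X e x i j) e.1.target :=
  contDiffOn_subst hX hX0 e ((hF.finslerOn e).smooth_gLow i j)

theorem contDiffOn_gUpX (hF : IsFinsler F)
    (hX : ContMDiff (𝓡 n) (𝓡 n).tangent ∞ (fun x => (⟨x, X x⟩ : TangentBundle (𝓡 n) M)))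
    (hX0 : ∀ x, X x ≠ 0) (e : Chart n M) (i j : Fin n) :
    ContDiffOn ℝ ∞ (fun x => gUpX F X e x i j) e.1.target :=
  contDiffOn_subst hX hX0 e ((hF.finslerOn e).smooth_gUp i j)

theorem contDiffOn_chernX (hF : IsFinsler F)
    (hX : ContMDiff (𝓡 n) (𝓡 n).tangent ∞ (fun x => (⟨x, X x⟩ : TangentBundle (𝓡 n) M)))
    (hX0 : ∀ x, X x ≠ 0) (e : Chart n M) (k i j : Fin n) :
    ContDiffOn ℝ ∞ (fun x => chernX F X e x k i j) e.1.target :=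
  contDiffOn_subst hX hX0 e ((hF.finslerOn e).smooth_chern k i j)

theorem contDiffOn_bX (hF : IsFinsler F) (u : CotangentMorphism n M)
    (hX : ContMDiff (𝓡 n) (𝓡 n).tangent ∞ (fun x => (⟨x, X x⟩ : TangentBundle (𝓡 n) M)))
    (hX0 : ∀ x, X x ≠ 0) (e : Chart n M) (k i j : Fin n) :
    ContDiffOn ℝ ∞ (fun x => bX F X u e x k i j) e.1.target :=
  contDiffOn_subst hX hX0 e ((hF.finslerOn e).smooth_bTensor (hF.smooth_dLog u e) k i j)

theorem contDiffOn_gDZero (hF : IsFinsler F)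
    (hX : ContMDiff (𝓡 n) (𝓡 n).tangent ∞ (fun x => (⟨x, X x⟩ : TangentBundle (𝓡 n) M)))
    (hX0 : ∀ x, X x ≠ 0) (δ : ℝ) (e : Chart n M) (k i j : Fin n) :
    ContDiffOn ℝ ∞ (fun x => gDZero F X δ e x k i j) e.1.target := by
  have hg := hF.contDiffOn_gLowX hX hX0 e
  have hc := hF.contDiffOn_chernX hX hX0 e
  exact ContDiffOn.sum fun s _ => (hF.contDiffOn_gUpX hX hX0 e s k).mul
    (((ContDiffOn.sum fun a _ => (hg a j).mul (hc a s i)).add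
      (ContDiffOn.sum fun a _ => (hg i a).mul (hc a s j))).sub
      ((contDiffOn_const.mul (ContDiffOn.sum fun t _ => hc t t s)).mul (hg i j)))

theorem contDiffOn_gB (hF : IsFinsler F) (u : CotangentMorphism n M)
    (hX : ContMDiff (𝓡 n) (𝓡 n).tangent ∞ (fun x => (⟨x, X x⟩ : TangentBundle (𝓡 n) M)))
    (hX0 : ∀ x, X x ≠ 0) (δ : ℝ) (e : Chart n M) (k i j : Fin n) :
    ContDiffOn ℝ ∞ (fun x => gB F X u δ e x k i j) e.1.target := by
  have hg := hF.contDiffOn_gLowX hX hX0 e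
  have hb := hF.contDiffOn_bX u hX hX0 e
  exact ContDiffOn.sum fun l _ => (hF.contDiffOn_gUpX hX hX0 e k l).mul
    ((ContDiffOn.sum fun s _ => ((hg s j).mul (hb s l i)).add ((hg s i).mul (hb s l j))).sub
      ((contDiffOn_const.mul (hg i j)).mul (ContDiffOn.sum fun t _ => hb t l t)))

theorem contDiffOn_zeroOrder (hF : IsFinsler F) (u : CotangentMorphism n M)
    (hX : ContMDiff (𝓡 n) (𝓡 n).tangent ∞ (fun x => (⟨x, X x⟩ : TangentBundle (𝓡 n) M)))
    (hX0 : ∀ x, X x ≠ 0) (δ : ℝ) (f : Diff n M) (e : Chart n M) (k i j : Fin n) :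
    ContDiffOn ℝ ∞ (fun x => zeroOrder F X u δ f e x k i j) e.1.target := by
  have hl : ∀ k i j, ContDiffOn ℝ ∞ (fun x => ell F X f e x k i j) e.1.target := fun k i j =>
    ContDiffOn.sub (hF.contDiffOn_chernX hX hX0 (e.comp f.symm) k i j)
      (hF.contDiffOn_chernX hX hX0 e k i j)
  have hb : ∀ k i j, ContDiffOn ℝ ∞ (fun x => deltaB F X u f e x k i j) e.1.target :=
    fun k i j => ContDiffOn.sub (hF.contDiffOn_bX u hX hX0 (e.comp f.symm) k i j)
      (hF.contDiffOn_bX u hX hX0 e k i j)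
  exact (((contDiffOn_const.mul ((hl k i j).sub (contDiffOn_const.mul
    ((contDiffOn_const.mul (ContDiffOn.sum fun t _ => hl t t j)).add
      (contDiffOn_const.mul (ContDiffOn.sum fun t _ => hl t t i)))))).add
    (hF.contDiffOn_gB u hX hX0 δ e k i j)).sub
    (hF.contDiffOn_gB u hX hX0 δ (e.comp f.symm) k i j)).sub
    (contDiffOn_const.mul ((hb k i j).sub (contDiffOn_const.mul
    ((contDiffOn_const.mul (ContDiffOn.sum fun t _ => hb t j t)).add
      (contDiffOn_const.mul (ContDiffOn.sum fun t _ => hb t i t))))))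

theorem contDiffOn_schwarzianCoeffs (hF : IsFinsler F) (u : CotangentMorphism n M)
    (hX : ContMDiff (𝓡 n) (𝓡 n).tangent ∞ (fun x => (⟨x, X x⟩ : TangentBundle (𝓡 n) M)))
    (hX0 : ∀ x, X x ≠ 0) (δ : ℝ) (f : Diff n M) (e : Chart n M) (m : ℕ) (I : Fin m → Fin n)
    (k i j : Fin n) : ContDiffOn ℝ ∞ (schwarzianCoeffs F X u δ f e m I k i j) e.1.target := by
  match m, I with
  | 0, I =>
    exact (ContDiffOn.sub (hF.contDiffOn_gDZero hX hX0 δ (e.comp f.symm) k i j)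
      (hF.contDiffOn_gDZero hX hX0 δ e k i j)).add (hF.contDiffOn_zeroOrder u hX hX0 δ f e k i j)
  | 1, I =>
    exact ContDiffOn.sub (ContDiffOn.mul (hF.contDiffOn_gUpX hX hX0 (e.comp f.symm) (I 0) k)
      (hF.contDiffOn_gLowX hX hX0 (e.comp f.symm) i j))
      ((hF.contDiffOn_gUpX hX hX0 e (I 0) k).mul (hF.contDiffOn_gLowX hX hX0 e i j))
  | m + 2, I => exact contDiffOn_const

/-- The operator is a difference of two copies of `g^{sk} g_{ij} D_s`, in the charts `e` and e ∘
f⁻¹, plus a tensor of order zero. All three pieces transform with the same J and the same density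
factor. -/
theorem schwarzian_transition (hF : IsFinsler F) (u : CotangentMorphism n M)
    (hX0 : ∀ x, X x ≠ 0) (f : Diff n M) (P : SymDensity n M δ) {e e' : Chart n M} {x : Coord n}
    (hx : x ∈ e.overlap e') :
    schwarzian F X u δ f e' (P.1 e') (e.transition e' x)
      = |(e.jac e' x).det| ^ (-δ) •
        (e.jac e' x).mulVec (schwarzian F X u δ f e (P.1 e) x) := by
  obtain ⟨h1, h2, h3, h4⟩ := P.2
  have hD := hF.gD_transition hX0 hx (h1 e) (h1 e') fun z hz => h4 e e' z hz
  -- The components of `P` in `e` and `e'` also satisfy the density law for e ∘ f⁻¹ and e' ∘ f⁻¹,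
  -- since the transition map is unchanged.
  have hD' := hF.gD_transition hX0 (Chart.mem_overlap_comp hx f.symm) (p := P.1 e)
    (p' := P.1 e') (h1 e) (h1 e') fun z hz => by
      rw [Chart.overlap_comp] at hz
      rw [Chart.jac_comp, Chart.transition_comp]
      exact h4 e e' z hz
  rw [Chart.jac_comp, Chart.transition_comp] at hD'
  funext c
  have hZ := (hF.isTensor_zeroOrder hX0 u δ f hx).sum_mul_eq (P.1 e x)
    (|(e.jac e' x).det| ^ (-δ)) c
  have hP : P.1 e' (e.transition e' x) = _ := h4 e e' x hx
  rw [← hP] at hZ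
  have hDc := congrFun hD c
  have hDc' := congrFun hD' c
  rw [schwarzian, pullback, hDc, hDc', hZ]
  simp only [schwarzian, pullback, Pi.smul_apply, Matrix.mulVec, dotProduct, smul_eq_mul, mul_add,
    mul_sub,
    Finset.sum_add_distrib, Finset.sum_sub_distrib]

/-- The local expressions of the operator, extended by zero off the coordinate domains. -/
def localOperator (F : TangentBundle (𝓡 n) M → ℝ) (X : (x : M) → TangentSpace (𝓡 n) x)
    (u : CotangentMorphism n M) (δ : ℝ) (f : Diff n M)
    (p : Chart n M → Coord n → Matrix (Fin n) (Fin n) ℝ) (e : Chart n M) (x : Coord n) :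
    Fin n → ℝ :=
  Set.indicator e.1.target (schwarzian F X u δ f e (p e)) x

theorem localOperator_of_mem (u : CotangentMorphism n M) (δ : ℝ) (f : Diff n M)
    (p : Chart n M → Coord n → Matrix (Fin n) (Fin n) ℝ) {e : Chart n M} {x : Coord n}
    (hx : x ∈ e.1.target) : localOperator F X u δ f p e x = schwarzian F X u δ f e (p e) x :=
  Set.indicator_of_mem hx _

theorem localOperator_of_notMem (u : CotangentMorphism n M) (δ : ℝ) (f : Diff n M)
    (p : Chart n M → Coord n → Matrix (Fin n) (Fin n) ℝ) {e : Chart n M} {x : Coord n}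
    (hx : x ∉ e.1.target) : localOperator F X u δ f p e x = 0 :=
  Set.indicator_of_notMem hx _

/-- The operator `𝒜(f)`, with the vector field `X` substituted for `y`. -/
def operator (hF : IsFinsler F) (u : CotangentMorphism n M)
    (hX : ContMDiff (𝓡 n) (𝓡 n).tangent ∞ (fun x => (⟨x, X x⟩ : TangentBundle (𝓡 n) M)))
    (hX0 : ∀ x, X x ≠ 0) (δ : ℝ) (f : Diff n M) : SymDensity n M δ →ₗ[ℝ] VecDensity n M δ where
  toFun P := ⟨localOperator F X u δ f P.1, by
    refine ⟨fun e k => ?_, fun e x hx => localOperator_of_notMem u δ f P.1 hx,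
      fun e e' x hx => ?_⟩
    · refine ((schwarzianCoeffs F X u δ f e).contDiffOn_eval e.1.open_target
        (hF.contDiffOn_schwarzianCoeffs u hX hX0 δ f e) (P.2.1 e) 1 k).congr fun x hx => ?_
      rw [localOperator_of_mem u δ f P.1 hx, schwarzian_eq_eval]
    · rw [localOperator_of_mem u δ f P.1 hx.1]
      exact (localOperator_of_mem u δ f P.1 (Chart.transition_mem_target hx)).trans
        (hF.schwarzian_transition u hX0 f P hx)⟩
  map_add' P Q := by
    refine Subtype.ext (funext fun e => funext fun x => ?_)
    change localOperator F X u δ f (P + Q).1 e x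
      = localOperator F X u δ f P.1 e x + localOperator F X u δ f Q.1 e x
    by_cases hx : x ∈ e.1.target
    · simp only [localOperator_of_mem u δ f _ hx]
      funext k
      rw [Pi.add_apply, schwarzian_eq_eval, schwarzian_eq_eval, schwarzian_eq_eval]
      exact Coeffs.eval_add_of_contDiffOn _ e.1.open_target (P.2.1 e) (Q.2.1 e) hx 1 k
    · simp only [localOperator_of_notMem u δ f _ hx, add_zero]
  map_smul' c P := by
    refine Subtype.ext (funext fun e => funext fun x => ?_)
    change localOperator F X u δ f (c • P).1 e x = c • localOperator F X u δ f P.1 e x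
    by_cases hx : x ∈ e.1.target
    · simp only [localOperator_of_mem u δ f _ hx]
      funext k
      rw [Pi.smul_apply, schwarzian_eq_eval, schwarzian_eq_eval]
      exact Coeffs.eval_smul _ e.1.open_target c (P.2.1 e) hx 1 k
    · simp only [localOperator_of_notMem u δ f _ hx, smul_zero]

theorem operator_apply (hF : IsFinsler F) (u : CotangentMorphism n M)
    (hX : ContMDiff (𝓡 n) (𝓡 n).tangent ∞ (fun x => (⟨x, X x⟩ : TangentBundle (𝓡 n) M)))
    (hX0 : ∀ x, X x ≠ 0) (f : Diff n M) (P : SymDensity n M δ) {e : Chart n M} {x : Coord n}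
    (hx : x ∈ e.1.target) :
    (hF.operator u hX hX0 δ f P).1 e x = schwarzian F X u δ f e (P.1 e) x :=
  localOperator_of_mem u δ f P.1 hx

theorem hasOrder_operator (hF : IsFinsler F) (u : CotangentMorphism n M)
    (hX : ContMDiff (𝓡 n) (𝓡 n).tangent ∞ (fun x => (⟨x, X x⟩ : TangentBundle (𝓡 n) M)))
    (hX0 : ∀ x, X x ≠ 0) (δ : ℝ) (f : Diff n M) : HasOrder 1 (hF.operator u hX hX0 δ f) :=
  fun e => ⟨schwarzianCoeffs F X u δ f e, hF.contDiffOn_schwarzianCoeffs u hX hX0 δ f e,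
    fun P x hx k => by rw [hF.operator_apply u hX hX0 f P hx, schwarzian_eq_eval]⟩

end IsFinsler

/-! ### The cocycle relation. -/

theorem Chart.comp_trans (e : Chart n M) (f h : Diff n M) :
    (e.comp f).comp h = e.comp (h.trans f) :=
  Subtype.ext rfl

/-- The operator is the difference of two expressions of one and the same form. -/
theorem schwarzian_cocycle (F : TangentBundle (𝓡 n) M → ℝ)
    (X : (x : M) → TangentSpace (𝓡 n) x) (u : CotangentMorphism n M) (δ : ℝ) (f h : Diff n M)
    (e : Chart n M) (p : Coord n → Matrix (Fin n) (Fin n) ℝ) (x : Coord n) (k : Fin n) :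
    schwarzian F X u δ (h.trans f).symm e p x k
      = schwarzian F X u δ h.symm (e.comp f) p x k + schwarzian F X u δ f.symm e p x k := by
  have hs : ∀ g : Diff n M, g.symm.symm = g := fun _ => rfl
  -- Unfolded, only the charts e ∘ f ∘ h, e ∘ f and `e` occur. The terms of e ∘ f enter with both
  -- signs, and what remains is linear rearrangement.
  simp only [schwarzian, zeroOrder, ell, deltaB, pullback, hs, Chart.comp_trans]
  rw [add_add_add_comm, ← Finset.sum_add_distrib]
  congr 1
  · ring
  refine Finset.sum_congr rfl fun i _ => ?_
  rw [← Finset.sum_add_distrib]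
  refine Finset.sum_congr rfl fun j _ => ?_
  simp only [Finset.sum_sub_distrib]
  ring

/-- The cocycle relation. -/
theorem IsFinsler.operator_trans_symm {F : TangentBundle (𝓡 n) M → ℝ}
    {X : (x : M) → TangentSpace (𝓡 n) x} (hF : IsFinsler F) (u : CotangentMorphism n M)
    (hX : ContMDiff (𝓡 n) (𝓡 n).tangent ∞ (fun x => (⟨x, X x⟩ : TangentBundle (𝓡 n) M)))
    (hX0 : ∀ x, X x ≠ 0) (δ : ℝ) (f h : Diff n M) :
    hF.operator u hX hX0 δ (h.trans f).symm
      = VecDensity.push f ∘ₗ hF.operator u hX hX0 δ h.symm ∘ₗ SymDensity.push f.symm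
        + hF.operator u hX hX0 δ f.symm := by
  refine LinearMap.ext fun P => Subtype.ext (funext fun e => funext fun x => ?_)
  -- Transporting `P` by f⁻¹ and reading it in e ∘ f gives back the components of `P` in `e`, so
  -- both sides act on the same functions.
  have hP : (SymDensity.push f.symm P).1 (e.comp f) = P.1 e :=
    congrArg P.1 (Chart.comp_symm_comp e f)
  refine Eq.trans (b := (hF.operator u hX hX0 δ h.symm (SymDensity.push f.symm P)).1 (e.comp f) x
      + (hF.operator u hX hX0 δ f.symm P).1 e x) ?_ rfl
  by_cases hx : x ∈ e.1.target
  · rw [hF.operator_apply u hX hX0 _ P hx, hF.operator_apply u hX hX0 f.symm P hx,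
      hF.operator_apply u hX hX0 h.symm (SymDensity.push f.symm P) (e := e.comp f) hx, hP]
    exact funext fun k => schwarzian_cocycle F X u δ f h e (P.1 e) x k
  -- Off the coordinate domain all three terms are zero by the convention of extension by zero; `e`
  -- and e ∘ f have the same target.
  · rw [(hF.operator u hX hX0 δ (h.trans f).symm P).2.2.1 e x hx,
      (hF.operator u hX hX0 δ f.symm P).2.2.1 e x hx,
      (hF.operator u hX hX0 δ h.symm (SymDensity.push f.symm P)).2.2.1 (e.comp f) x hx, add_zero]

end Finsler
end

theorem proposition4p3 {n : ℕ} {M : Type*} [TopologicalSpace M] [T2Space M]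
    [SecondCountableTopology M] [ChartedSpace (Finsler.Coord n) M] [IsManifold (𝓡 n) ∞ M]
    (F : TangentBundle (𝓡 n) M → ℝ) (hF : Finsler.IsFinsler F)
    (u : Finsler.CotangentMorphism n M)
    (X : (x : M) → TangentSpace (𝓡 n) x)
    (hX : ContMDiff (𝓡 n) (𝓡 n).tangent ∞ (fun x => (⟨x, X x⟩ : TangentBundle (𝓡 n) M)))
    (hX0 : ∀ x, X x ≠ 0) (δ : ℝ) :
    ∃ A : Finsler.Diff n M → Finsler.DiffOp n M δ,
      (∀ (f : Finsler.Diff n M) (P : Finsler.SymDensity n M δ) (e : Finsler.Chart n M),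
        ∀ x ∈ e.1.target, ∀ k : Fin n,
          ((A f).1 P).1 e x k = Finsler.schwarzian F X u δ f e (P.1 e) x k) ∧
      Finsler.IsOneCocycle (fun f => A f.symm) := by
  exact ⟨fun f => ⟨hF.operator u hX hX0 δ f, 1, hF.hasOrder_operator u hX hX0 δ f⟩,
    fun f P e x hx k => congrFun (hF.operator_apply u hX hX0 f P hx) k,
    fun f h => Subtype.ext (hF.operator_trans_symm u hX hX0 δ f h)⟩
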